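/- For $N\ge 1$ let $\mathbb{GT}_N$ be the set of signatures $\lambda=(\lambda_1\ge\dots\ge\lambda_N)$, $\lambda_i\in\mathbb Z$, and write $\lambda\prec\mu$ for $\lambda\in\mathbb{GT}_N$, $\mu\in\mathbb{GT}_{N+1}$ if $\mu_1\ge\lambda_1\ge\mu_2\ge\dots\ge\lambda_N\ge\mu_{N+1}$. Let $\mathcal T$ be the space of infinite paths $\tau=(\tau(1)\prec\tau(2)\prec\cdots)$, $\tau(N)\in\mathbb{GT}_N$, with the topology and the Borel $\sigma$-algebra generated by the cylindrical sets $C_{(\tau(1),\dots,\tau(N))}$ (all infinite paths beginning with the given finite path). For a signature $\lambda$, let $\lambda^+$ be the Young diagram whose row lengths are the positive coordinates of $\lambda$, and $\lambda^-$ the Young diagram whose row lengths are the absolute values of its negative coordinates. Let $G^{\pm}\subset\mathcal T$ be the set of paths $\tau$ for which $\bigcup_N\tau^{\pm}(N)$ is the whole quadrant. For $z,w\in\mathbb C$ and $\lambda\in\mathbb{GT}_N$ put $$M_N^{z,w}(\lambda)=\frac1{S_N(z,w)}\prod_{i=1}^N\left|\frac1{\Gamma(z-\lambda_i+i)\,\Gamma(w+N+1+\lambda_i-i)}\right|^2\operatorname{Dim}_N^2(\lambda),\qquad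 P_N^{z,w}(\lambda)=\frac{M_N^{z,w}(\lambda)}{\operatorname{Dim}_N(\lambda)},$$ where $\operatorname{Dim}_N(\lambda)=\prod_{1\le i<j\le N}\frac{\lambda_i-\lambda_j+j-i}{j-i}$ and $S_N(z,w)$ is the constant that makes $\sum_{\lambda\in\mathbb{GT}_N}M_N^{z,w}(\lambda)=1$. Let $z,w,z',w'\in\mathbb C\setminus\mathbb Z$ with $\Re(z+w)>-\tfrac12$ and $\Re(z'+w')>-\tfrac12$. Then there is a unique Borel measure $\rho_{z,w}$ on $\mathcal T$ (the $(z,w)$-measure, a probability measure) such that $\rho_{z,w}(C_\tau)=P_N^{z,w}(\tau(N))$ for every finite path $\tau=(\tau(1),\dots,\tau(N))$, and likewise a unique $\rho_{z',w'}$. Let $\mathfrak Q\subset\mathcal T$ be the set of paths $\tau$ along which $P_N^{z,w}(\tau(N))/P_N^{z',w'}(\tau(N))$ tends to a finite nonzero limit as $N\to\infty$. Then: 1. If $\{z,\overline z\}\ne\{z',\overline{z'}\}$, then $\rho_{z,w}(\mathfrak Q\cap G^+)=\rho_{z',w'}(\mathfrak Q\cap G^+)=0$. 2. If $\{w,\overline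 w\}\ne\{w',\overline{w'}\}$, then $\rho_{z,w}(\mathfrak Q\cap G^-)=\rho_{z',w'}(\mathfrak Q\cap G^-)=0$. 3. If $\{z,\overline z\}\ne\{z',\overline{z'}\}$ and $\{w,\overline w\}\ne\{w',\overline{w'}\}$, then the measures $\rho_{z,w}$ and $\rho_{z',w'}$ are disjoint (mutually singular). -/

import Mathlib

open MeasureTheory Filter Topology
open scoped ComplexConjugate

noncomputable section

namespace GelfandTsetlin

/-- The set `GT_N` of signatures of length `N`, i.e. of integer tuples
`lam_1 ≥ lam_2 ≥ … ≥ lam_N`. The coordinate `lam_{i+1}` is `l.1 i` for `i : Fin N`. -/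
def Signature (N : ℕ) : Type := {l : Fin N → ℤ // Antitone l}

/-- The edges `l ≺ m` of the Gelfand-Tsetlin graph:
`m_1 ≥ l_1 ≥ m_2 ≥ l_2 ≥ … ≥ l_N ≥ m_{N+1}`. -/
def Interlaces {N : ℕ} (l : Signature N) (m : Signature (N + 1)) : Prop :=
  ∀ i : Fin N, l.1 i ≤ m.1 i.castSucc ∧ m.1 i.succ ≤ l.1 i

/-- Infinite paths `(t(1), t(2), …)` in the Gelfand-Tsetlin graph. The value `t(0)` is the empty
signature, the unique element of `GT_0`, and carries no information. -/
def Path : Type := {t : ∀ N : ℕ, Signature N // ∀ N, Interlaces (t N) (t (N + 1))}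

/-- `(s(1), …, s(N))` is a finite path (the values of `s` beyond `N` play no role). -/
def IsFinitePath (s : ∀ n : ℕ, Signature n) (N : ℕ) : Prop :=
  ∀ n < N, Interlaces (s n) (s (n + 1))

/-- The cylindrical set of all infinite paths which begin with `(s(1), …, s(N))`. -/
def cylinder (s : ∀ n : ℕ, Signature n) (N : ℕ) : Set Path :=
  {t | ∀ n ≤ N, t.1 n = s n}

/-- The family of all cylindrical sets of finite paths. -/
def cylinders : Set (Set Path) :=
  {C | ∃ (N : ℕ) (s : ∀ n : ℕ, Signature n), IsFinitePath s N ∧ C = cylinder s N}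

/-- The topology on the path space generated by the cylindrical sets. -/
instance : TopologicalSpace Path := TopologicalSpace.generateFrom cylinders

/-- The σ-algebra generated by the cylindrical sets; it is the Borel σ-algebra, see below. -/
instance : MeasurableSpace Path := MeasurableSpace.generateFrom cylinders

instance (N : ℕ) : Countable (Signature N) :=
  inferInstanceAs (Countable {l : Fin N → ℤ // Antitone l})

instance (N : ℕ) : Inhabited (Signature N) := ⟨⟨fun _ => 0, fun _ _ _ => le_rfl⟩⟩

lemma countable_cylinders : cylinders.Countable := by
  classical
  let F : (Σ N : ℕ, (∀ n : Fin (N + 1), Signature n)) → Set Path :=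
    fun p => {t | ∀ n : Fin (p.1 + 1), t.1 n = p.2 n}
  refine (Set.countable_range F).mono ?_
  rintro C ⟨N, s, -, rfl⟩
  refine ⟨⟨N, fun n => s n⟩, ?_⟩
  ext t
  constructor
  · intro h n hn
    exact h ⟨n, Nat.lt_succ_of_le hn⟩
  · intro h n
    exact h n (Nat.le_of_lt_succ n.2)

instance : SecondCountableTopology Path :=
  ⟨⟨cylinders, countable_cylinders, rfl⟩⟩

instance : BorelSpace Path := ⟨(borel_eq_generateFrom_of_subbasis rfl).symm⟩

/-- The boxes of the "positive" Young diagram of a signature: the box in row `i + 1` and column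
`j + 1` belongs to it if and only if `i + 1 ≤ N` and `j + 1 ≤ lam_{i+1}`. -/
def posDiagram {N : ℕ} (l : Signature N) : Set (ℕ × ℕ) :=
  {b | ∃ h : b.1 < N, (b.2 : ℤ) + 1 ≤ l.1 ⟨b.1, h⟩}

/-- The boxes of the "negative" Young diagram of a signature, whose successive rows have lengths
`-lam_N, -lam_{N-1}, …` (as long as these are positive). -/
def negDiagram {N : ℕ} (l : Signature N) : Set (ℕ × ℕ) :=
  {b | ∃ h : b.1 < N, (b.2 : ℤ) + 1 ≤ -l.1 (Fin.rev ⟨b.1, h⟩)}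

/-- The paths whose "positive" Young diagrams exhaust the whole quadrant. -/
def Gpos : Set Path := {t | ⋃ N : ℕ, posDiagram (t.1 N) = Set.univ}

/-- The paths whose "negative" Young diagrams exhaust the whole quadrant. -/
def Gneg : Set Path := {t | ⋃ N : ℕ, negDiagram (t.1 N) = Set.univ}

/-- The dimension `Dim_N(lam) = ∏_{i < j} (lam_i - lam_j + j - i) / (j - i)` of the irreducible
representation of `U(N)` with highest weight `lam`. -/
def Dim {N : ℕ} (l : Signature N) : ℝ :=
  ∏ i : Fin N, ∏ j ∈ Finset.Ioi i,
    ((l.1 i : ℝ) - (l.1 j : ℝ) + (j : ℝ) - (i : ℝ)) / ((j : ℝ) - (i : ℝ))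

/-- The product `∏_{i=1}^N |1 / (Γ(z - lam_i + i) Γ(w + N + 1 + lam_i - i))|²`; the index `i` of
the mathematical formula is `(i : ℕ) + 1` here. -/
def gammaWeight (z w : ℂ) {N : ℕ} (l : Signature N) : ℝ :=
  ∏ i : Fin N,
    ‖1 / (Complex.Gamma (z - (l.1 i : ℂ) + (((i : ℕ) + 1 : ℕ) : ℂ)) *
        Complex.Gamma (w + (N : ℂ) + 1 + (l.1 i : ℂ) - (((i : ℕ) + 1 : ℕ) : ℂ)))‖ ^ 2

/-- The normalization constant `S_N(z,w)`. -/
def S (z w : ℂ) (N : ℕ) : ℝ := ∑' l : Signature N, gammaWeight z w l * Dim l ^ 2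

/-- The coherent system `M_N^{z,w}`. -/
def M (z w : ℂ) {N : ℕ} (l : Signature N) : ℝ :=
  (S z w N)⁻¹ * gammaWeight z w l * Dim l ^ 2

/-- `P_N^{z,w}(lam) = M_N^{z,w}(lam) / Dim_N(lam)`. -/
def P (z w : ℂ) {N : ℕ} (l : Signature N) : ℝ := M z w l / Dim l

/-- `ρ` is the `(z,w)`-measure: the mass of the cylindrical set of a finite path with endpoint
`lam ∈ GT_N` is `P_N^{z,w}(lam)`. For `N = 0` this says that `ρ` has total mass one. -/
def IsZWMeasure (z w : ℂ) (ρ : Measure Path) : Prop :=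
  ∀ (N : ℕ) (s : ∀ n : ℕ, Signature n), IsFinitePath s N →
    ρ (cylinder s N) = ENNReal.ofReal (P z w (s N))

/-- The set of paths along which `P_N^{z,w} / P_N^{z',w'}` tends to a finite nonzero limit. -/
def Q (z w z' w' : ℂ) : Set Path :=
  {t | ∃ c : ℝ, c ≠ 0 ∧
    Tendsto (fun N : ℕ => P z w (t.1 N) / P z' w' (t.1 N)) atTop (𝓝 c)}

end GelfandTsetlin

end

/-! The mass of a cylinder depends only on its endpoint, so the argument rests on one-step
comparisons. In the shifted coordinates `l_i - i` the weight of a path is a product of one-particle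
weights times a Vandermonde determinant, and interlacing confines each coordinate to its own
interval. Summing over the next level then telescopes inside a determinant, which gives coherency
(`exists_coherency_const`) and, with the branching rule, the normalization and existence of the
measures.

For part 1, choose a natural number `c` with `|z - c| ≠ |z' - c|`. On a path in `Gpos`, infinitely
many steps carry some shifted row from below `c` to at least `c` (`exists_crosses_of_mem_Gpos`).
Putting that row at `c - 1` or at `c` instead changes the ratio `P / P'` by a factor tending to `|z
- c|² / |z' - c|² ≠ 1`, so at least one of the two positions makes the logarithm of the ratio jump
by a fixed `δ`. The weights decay summably to the right of `c`, uniformly in the level, so the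
probability of crossing is at most a constant times the probability of a jump (`tsum_crosses_le`).
First jumps are disjoint events, hence the probabilities of crossing before any jump are summable,
and Borel–Cantelli excludes infinitely many crossings without a jump (`measure_Q_inter_Gpos`).
Convergence of the ratio to a nonzero limit means that jumps eventually cease. Part 2 is part 1
after the reflection `λ ↦ -λ`, which exchanges `z` with `w`.

For part 3, almost every path lies in `Gpos ∪ Gneg`: otherwise some row is eventually frozen,
although at level `n` the odds of lengthening it are at least of order `1/n`, and the harmonic
series diverges (`measure_stays_eq_zero`). So `Q` is null. The ratio is the density of `ρ` with
respect to `ρ'` on initial segments, a nonnegative martingale; it converges `ρ'`-almost surely, its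
limit must be zero, and this is singularity (`mutuallySingular_of_measure_Q`). -/

namespace GelfandTsetlin

/-- The shifted coordinates `l_i - i` of an integer tuple, for the indexing `i = 1, …, N`. -/
def shifted {N : ℕ} (v : Fin N → ℤ) (i : Fin N) : ℤ := v i - ((i : ℕ) + 1 : ℕ)

/-- The one-particle weight of the measure `M_N^{z,w}`. -/
noncomputable def gammaFactor (z w : ℂ) (N : ℕ) (x : ℤ) : ℝ :=
  ‖1 / (Complex.Gamma (z - x) * Complex.Gamma (w + N + 1 + x))‖ ^ 2

/-- The dimension formula for an arbitrary integer tuple. -/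
noncomputable def dimFun {N : ℕ} (v : Fin N → ℤ) : ℝ :=
  ∏ i : Fin N, ∏ j ∈ Finset.Ioi i,
    ((v i : ℝ) - (v j : ℝ) + (j : ℝ) - (i : ℝ)) / ((j : ℝ) - (i : ℝ))

/-- The product of one-particle weights for an arbitrary integer tuple. -/
noncomputable def gammaFun (z w : ℂ) {N : ℕ} (v : Fin N → ℤ) : ℝ :=
  ∏ i, gammaFactor z w N (shifted v i)

lemma Dim_eq_dimFun {N : ℕ} (l : Signature N) : Dim l = dimFun l.1 := rfl

lemma gammaWeight_eq_gammaFun (z w : ℂ) {N : ℕ} (l : Signature N) :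
    gammaWeight z w l = gammaFun z w l.1 := by
  unfold gammaWeight gammaFun gammaFactor shifted
  refine Finset.prod_congr rfl fun i _ => ?_
  push_cast
  congr 6 <;> ring

/-! ### One-particle weights: recurrences, summability and decay. -/

section Gamma

variable {z w : ℂ}

lemma Gamma_ne_zero_of_forall_ne_int {s : ℂ} (hs : ∀ n : ℤ, s ≠ n) :
    Complex.Gamma s ≠ 0 :=
  Complex.Gamma_ne_zero fun m => by simpa using hs (-m)

lemma sub_int_ne (hz : ∀ n : ℤ, z ≠ n) (x n : ℤ) : z - x ≠ n := by
  intro h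
  apply hz (n + x)
  push_cast
  rw [← h]; ring

lemma add_int_ne (hz : ∀ n : ℤ, z ≠ n) (x n : ℤ) : z + x ≠ n := by
  have := sub_int_ne hz (-x) n
  push_cast at this
  simpa using this

lemma norm_sub_int_pos (hz : ∀ n : ℤ, z ≠ n) (x : ℤ) : 0 < ‖z - x - 1‖ := by
  rw [norm_pos_iff, sub_ne_zero]
  simpa using sub_int_ne hz x 1

lemma norm_add_int_pos (hw : ∀ n : ℤ, w ≠ n) (N : ℕ) (x : ℤ) : 0 < ‖w + N + 1 + x‖ := by
  rw [norm_pos_iff]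
  have := add_int_ne hw (N + 1 + x) 0
  push_cast at this
  simpa [add_assoc] using this

lemma gammaFactor_pos (hz : ∀ n : ℤ, z ≠ n) (hw : ∀ n : ℤ, w ≠ n) (N : ℕ) (x : ℤ) :
    0 < gammaFactor z w N x := by
  unfold gammaFactor
  have h1 := Gamma_ne_zero_of_forall_ne_int (sub_int_ne hz x)
  have h2 : Complex.Gamma (w + N + 1 + x) ≠ 0 := by
    have := Gamma_ne_zero_of_forall_ne_int (add_int_ne hw (N + 1 + x))
    push_cast at this
    rwa [← add_assoc, ← add_assoc] at this
  exact pow_pos (norm_pos_iff.2 (one_div_ne_zero (mul_ne_zero h1 h2))) 2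

/-- Raising the level by one. -/
lemma gammaFactor_succ (hw : ∀ n : ℤ, w ≠ n) (N : ℕ) (x : ℤ) :
    gammaFactor z w N x = gammaFactor z w (N + 1) x * ‖w + N + 1 + x‖ ^ 2 := by
  unfold gammaFactor
  have h0 : w + N + 1 + x ≠ 0 := norm_pos_iff.1 (norm_add_int_pos hw N x)
  have h : Complex.Gamma (w + (N + 1 : ℕ) + 1 + x) =
      (w + N + 1 + x) * Complex.Gamma (w + N + 1 + x) := by
    rw [← Complex.Gamma_add_one _ h0]
    push_cast
    congr 1; ring
  rw [h, ← mul_pow, ← norm_mul]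
  congr 2
  field_simp

/-- Raising the level and moving the particle by one. -/
lemma gammaFactor_add_one (hz : ∀ n : ℤ, z ≠ n) (N : ℕ) (x : ℤ) :
    gammaFactor z w N (x + 1) = gammaFactor z w (N + 1) x * ‖z - x - 1‖ ^ 2 := by
  unfold gammaFactor
  have h0 : z - x - 1 ≠ 0 := norm_pos_iff.1 (norm_sub_int_pos hz x)
  have h : Complex.Gamma (z - x) = (z - x - 1) * Complex.Gamma (z - x - 1) := by
    rw [← Complex.Gamma_add_one _ h0]
    congr 1; ring
  have h2 : w + (N + 1 : ℕ) + 1 + x = w + N + 1 + (x + 1 : ℤ) := by push_cast; ring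
  have h3 : z - (x + 1 : ℤ) = z - x - 1 := by push_cast; ring
  rw [h, h2, h3, ← mul_pow, ← norm_mul]
  congr 2
  field_simp

/-- Moving the particle by one at a fixed level. -/
lemma gammaFactor_step (hz : ∀ n : ℤ, z ≠ n) (hw : ∀ n : ℤ, w ≠ n) (N : ℕ) (x : ℤ) :
    gammaFactor z w N (x + 1) * ‖w + N + 1 + x‖ ^ 2 = gammaFactor z w N x * ‖z - x - 1‖ ^ 2 := by
  rw [gammaFactor_add_one hz, gammaFactor_succ hw N x]; ring

/-- The reflection `x ↦ -(N + 1) - x` exchanges the two gamma functions. It reduces the left tail to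
the right tail here and underlies the duality of signatures later. -/
lemma gammaFactor_swap (N : ℕ) (x : ℤ) :
    gammaFactor z w N x = gammaFactor w z N (-(N + 1) - x) := by
  unfold gammaFactor
  push_cast
  rw [mul_comm]
  congr 5 <;> ring

/-- The Raabe test. -/
lemma summable_of_raabe {u : ℕ → ℝ} (hu : ∀ n, 0 ≤ u n) {δ : ℝ} (hδ : 0 < δ) {n₀ : ℕ}
    (h : ∀ n ≥ n₀, δ * u (n + 1) ≤ n * u n - (n + 1) * u (n + 1)) : Summable u := by
  rw [← summable_nat_add_iff (n₀ + 1)]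
  refine summable_of_sum_range_le (c := n₀ * u n₀ / δ) (fun _ => hu _) fun n => ?_
  rw [le_div_iff₀ hδ]
  -- The right-hand side of the hypothesis telescopes.
  have : ∀ n : ℕ, (∑ i ∈ Finset.range n, u (i + (n₀ + 1))) * δ ≤
      n₀ * u n₀ - ((n₀ + n : ℕ) : ℝ) * u (n₀ + n) := by
    intro n
    induction n with
    | zero => simp
    | succ k ih =>
      rw [Finset.sum_range_succ, add_mul]
      have := h (n₀ + k) (by omega)
      have e : k + (n₀ + 1) = n₀ + k + 1 := by ring
      have e' : n₀ + (k + 1) = n₀ + k + 1 := by ring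
      rw [e, e']
      push_cast at ih this ⊢
      linarith
  refine (this n).trans ?_
  have := mul_nonneg (Nat.cast_nonneg (α := ℝ) (n₀ + n)) (hu (n₀ + n))
  linarith

lemma sq_norm_eq (s : ℂ) : ‖s‖ ^ 2 = s.re ^ 2 + s.im ^ 2 := by
  rw [Complex.sq_norm, Complex.normSq_apply]; ring

/-- Consecutive terms have ratio `|n + 1 - z|² / |n + 2 + w|² = 1 - 2(1 + Re (z + w))/n + O(1/n²)`,
so Raabe's test asks for exactly `Re (z + w) > -1/2`. The margin is `2δ`; half of it absorbs the
lower-order terms. -/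
lemma summable_gammaFactor_nat (hz : ∀ n : ℤ, z ≠ n) (hw : ∀ n : ℤ, w ≠ n)
    (hzw : -(1 / 2 : ℝ) < (z + w).re) : Summable fun n : ℕ => gammaFactor z w 1 n := by
  set δ : ℝ := z.re + w.re + 1 / 2 with hδ
  have hδ0 : 0 < δ := by rw [Complex.add_re] at hzw; linarith
  set E1 : ℝ := (w.re + 2) ^ 2 + w.im ^ 2 - ((1 - z.re) ^ 2 + z.im ^ 2) -
    (1 + δ) * (2 * (1 - z.re)) with hE1
  set E0 : ℝ := -(1 + δ) * ((1 - z.re) ^ 2 + z.im ^ 2) with hE0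
  obtain ⟨n₀, hn₀⟩ := exists_nat_ge ((|E1| + |E0|) / δ + 1)
  refine summable_of_raabe (fun n => (gammaFactor_pos hz hw 1 n).le) hδ0 (n₀ := n₀) ?_
  intro n hn
  have hn' : (|E1| + |E0|) / δ + 1 ≤ n := hn₀.trans (by exact_mod_cast hn)
  have hn1 : (1 : ℝ) ≤ n := by
    have : 0 ≤ (|E1| + |E0|) / δ := by positivity
    linarith
  have hn2 : |E1| + |E0| ≤ δ * n := by
    have : (|E1| + |E0|) / δ ≤ n := by linarith
    rw [div_le_iff₀ hδ0] at this
    linarith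
  have hs := gammaFactor_step hz hw 1 n
  have hp := norm_add_int_pos hw 1 n
  have hp2 : 0 < ‖w + (1 : ℕ) + 1 + (n : ℤ)‖ ^ 2 := by positivity
  rw [← mul_le_mul_iff_of_pos_right hp2]
  have hc : (((n + 1 : ℕ) : ℤ)) = (n : ℤ) + 1 := by push_cast; ring
  rw [hc]
  have e1 : ‖w + (1 : ℕ) + 1 + (n : ℤ)‖ ^ 2 = (n + 2 + w.re) ^ 2 + w.im ^ 2 := by
    rw [sq_norm_eq]; simp; ring
  have e2 : ‖z - (n : ℤ) - 1‖ ^ 2 = (n + 1 - z.re) ^ 2 + z.im ^ 2 := by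
    rw [sq_norm_eq]; simp; ring
  have key : 0 ≤ n * ((n + 2 + w.re) ^ 2 + w.im ^ 2) -
      (n + 1 + δ) * ((n + 1 - z.re) ^ 2 + z.im ^ 2) := by
    have : (n : ℝ) * ((n + 2 + w.re) ^ 2 + w.im ^ 2) -
      (n + 1 + δ) * ((n + 1 - z.re) ^ 2 + z.im ^ 2) = δ * n * n + E1 * n + E0 := by
      rw [hE1, hE0, hδ]; ring
    rw [this]
    have a1 := neg_abs_le E1
    have a2 := neg_abs_le E0
    have a3 := abs_nonneg E0
    nlinarith
  have hu := (gammaFactor_pos hz hw 1 n).le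
  have := mul_nonneg hu key
  rw [e1, e2] at hs
  rw [e1]
  nlinarith

lemma summable_gammaFactor_one (hz : ∀ n : ℤ, z ≠ n) (hw : ∀ n : ℤ, w ≠ n)
    (hzw : -(1 / 2 : ℝ) < (z + w).re) : Summable (gammaFactor z w 1) := by
  refine Summable.of_nat_of_neg (summable_gammaFactor_nat hz hw hzw) ?_
  have h : Summable fun n : ℕ => gammaFactor w z 1 n :=
    summable_gammaFactor_nat hw hz (by rwa [add_comm])
  rw [← summable_nat_add_iff 2]
  refine h.congr fun n => ?_
  rw [gammaFactor_swap]
  congr 1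
  push_cast
  ring

/-- The one-particle weights at all levels are dominated by the one at level one. -/
lemma exists_gammaFactor_le (hw : ∀ n : ℤ, w ≠ n) (N : ℕ) :
    ∃ C : ℝ, 0 ≤ C ∧ ∀ x : ℤ,
      gammaFactor z w (N + 1) x * (1 + |(x : ℝ)|) ^ (2 * N) ≤ C * gammaFactor z w 1 x := by
  induction N with
  | zero => exact ⟨1, zero_le_one, fun x => by simp⟩
  | succ N ih =>
    obtain ⟨C, hC, h⟩ := ih
    -- Each new level divides the weight by `‖w + N + 2 + x‖²`. Since `w` is not an integer, this
    -- norm is bounded away from zero, hence comparable with `1 + |x|`.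
    obtain ⟨D, hD, hD'⟩ : ∃ D : ℝ, 0 ≤ D ∧ ∀ x : ℤ,
        1 + |(x : ℝ)| ≤ D * ‖w + (N + 1 : ℕ) + 1 + x‖ := by
      set s : ℂ := w + (N + 1 : ℕ) + 1 with hs
      obtain ⟨ε, hε, hε'⟩ : ∃ ε : ℝ, 0 < ε ∧ ∀ x : ℤ, ε ≤ ‖s + x‖ := by
        have hfin : {x : ℤ | |(x : ℝ)| ≤ ‖s‖ + 1}.Finite := by
          refine (Set.finite_Icc (-⌈‖s‖ + 1⌉) ⌈‖s‖ + 1⌉).subset fun x hx => ?_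
          rw [Set.mem_ofPred_eq, abs_le] at hx
          have := Int.le_ceil (‖s‖ + 1)
          constructor
          · have : ((-⌈‖s‖ + 1⌉ : ℤ) : ℝ) ≤ x := by push_cast; linarith
            exact_mod_cast this
          · have : (x : ℝ) ≤ (⌈‖s‖ + 1⌉ : ℤ) := by linarith
            exact_mod_cast this
        obtain ⟨x₀, -, hx₀⟩ := hfin.exists_minimalFor (fun x : ℤ => ‖s + x‖) _
          ⟨0, by simp; positivity⟩
        have hpos : ∀ x : ℤ, 0 < ‖s + x‖ := fun x => norm_add_int_pos hw (N + 1) x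
        refine ⟨min 1 ‖s + x₀‖, lt_min one_pos (hpos _), fun x => ?_⟩
        by_cases hx : |(x : ℝ)| ≤ ‖s‖ + 1
        · refine (min_le_right _ _).trans ?_
          rcases le_total ‖s + x₀‖ ‖s + x‖ with h | h
          · exact h
          · exact hx₀ hx h
        · refine (min_le_left _ _).trans ?_
          have := norm_sub_norm_le (x : ℂ) (-s)
          rw [norm_neg, Complex.norm_intCast] at this
          have e : (x : ℂ) - -s = s + x := by ring
          rw [e] at this
          linarith
      refine ⟨1 + (1 + ‖s‖) / ε, by positivity, fun x => ?_⟩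
      have h1 : |(x : ℝ)| ≤ ‖s + x‖ + ‖s‖ := by
        have := norm_sub_le (s + x) s
        rwa [add_sub_cancel_left, Complex.norm_intCast] at this
      have h2 : 1 + ‖s‖ ≤ (1 + ‖s‖) / ε * ‖s + x‖ := by
        rw [div_mul_eq_mul_div, le_div_iff₀ hε]
        exact mul_le_mul_of_nonneg_left (hε' x) (by positivity)
      linarith
    refine ⟨C * D ^ 2, by positivity, fun x => ?_⟩
    have hg : 0 ≤ gammaFactor z w (N + 1 + 1) x := by unfold gammaFactor; positivity
    calc gammaFactor z w (N + 1 + 1) x * (1 + |(x : ℝ)|) ^ (2 * (N + 1))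
        = gammaFactor z w (N + 1 + 1) x * (1 + |(x : ℝ)|) ^ (2 * N) * (1 + |(x : ℝ)|) ^ 2 := by ring
      _ ≤ gammaFactor z w (N + 1 + 1) x * (1 + |(x : ℝ)|) ^ (2 * N) *
          (D * ‖w + (N + 1 : ℕ) + 1 + x‖) ^ 2 := by
        gcongr
        exact hD' x
      _ = D ^ 2 * (gammaFactor z w (N + 1) x * (1 + |(x : ℝ)|) ^ (2 * N)) := by
        rw [gammaFactor_succ hw (N + 1) x]; ring
      _ ≤ D ^ 2 * (C * gammaFactor z w 1 x) := mul_le_mul_of_nonneg_left (h x) (sq_nonneg D)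
      _ = _ := by ring

lemma summable_gammaFactor (hz : ∀ n : ℤ, z ≠ n) (hw : ∀ n : ℤ, w ≠ n)
    (hzw : -(1 / 2 : ℝ) < (z + w).re) (N : ℕ) : Summable (gammaFactor z w (N + 1)) := by
  obtain ⟨C, -, h⟩ := exists_gammaFactor_le (z := z) hw N
  refine Summable.of_nonneg_of_le (g := gammaFactor z w (N + 1))
    (f := fun x => C * gammaFactor z w 1 x) (fun x => (gammaFactor_pos hz hw _ x).le)
    (fun x => ?_) ((summable_gammaFactor_one hz hw hzw).mul_left C)
  refine le_trans (le_mul_of_one_le_right (gammaFactor_pos hz hw _ x).le (one_le_pow₀ ?_)) (h x)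
  linarith [abs_nonneg (x : ℝ)]

/-- These are the boundary terms at infinity in the telescoped sums of the coherency relation. -/
lemma tendsto_gammaFactor_mul_pow (hz : ∀ n : ℤ, z ≠ n) (hw : ∀ n : ℤ, w ≠ n)
    (hzw : -(1 / 2 : ℝ) < (z + w).re) {N j : ℕ} (hj : j < N) :
    Tendsto (fun x : ℤ => gammaFactor z w N x * (x : ℝ) ^ j) cofinite (𝓝 0) := by
  obtain ⟨N, rfl⟩ : ∃ M, N = M + 1 := ⟨N - 1, by omega⟩
  obtain ⟨C, -, h⟩ := exists_gammaFactor_le (z := z) hw N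
  have h0 := ((summable_gammaFactor_one hz hw hzw).mul_left C).tendsto_cofinite_zero
  refine squeeze_zero_norm (fun x => ?_) h0
  have hg := (gammaFactor_pos hz hw (N + 1) x).le
  rw [norm_mul, norm_pow, Real.norm_of_nonneg hg, Real.norm_eq_abs]
  refine le_trans (mul_le_mul_of_nonneg_left ?_ hg) (h x)
  calc |(x : ℝ)| ^ j ≤ (1 + |(x : ℝ)|) ^ j := by gcongr; linarith
    _ ≤ (1 + |(x : ℝ)|) ^ (2 * N) := by
      apply pow_le_pow_right₀
      · linarith [abs_nonneg (x : ℝ)]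
      · omega

end Gamma

/-! ### Polynomials whose weighted sums telescope. -/

section Polynomials

open Polynomial

/-- The two leading coefficients are all that matters below: the first cancels in the difference of
quadratics, and the second supplies the new leading coefficient `j + α - β`. -/
lemma exists_X_mul_X_add_one_pow (j : ℕ) :
    ∃ r ∈ degreeLT ℝ j, (X : ℝ[X]) * (X + 1) ^ j = X ^ (j + 1) + C (j : ℝ) * X ^ j + r := by
  induction j with
  | zero => exact ⟨0, zero_mem _, by simp⟩
  | succ j ih =>
    obtain ⟨r, hr, h⟩ := ih
    refine ⟨C (j : ℝ) * X ^ j + X * r + r, ?_, ?_⟩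
    · refine add_mem (add_mem ?_ ?_) ?_
      · rw [mem_degreeLT]
        exact (degree_C_mul_X_pow_le _ _).trans_lt (by exact_mod_cast Nat.lt_succ_self j)
      · rw [mem_degreeLT] at hr ⊢
        rcases eq_or_ne r 0 with rfl | h0
        · simp
        · rw [degree_mul, degree_X, degree_eq_natDegree h0] at *
          norm_cast at *
          omega
      · exact degreeLT_mono (Nat.le_succ j) hr
    · rw [pow_succ, ← mul_assoc, h]
      simp only [Nat.cast_add, Nat.cast_one, C_add, C_1]
      ring

/-- The polynomial identity behind the coherency relation: a difference of quadratic polynomials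
against consecutive powers drops the top degree only once. -/
lemma exists_quadratic_difference {α a β b : ℝ} (j : ℕ) (hκ : (j : ℝ) + α - β ≠ 0) :
    ∃ p : ℝ[X], p.Monic ∧ p.natDegree = j + 1 ∧ ∀ x : ℝ,
      (x ^ 2 + α * x + a) * (x + 1) ^ j - (x ^ 2 + β * x + b) * x ^ j =
        (j + α - β) * p.eval x := by
  obtain ⟨r, hr, h⟩ := exists_X_mul_X_add_one_pow j
  set s : ℝ[X] := X * r + C (α * j) * X ^ j + C α * r + C a * (X + 1) ^ j - C b * X ^ j with hs
  have hXj : ∀ c : ℝ, C c * X ^ j ∈ degreeLT ℝ (j + 1) := fun c => by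
    rw [mem_degreeLT]
    exact (degree_C_mul_X_pow_le _ _).trans_lt (by exact_mod_cast Nat.lt_succ_self j)
  have hs1 : s ∈ degreeLT ℝ (j + 1) := by
    refine sub_mem (add_mem (add_mem (add_mem ?_ (hXj _)) ?_) ?_) (hXj _)
    · rw [mem_degreeLT] at hr ⊢
      rcases eq_or_ne r 0 with rfl | h0
      · simp
      · rw [degree_mul, degree_X, degree_eq_natDegree h0] at *
        norm_cast at *
        omega
    · rw [← smul_eq_C_mul]
      exact Submodule.smul_mem _ _ (degreeLT_mono (Nat.le_succ j) hr)
    · rw [← smul_eq_C_mul]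
      refine Submodule.smul_mem _ _ ?_
      rw [mem_degreeLT]
      refine lt_of_le_of_lt ?_ (show ((j : ℕ) : WithBot ℕ) < ((j + 1 : ℕ) : WithBot ℕ) by
        exact_mod_cast Nat.lt_succ_self j)
      refine (degree_pow_le _ _).trans ?_
      have : (X + 1 : ℝ[X]).degree = 1 := by
        rw [← C_1]; exact degree_X_add_C 1
      rw [this]; simp
  have hs2 : (C ((j : ℝ) + α - β)⁻¹ * s).degree < ((j + 1 : ℕ) : WithBot ℕ) := by
    have := Submodule.smul_mem (degreeLT ℝ (j + 1)) ((j : ℝ) + α - β)⁻¹ hs1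
    rwa [smul_eq_C_mul, mem_degreeLT] at this
  refine ⟨X ^ (j + 1) + C ((j : ℝ) + α - β)⁻¹ * s, monic_X_pow_add hs2, ?_, fun x => ?_⟩
  · apply natDegree_eq_of_degree_eq_some
    rw [degree_add_eq_left_of_degree_lt, degree_X_pow]
    rwa [degree_X_pow]
  · have hx := congrArg (Polynomial.eval x) h
    simp only [eval_mul, eval_X, eval_pow, eval_add, eval_one, eval_C] at hx
    simp only [eval_mul, eval_X, eval_pow, eval_add, eval_one, eval_C, hs, eval_sub]
    rw [mul_add, mul_inv_cancel_left₀ hκ]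
    linear_combination (x + α) * hx

end Polynomials

/-! ### Dimensions as Vandermonde determinants. -/

section Vandermonde

lemma shifted_strictAnti {N : ℕ} {v : Fin N → ℤ} (hv : Antitone v) : StrictAnti (shifted v) := by
  intro i j hij
  have := hv hij.le
  have h : (i : ℕ) < j := hij
  simp only [shifted]
  push_cast
  omega

lemma dimFun_eq_prod {N : ℕ} (v : Fin N → ℤ) :
    dimFun v = ∏ i : Fin N, ∏ j ∈ Finset.Ioi i,
      ((shifted v i : ℝ) - shifted v j) / ((j : ℝ) - (i : ℝ)) := by
  unfold dimFun shifted
  refine Finset.prod_congr rfl fun i _ => Finset.prod_congr rfl fun j _ => ?_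
  push_cast
  congr 1
  ring

/-- The constant relating the dimension to the Vandermonde determinant. -/
noncomputable def dimConst (N : ℕ) : ℝ :=
  ∏ i : Fin N, ∏ j ∈ Finset.Ioi i, -(1 / ((j : ℝ) - (i : ℝ)))

lemma dimConst_ne_zero (N : ℕ) : dimConst N ≠ 0 := by
  unfold dimConst
  refine Finset.prod_ne_zero_iff.2 fun i _ => Finset.prod_ne_zero_iff.2 fun j hj => ?_
  have h : i < j := Finset.mem_Ioi.1 hj
  have : (i : ℝ) < j := by exact_mod_cast h
  exact neg_ne_zero.2 (one_div_ne_zero (by linarith))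

lemma dimFun_eq_det {N : ℕ} (v : Fin N → ℤ) :
    dimFun v = dimConst N * (Matrix.vandermonde fun i => (shifted v i : ℝ)).det := by
  rw [dimFun_eq_prod, Matrix.det_vandermonde, dimConst, ← Finset.prod_mul_distrib]
  refine Finset.prod_congr rfl fun i _ => ?_
  rw [← Finset.prod_mul_distrib]
  refine Finset.prod_congr rfl fun j _ => ?_
  ring

lemma dimConst_mul_det_pos {N : ℕ} {y : Fin N → ℤ} (hy : StrictAnti y) :
    0 < dimConst N * (Matrix.vandermonde fun i => (y i : ℝ)).det := by
  rw [Matrix.det_vandermonde, dimConst, ← Finset.prod_mul_distrib]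
  refine Finset.prod_pos fun i _ => ?_
  rw [← Finset.prod_mul_distrib]
  refine Finset.prod_pos fun j hj => ?_
  have h : i < j := Finset.mem_Ioi.1 hj
  have h1 : (i : ℝ) < j := by exact_mod_cast h
  have h2 : (y j : ℝ) < y i := by exact_mod_cast hy h
  exact mul_pos_of_neg_of_neg (neg_neg_of_pos (one_div_pos.2 (by linarith))) (by linarith)

lemma dimFun_pos {N : ℕ} {v : Fin N → ℤ} (hv : Antitone v) : 0 < dimFun v := by
  rw [dimFun_eq_det]
  exact dimConst_mul_det_pos (shifted_strictAnti hv)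

lemma gammaFun_pos {z w : ℂ} (hz : ∀ n : ℤ, z ≠ n) (hw : ∀ n : ℤ, w ≠ n) {N : ℕ}
    (v : Fin N → ℤ) : 0 < gammaFun z w v :=
  Finset.prod_pos fun _ _ => gammaFactor_pos hz hw _ _

/-- Summation of a determinant over a box, row by row. -/
lemma sum_piFinset_det {n : ℕ} (s : Fin n → Finset ℤ) (g : ℤ → Fin n → ℝ) :
    ∑ y ∈ Fintype.piFinset s, (Matrix.of fun i j => g (y i) j).det =
      (Matrix.of fun i j => ∑ y ∈ s i, g y j).det := by
  have := (Matrix.detRowAlternating (n := Fin n) (R := ℝ)).toMultilinearMap.map_sum_finset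
    (fun _ y => g y) s
  rw [eq_comm]
  refine Eq.trans ?_ this
  show Matrix.det _ = Matrix.det _
  congr 1
  ext i j
  simp [Finset.sum_apply]

end Vandermonde

/-! ### Interlacing as a box condition in shifted coordinates. -/

section Interlacing

/-- The interlacing condition for shifted coordinates. -/
lemma interlaces_iff_shifted {N : ℕ} {l : Signature N} {m : Signature (N + 1)} :
    Interlaces l m ↔ ∀ i : Fin N, shifted l.1 i ≤ shifted m.1 i.castSucc ∧
      shifted m.1 i.succ < shifted l.1 i := by
  unfold Interlaces shifted
  refine forall_congr' fun i => ?_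
  push_cast [Fin.val_castSucc, Fin.val_succ]
  constructor <;> rintro ⟨h1, h2⟩ <;> constructor <;> omega

lemma antitone_of_interlaces {N : ℕ} {l : Fin N → ℤ} {m : Fin (N + 1) → ℤ}
    (h : ∀ i : Fin N, l i ≤ m i.castSucc ∧ m i.succ ≤ l i) : Antitone m :=
  Fin.antitone_iff_succ_le.2 fun i => (h i).2.trans (h i).1

lemma shifted_injective {N : ℕ} : Function.Injective (shifted (N := N)) := by
  intro v v' h
  funext i
  have := congrFun h i
  simp only [shifted] at this
  omega

/-- Summation over the signatures above a given one as a limit of sums over boxes. -/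
lemma tendsto_sum_box {N : ℕ} (l : Signature N) (G : (Fin (N + 1) → ℤ) → ENNReal) :
    Tendsto (fun K : ℕ => ∑ y ∈ Fintype.piFinset (fun i =>
        Finset.Ico ((Fin.snoc (shifted l.1) (-(K : ℤ)) : Fin (N + 1) → ℤ) i)
          ((Fin.cons (K : ℤ) (shifted l.1) : Fin (N + 1) → ℤ) i)), G y) atTop
      (𝓝 (∑' m : {m : Signature (N + 1) // Interlaces l m}, G (shifted m.1.1))) := by
  classical
  set T : ℕ → Finset (Fin (N + 1) → ℤ) := fun K => Fintype.piFinset (fun i =>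
        Finset.Ico ((Fin.snoc (shifted l.1) (-(K : ℤ)) : Fin (N + 1) → ℤ) i)
          ((Fin.cons (K : ℤ) (shifted l.1) : Fin (N + 1) → ℤ) i)) with hT
  -- Interlacing bounds each shifted coordinate separately by a half-open interval; only the first
  -- is unbounded above and the last unbounded below, and `K` truncates these two.
  have hmem : ∀ K y, y ∈ T K ↔ (∀ i : Fin N, shifted l.1 i ≤ y i.castSucc ∧
      y i.succ < shifted l.1 i) ∧ y 0 < K ∧ -(K : ℤ) ≤ y (Fin.last N) := by
    intro K y
    simp only [hT, Fintype.mem_piFinset, Finset.mem_Ico, forall_and]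
    rw [Fin.forall_fin_succ' (P := fun i => (Fin.snoc (shifted l.1) (-(K : ℤ)) :
      Fin (N + 1) → ℤ) i ≤ y i), Fin.forall_fin_succ (P := fun i => y i <
      (Fin.cons (K : ℤ) (shifted l.1) : Fin (N + 1) → ℤ) i)]
    simp only [Fin.snoc_castSucc, Fin.snoc_last, Fin.cons_zero, Fin.cons_succ]
    tauto
  set Φ : {m : Signature (N + 1) // Interlaces l m} → (Fin (N + 1) → ℤ) :=
    fun m => shifted m.1.1 with hΦ
  have hΦinj : Function.Injective Φ := fun m m' h =>
    Subtype.ext (Subtype.ext (shifted_injective h))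
  have hrange : ∀ K, ∀ y ∈ T K, y ∈ Set.range Φ := by
    intro K y hy
    have hy' := ((hmem K y).1 hy).1
    let m : Fin (N + 1) → ℤ := fun i => y i + ((i : ℕ) + 1 : ℕ)
    have hm : shifted m = y := by funext i; simp [shifted, m]
    have hint : ∀ i : Fin N, l.1 i ≤ m i.castSucc ∧ m i.succ ≤ l.1 i := by
      intro i
      have := hy' i
      simp only [shifted] at this
      simp only [m]
      push_cast [Fin.val_castSucc, Fin.val_succ] at this ⊢
      omega
    exact ⟨⟨⟨m, antitone_of_interlaces hint⟩, hint⟩, hm⟩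
  have hmono : Monotone fun K => (T K).preimage Φ hΦinj.injOn := by
    intro K K' hKK m hm
    rw [Finset.mem_preimage, hmem] at hm ⊢
    refine ⟨hm.1, ?_, ?_⟩ <;> omega
  have hex : ∀ m, ∃ K, m ∈ (T K).preimage Φ hΦinj.injOn := by
    intro m
    refine ⟨(Φ m 0).natAbs + (Φ m (Fin.last N)).natAbs + 1, ?_⟩
    rw [Finset.mem_preimage, hmem]
    exact ⟨interlaces_iff_shifted.1 m.2, by omega, by omega⟩
  have h1 := (ENNReal.summable (f := fun m => G (Φ m))).hasSum.comp
    (tendsto_atTop_finset_of_monotone hmono hex)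
  refine h1.congr fun K => ?_
  exact Finset.sum_preimage Φ (T K) hΦinj.injOn G fun y hy h => absurd (hrange K y hy) h

end Interlacing

/-! ### The coherency relation. -/

section Coherency

variable {z w : ℂ}

lemma tendsto_Ico_neg : Tendsto (fun K : ℕ => Finset.Ico (-(K : ℤ)) K) atTop atTop := by
  refine tendsto_atTop_finset_of_monotone (fun a b h => ?_) fun x => ⟨x.natAbs + 1, ?_⟩
  · exact Finset.Ico_subset_Ico (by omega) (by omega)
  · rw [Finset.mem_Ico]; omega

lemma tendsto_natCast_int_cofinite : Tendsto (fun K : ℕ => (K : ℤ)) atTop cofinite := by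
  rw [← Nat.cofinite_eq_atTop]
  exact Nat.cast_injective.tendsto_cofinite

lemma sum_Ico_sub_int (g : ℤ → ℝ) {a b : ℤ} (h : a ≤ b) :
    ∑ y ∈ Finset.Ico a b, (g (y + 1) - g y) = g b - g a := by
  induction b, h using Int.leInduction with
  | base => simp
  | succ b hab ih =>
    rw [← Finset.insert_Ico_right_eq_Ico_add_one hab, Finset.sum_insert (by simp), ih]
    ring

/-- Limit of the determinant of the telescoped row sums. -/
lemma tendsto_det_telescoped {N : ℕ} (x : Fin N → ℤ) (f : ℤ → ℝ) (hf : Summable f)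
    (g : Fin N → ℤ → ℝ) (hg : ∀ j, Tendsto (g j) cofinite (𝓝 0)) (hx : StrictAnti x) :
    Tendsto (fun K : ℕ => (Matrix.of fun i : Fin (N + 1) => fun j : Fin (N + 1) =>
      ∑ y ∈ Finset.Ico ((Fin.snoc x (-(K : ℤ)) : Fin (N + 1) → ℤ) i)
        ((Fin.cons (K : ℤ) x : Fin (N + 1) → ℤ) i),
        (Fin.cons (f y) (fun j => g j (y + 1) - g j y) : Fin (N + 1) → ℝ) j).det) atTop
      (𝓝 ((-1) ^ N * (∑' y, f y) * (Matrix.of fun i j => -g j (x i)).det)) := by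
  -- Adding each accumulated row to the next one glues adjacent intervals, so all rows become sums
  -- up to the common end `K` and the determinant is unchanged.
  set A : ℕ → Matrix (Fin (N + 1)) (Fin (N + 1)) ℝ := fun K => Matrix.of fun i j =>
    (Fin.cons (∑ y ∈ Finset.Ico ((Fin.snoc x (-(K : ℤ)) : Fin (N + 1) → ℤ) i) K, f y)
      (fun j => g j K - g j ((Fin.snoc x (-(K : ℤ)) : Fin (N + 1) → ℤ) i)) :
        Fin (N + 1) → ℝ) j with hA
  -- In the limit the last row is a sum over all of `ℤ`: its telescoped entries vanish and only the
  -- total mass of `f` survives. Expansion along this row follows.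
  set B : Matrix (Fin (N + 1)) (Fin (N + 1)) ℝ := Matrix.of fun i j =>
    (Fin.snoc (α := fun _ => Fin (N + 1) → ℝ)
      (fun i => Fin.cons (∑' y, (Set.Ici (x i)).indicator f y) fun j => -g j (x i))
      (Fin.cons (∑' y, f y) fun _ => 0) : Fin (N + 1) → Fin (N + 1) → ℝ) i j with hB
  have hlim : Tendsto A atTop (𝓝 B) := by
    refine tendsto_pi_nhds.2 fun i => tendsto_pi_nhds.2 fun j => ?_
    have hgK : ∀ j, Tendsto (fun K : ℕ => g j K) atTop (𝓝 0) := fun j =>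
      (hg j).comp tendsto_natCast_int_cofinite
    have hgK' : ∀ j, Tendsto (fun K : ℕ => g j (-(K : ℤ))) atTop (𝓝 0) := fun j =>
      (hg j).comp (neg_injective.tendsto_cofinite.comp tendsto_natCast_int_cofinite)
    refine Fin.lastCases ?_ (fun i => ?_) i <;> refine Fin.cases ?_ (fun j => ?_) j
    · simp only [hA, hB, Matrix.of_apply, Fin.snoc_last, Fin.cons_zero]
      exact hf.hasSum.comp tendsto_Ico_neg
    · simp only [hA, hB, Matrix.of_apply, Fin.snoc_last, Fin.cons_succ]
      simpa using (hgK j).sub (hgK' j)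
    · simp only [hA, hB, Matrix.of_apply, Fin.snoc_castSucc, Fin.cons_zero]
      refine ((hf.indicator (Set.Ici (x i))).hasSum.comp tendsto_Ico_neg).congr' ?_
      filter_upwards [eventually_ge_atTop (x i).natAbs] with K hK
      rw [Function.comp, Finset.sum_indicator_eq_sum_filter]
      congr 1
      ext y
      simp only [Finset.mem_filter, Finset.mem_Ico, Set.mem_Ici]
      omega
    · simp only [hA, hB, Matrix.of_apply, Fin.snoc_castSucc, Fin.cons_succ]
      simpa using (hgK j).sub_const (g j (x i))
  have hdet : Tendsto (fun K => (A K).det) atTop (𝓝 B.det) :=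
    (continuous_id.matrix_det.tendsto B).comp hlim
  have hBdet : B.det = (-1) ^ N * (∑' y, f y) * (Matrix.of fun i j => -g j (x i)).det := by
    rw [Matrix.det_succ_row B (Fin.last N), Fin.sum_univ_succ, Finset.sum_eq_zero, add_zero]
    · have h1 : B (Fin.last N) 0 = ∑' y, f y := by
        simp only [hB, Matrix.of_apply, Fin.snoc_last, Fin.cons_zero]
      have h2 : B.submatrix (Fin.last N).succAbove (Fin.succAbove 0) =
          Matrix.of fun i j => -g j (x i) := by
        ext i j
        simp only [hB, Matrix.submatrix_apply, Fin.succAbove_last, Fin.succAbove_zero,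
          Matrix.of_apply, Fin.snoc_castSucc, Fin.cons_succ]
      rw [h1, h2]
      simp
    · intro j _
      have : B (Fin.last N) j.succ = 0 := by
        simp only [hB, Matrix.of_apply, Fin.snoc_last, Fin.cons_succ]
      rw [this]; simp
  rw [← hBdet]
  refine hdet.congr' ?_
  have hev : ∀ᶠ K : ℕ in atTop, ∀ i : Fin N, (x i).natAbs ≤ K :=
    eventually_all.2 fun i => eventually_ge_atTop _
  filter_upwards [hev] with K hK
  have hle : ∀ i : Fin (N + 1), (Fin.snoc x (-(K : ℤ)) : Fin (N + 1) → ℤ) i ≤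
      (Fin.cons (K : ℤ) x : Fin (N + 1) → ℤ) i := by
    intro i
    rcases Fin.eq_castSucc_or_eq_last i with ⟨i, rfl⟩ | rfl
    · rw [Fin.snoc_castSucc]
      rcases Fin.eq_zero_or_eq_succ i.castSucc with h | ⟨k, h⟩
      · rw [h, Fin.cons_zero]
        have := hK i
        omega
      · rw [h, Fin.cons_succ]
        refine hx.antitone ?_
        rw [Fin.le_def]
        have := congrArg Fin.val h
        simp at this
        omega
    · rw [Fin.snoc_last]
      rcases Fin.eq_zero_or_eq_succ (Fin.last N) with h | ⟨k, h⟩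
      · rw [h, Fin.cons_zero]
        omega
      · rw [h, Fin.cons_succ]
        have := hK k
        omega
  refine Matrix.det_eq_of_forall_row_eq_smul_add_pred (fun _ => 1) (fun j => ?_) fun i j => ?_
  · refine Fin.cases ?_ (fun j => ?_) j
    · simp only [hA, Matrix.of_apply, Fin.cons_zero]
    · simp only [hA, Matrix.of_apply, Fin.cons_succ]
      rw [sum_Ico_sub_int _ (hle 0), Fin.cons_zero]
  · refine Fin.cases ?_ (fun j => ?_) j
    · simp only [hA, Matrix.of_apply, Fin.cons_zero, Fin.cons_succ, Fin.snoc_castSucc, one_mul]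
      have h1 := hle i.succ
      rw [Fin.cons_succ] at h1
      have h2 := hK i
      rw [← Finset.Ico_union_Ico_eq_Ico h1 (show x i ≤ K by omega),
        Finset.sum_union (Finset.Ico_disjoint_Ico_consecutive _ _ _)]
    · simp only [hA, Matrix.of_apply, Fin.cons_succ, one_mul]
      have h1 := hle i.succ
      rw [Fin.cons_succ] at h1
      rw [sum_Ico_sub_int (g j) h1, Fin.snoc_castSucc]
      ring

/-- The coherency relation, up to a constant which depends only on the level. -/
lemma exists_coherency_const (hz : ∀ n : ℤ, z ≠ n) (hw : ∀ n : ℤ, w ≠ n)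
    (hzw : -(1 / 2 : ℝ) < (z + w).re) (N : ℕ) :
    ∃ c : ℝ, 0 < c ∧ ∀ l : Signature N,
      ∑' m : {m : Signature (N + 1) // Interlaces l m},
        ENNReal.ofReal (gammaFun z w m.1.1 * dimFun m.1.1) =
      ENNReal.ofReal (c * (gammaFun z w l.1 * dimFun l.1)) := by
  set f : ℤ → ℝ := gammaFactor z w (N + 1) with hf
  set κ : Fin N → ℝ := fun j => ((j : ℕ) : ℝ) + 2 * (1 - z.re) - 2 * (N + 1 + w.re) with hκ
  have hκ0 : ∀ j, κ j ≠ 0 := by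
    intro j
    have h1 : ((j : ℕ) : ℝ) + 1 ≤ N := by exact_mod_cast j.2
    rw [Complex.add_re] at hzw
    apply ne_of_lt
    simp only [hκ]
    linarith
  choose p hp1 hp2 hp3 using fun j : Fin N => exists_quadratic_difference
    (a := (1 - z.re) ^ 2 + z.im ^ 2) (b := (N + 1 + w.re) ^ 2 + w.im ^ 2) (j : ℕ) (hκ0 j)
  set g : Fin N → ℤ → ℝ := fun j x => (κ j)⁻¹ * (gammaFactor z w N x * (x : ℝ) ^ (j : ℕ)) with hg
  have hgdiff : ∀ j (x : ℤ), g j (x + 1) - g j x = f x * (p j).eval (x : ℝ) := by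
    intro j x
    have h1 := hp3 j x
    have e1 : ‖z - x - 1‖ ^ 2 =
        (x : ℝ) ^ 2 + 2 * (1 - z.re) * x + ((1 - z.re) ^ 2 + z.im ^ 2) := by
      rw [sq_norm_eq]; simp; ring
    have e2 : ‖w + N + 1 + x‖ ^ 2 =
        (x : ℝ) ^ 2 + 2 * (N + 1 + w.re) * x + ((N + 1 + w.re) ^ 2 + w.im ^ 2) := by
      rw [sq_norm_eq]; simp; ring
    rw [← e1, ← e2] at h1
    simp only [hg]
    rw [gammaFactor_add_one hz, gammaFactor_succ hw N x, ← mul_sub]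
    push_cast
    rw [inv_mul_eq_iff_eq_mul₀ (hκ0 j)]
    linear_combination gammaFactor z w (N + 1) x * h1
  have hglim : ∀ j, Tendsto (g j) cofinite (𝓝 0) := by
    intro j
    simpa using (tendsto_gammaFactor_mul_pow hz hw hzw j.2).const_mul (κ j)⁻¹
  -- Replacing monomials by the monic polynomials `1, p_0, p_1, …` of degrees `0, 1, 2, …` preserves
  -- the Vandermonde determinant; with the weight absorbed in the rows, every column but the first
  -- is a difference.
  have hdet : ∀ y : Fin (N + 1) → ℤ,
      (∏ i, f (y i)) * (Matrix.vandermonde fun i => (y i : ℝ)).det =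
      (Matrix.of fun i j => (Fin.cons (f (y i)) (fun j => g j (y i + 1) - g j (y i)) :
        Fin (N + 1) → ℝ) j).det := by
    intro y
    rw [Matrix.det_eval_matrixOfPolynomials_eq_det_vandermonde _
      (Fin.cons 1 p : Fin (N + 1) → Polynomial ℝ), ← Matrix.det_mul_column]
    · congr 1
      ext i j
      refine Fin.cases ?_ (fun j => ?_) j
      · simp
      · simp [hgdiff]
    · intro j
      refine Fin.cases ?_ (fun j => ?_) j
      · simp
      · simp [hp2]
    · intro j
      refine Fin.cases ?_ (fun j => ?_) j
      · simp
      · simpa using hp1 j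
  set c : ℝ := dimConst (N + 1) * (-1) ^ N * (∑' y, f y) * (∏ j, -(κ j)⁻¹) / dimConst N with hc
  have main : ∀ l : Signature N,
      ∑' m : {m : Signature (N + 1) // Interlaces l m},
        ENNReal.ofReal (gammaFun z w m.1.1 * dimFun m.1.1) =
      ENNReal.ofReal (c * (gammaFun z w l.1 * dimFun l.1)) := by
    intro l
    have h1 := tendsto_sum_box l fun y => ENNReal.ofReal (dimConst (N + 1) *
      ((∏ i, f (y i)) * (Matrix.vandermonde fun i => (y i : ℝ)).det))
    have h2 := ((tendsto_det_telescoped (shifted l.1) f (summable_gammaFactor hz hw hzw N) g hglim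
      (shifted_strictAnti l.2)).const_mul (dimConst (N + 1)))
    have h3 := (ENNReal.continuous_ofReal.tendsto _).comp h2
    have h4 := tendsto_nhds_unique (h1.congr fun K => ?_) h3
    · refine Eq.trans ?_ (h4.trans ?_)
      · refine tsum_congr fun m => ?_
        rw [dimFun_eq_det, gammaFun]
        congr 1
        ring
      · congr 1
        have : (Matrix.of fun i j => -g j (shifted l.1 i)).det = (∏ j, -(κ j)⁻¹) *
            (gammaFun z w l.1 * (Matrix.vandermonde fun i => (shifted l.1 i : ℝ)).det) := by
          rw [gammaFun, ← Matrix.det_mul_column, ← Matrix.det_mul_row]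
          congr 1
          ext i j
          simp only [hg, Matrix.of_apply, Matrix.vandermonde_apply]
          ring
        rw [this, dimFun_eq_det, hc]
        field_simp [dimConst_ne_zero N]
    · rw [Function.comp, ← sum_piFinset_det, Finset.mul_sum, ENNReal.ofReal_sum_of_nonneg]
      · exact Finset.sum_congr rfl fun y _ => by rw [hdet]
      · intro y hy
        rw [← hdet, mul_left_comm]
        refine mul_nonneg (Finset.prod_nonneg fun i _ => (gammaFactor_pos hz hw _ _).le)
          (dimConst_mul_det_pos ?_).le
        rw [Fin.strictAnti_iff_succ_lt]
        intro i
        rw [Fintype.mem_piFinset] at hy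
        have a1 := (Finset.mem_Ico.1 (hy i.castSucc)).1
        have a2 := (Finset.mem_Ico.1 (hy i.succ)).2
        rw [Fin.snoc_castSucc] at a1
        rw [Fin.cons_succ] at a2
        exact a2.trans_le a1
  refine ⟨c, ?_, main⟩
  -- The sign of `c` need not be computed: at the zero signature both the left side and the weight
  -- are positive.
  have h0 := main default
  have hpos : (0 : ENNReal) < ∑' m : {m : Signature (N + 1) // Interlaces default m},
      ENNReal.ofReal (gammaFun z w m.1.1 * dimFun m.1.1) := by
    refine lt_of_lt_of_le ?_ (ENNReal.le_tsum ⟨default, fun i => ⟨le_rfl, le_rfl⟩⟩)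
    rw [ENNReal.ofReal_pos]
    exact mul_pos (gammaFun_pos hz hw _) (dimFun_pos (default : Signature (N + 1)).2)
  rw [h0, ENNReal.ofReal_pos] at hpos
  exact pos_of_mul_pos_left hpos
    (mul_pos (gammaFun_pos hz hw _) (dimFun_pos (default : Signature N).2)).le

end Coherency

/-! ### The branching rule for dimensions. -/

section Branching

lemma ascPochhammer_eval_sub (j : ℕ) (x : ℝ) :
    (ascPochhammer ℝ (j + 1)).eval x - (ascPochhammer ℝ (j + 1)).eval (x - 1) =
      (j + 1) * (ascPochhammer ℝ j).eval x := by
  have h1 : (ascPochhammer ℝ (j + 1)).eval (x - 1) =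
      (x - 1) * (ascPochhammer ℝ j).eval x := by
    rw [ascPochhammer_succ_left]
    simp [Polynomial.eval_comp]
  rw [h1, ascPochhammer_succ_eval]
  ring

/-- Summation over the signatures below a given one as a sum over a box. -/
lemma tsum_below_eq_sum_box {N : ℕ} (m : Signature (N + 1)) (G : (Fin N → ℤ) → ENNReal) :
    ∑' l : {l : Signature N // Interlaces l m}, G (shifted l.1.1) =
      ∑ x ∈ Fintype.piFinset (fun i : Fin N => Finset.Ico (shifted m.1 i.succ + 1)
        (shifted m.1 i.castSucc + 1)), G x := by
  set Φ : {l : Signature N // Interlaces l m} → (Fin N → ℤ) := fun l => shifted l.1.1 with hΦ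
  have hΦinj : Function.Injective Φ := fun l l' h =>
    Subtype.ext (Subtype.ext (shifted_injective h))
  have hrange : Set.range Φ = ↑(Fintype.piFinset (fun i : Fin N =>
      Finset.Ico (shifted m.1 i.succ + 1) (shifted m.1 i.castSucc + 1))) := by
    ext x
    rw [Finset.mem_coe, Fintype.mem_piFinset]
    constructor
    · rintro ⟨l, rfl⟩ i
      have := interlaces_iff_shifted.1 l.2 i
      rw [Finset.mem_Ico]
      simp only [hΦ]
      omega
    · intro hx
      let l : Fin N → ℤ := fun i => x i + ((i : ℕ) + 1 : ℕ)
      have hl : shifted l = x := by funext i; simp [shifted, l]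
      have hint : ∀ i : Fin N, l i ≤ m.1 i.castSucc ∧ m.1 i.succ ≤ l i := by
        intro i
        have := Finset.mem_Ico.1 (hx i)
        simp only [shifted] at this
        simp only [l]
        push_cast [Fin.val_castSucc, Fin.val_succ] at this ⊢
        omega
      have hanti : Antitone l := by
        cases N with
        | zero => exact fun i => i.elim0
        | succ N =>
          rw [Fin.antitone_iff_succ_le]
          intro i
          have h1 := (hint i.succ).1
          have h2 := (hint i.castSucc).2
          have h3 : i.succ.castSucc = i.castSucc.succ := by ext; simp
          rw [h3] at h1
          exact h1.trans h2
      exact ⟨⟨⟨l, hanti⟩, hint⟩, hl⟩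
  rw [← tsum_range G hΦinj, hrange]
  exact Finset.tsum_subtype' _ G

/-- In the basis of rising factorials, which have explicit discrete primitives, the sum over the box
below `m` telescopes row by row. The outcome is the Vandermonde determinant of `m` after subtracting
consecutive rows. The constant is identified afterwards by evaluating at the zero signature. -/
lemma exists_branching_const (N : ℕ) : ∃ d : ℝ, ∀ m : Signature (N + 1),
    ∑' l : {l : Signature N // Interlaces l m}, ENNReal.ofReal (dimFun l.1.1) =
      ENNReal.ofReal (d * dimFun m.1) := by
  refine ⟨dimConst N * (∏ j : Fin N, -(1 / (((j : ℕ) : ℝ) + 1))) / dimConst (N + 1), fun m => ?_⟩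
  set y := shifted m.1 with hy
  have hya : StrictAnti y := shifted_strictAnti m.2
  set B : ℕ → ℝ → ℝ := fun j x => (ascPochhammer ℝ j).eval x with hB
  have hvan : ∀ {n : ℕ} (x : Fin n → ℤ), (Matrix.vandermonde fun i => (x i : ℝ)).det =
      (Matrix.of fun i j : Fin n => B j (x i)).det := fun x =>
    Matrix.det_eval_matrixOfPolynomials_eq_det_vandermonde _ (fun j => ascPochhammer ℝ j)
      (fun j => ascPochhammer_natDegree ℝ j) (fun j => monic_ascPochhammer ℝ j)
  have h1 := tsum_below_eq_sum_box m fun x => ENNReal.ofReal (dimConst N *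
    (Matrix.vandermonde fun i => (x i : ℝ)).det)
  simp only [← dimFun_eq_det] at h1
  rw [h1, ← ENNReal.ofReal_sum_of_nonneg, ← Finset.mul_sum]
  · congr 1
    simp only [hvan]
    rw [sum_piFinset_det _ fun (x : ℤ) (j : Fin N) => B j x]
    have h2 : (Matrix.of fun i j : Fin N => ∑ x ∈ Finset.Ico (shifted m.1 i.succ + 1)
        (shifted m.1 i.castSucc + 1), B j x).det =
        (∏ j : Fin N, -(1 / (((j : ℕ) : ℝ) + 1))) *
          (Matrix.of fun i j : Fin N => B (j + 1) (y i.succ) - B (j + 1) (y i.castSucc)).det := by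
      rw [← Matrix.det_mul_row]
      congr 1
      ext i j
      simp only [Matrix.of_apply]
      have h3 := sum_Ico_sub_int (fun x => 1 / (((j : ℕ) : ℝ) + 1) * B (j + 1) ((x : ℝ) - 1))
        (show y i.succ + 1 ≤ y i.castSucc + 1 by
          have := hya (Fin.castSucc_lt_succ (i := i)); omega)
      have h4 : ∀ x : ℤ, B j x = 1 / (((j : ℕ) : ℝ) + 1) * B (j + 1) (((x + 1 : ℤ) : ℝ) - 1) -
          1 / (((j : ℕ) : ℝ) + 1) * B (j + 1) ((x : ℝ) - 1) := by
        intro x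
        push_cast
        rw [add_sub_cancel_right, ← mul_sub]
        simp only [hB]
        rw [ascPochhammer_eval_sub]
        field_simp
      rw [Finset.sum_congr rfl fun x _ => h4 x, h3]
      push_cast
      simp only [add_sub_cancel_right]
      ring
    -- The first column is constantly `1`, so subtracting the preceding row clears it below the top
    -- entry.
    have h5 : (Matrix.of fun i j : Fin (N + 1) => B j (y i)).det =
        (Matrix.of fun i j : Fin N => B (j + 1) (y i.succ) - B (j + 1) (y i.castSucc)).det := by
      rw [Matrix.det_eq_of_forall_row_eq_smul_add_pred (B := Matrix.of fun i j : Fin (N + 1) =>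
        (Fin.cons (B j (y 0)) (fun i : Fin N => B j (y i.succ) - B j (y i.castSucc)) :
          Fin (N + 1) → ℝ) i) (fun _ => 1) (fun j => by simp) (fun i j => by simp),
        Matrix.det_succ_column_zero, Fin.sum_univ_succ, Finset.sum_eq_zero, add_zero]
      · simp only [Fin.val_zero, pow_zero, Matrix.of_apply, Fin.cons_zero, one_mul]
        have : B 0 (y 0) = 1 := by simp [hB]
        rw [this, one_mul]
        congr 1
      · intro i _
        have : B 0 (y i.succ) - B 0 (y i.castSucc) = 0 := by simp [hB]
        simp [this]
    rw [h2, dimFun_eq_det, hvan, ← h5]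
    field_simp [dimConst_ne_zero (N + 1)]
    rfl
  · intro x hx
    refine (dimConst_mul_det_pos ?_).le
    rw [Fintype.mem_piFinset] at hx
    cases N with
    | zero => exact fun i => i.elim0
    | succ N =>
      rw [Fin.strictAnti_iff_succ_lt]
      intro i
      have h1 := (Finset.mem_Ico.1 (hx i.succ)).2
      have h2 := (Finset.mem_Ico.1 (hx i.castSucc)).1
      have h3 : i.succ.castSucc = i.castSucc.succ := by ext; simp
      rw [h3] at h1
      omega

lemma dimFun_default (N : ℕ) : dimFun (default : Signature N).1 = 1 := by
  refine Finset.prod_eq_one fun i _ => Finset.prod_eq_one fun j hj => ?_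
  have h : i < j := Finset.mem_Ioi.1 hj
  have h1 : (i : ℝ) < j := by exact_mod_cast h
  have : (default : Signature N).1 = fun _ => 0 := rfl
  rw [this]
  simp only [Int.cast_zero, sub_zero, zero_add]
  exact div_self (by linarith)

/-- The branching rule for dimensions. -/
lemma tsum_dimFun_below {N : ℕ} (m : Signature (N + 1)) :
    ∑' l : {l : Signature N // Interlaces l m}, ENNReal.ofReal (dimFun l.1.1) =
      ENNReal.ofReal (dimFun m.1) := by
  obtain ⟨d, hd⟩ := exists_branching_const N
  have h0 := hd default
  rw [tsum_eq_single ⟨default, fun i => ⟨le_rfl, le_rfl⟩⟩, dimFun_default, dimFun_default] at h0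
  · have : d = 1 := by
      rw [mul_one, ENNReal.ofReal_one, eq_comm, ENNReal.ofReal_eq_one] at h0
      exact h0
    rw [hd, this, one_mul]
  · rintro ⟨l, hl⟩ hne
    exfalso
    apply hne
    apply Subtype.ext
    apply Subtype.ext
    funext i
    exact le_antisymm (hl i).1 (hl i).2

end Branching

/-! ### Normalization constants and the normalized coherency relation. -/

section Normalization

variable {z w : ℂ}

/-- The unnormalized mass of a single path ending in a given tuple. -/
noncomputable def pathWeight (z w : ℂ) {N : ℕ} (v : Fin N → ℤ) : ℝ := gammaFun z w v * dimFun v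

lemma pathWeight_pos (hz : ∀ n : ℤ, z ≠ n) (hw : ∀ n : ℤ, w ≠ n) {N : ℕ} (l : Signature N) :
    0 < pathWeight z w l.1 := mul_pos (gammaFun_pos hz hw _) (dimFun_pos l.2)

/-- The sum over a level of the weights of all signatures, with multiplicity. -/
noncomputable def levelSum (z w : ℂ) (N : ℕ) : ENNReal :=
  ∑' l : Signature N, ENNReal.ofReal (pathWeight z w l.1) * ENNReal.ofReal (dimFun l.1)

/-- Double counting over the edges between two levels: summed downwards they give dimensions by the
branching rule, summed upwards they give `c` times the weight. -/
lemma levelSum_succ (N : ℕ) {c : ENNReal}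
    (h : ∀ l : Signature N, ∑' m : {m : Signature (N + 1) // Interlaces l m},
      ENNReal.ofReal (pathWeight z w m.1.1) = c * ENNReal.ofReal (pathWeight z w l.1)) :
    levelSum z w (N + 1) = c * levelSum z w N := by
  classical
  have hsub : ∀ {α : Type} (p : α → Prop) (F : α → ENNReal),
      ∑' a : {a // p a}, F a = ∑' a, if p a then F a else 0 := fun p F =>
    (tsum_subtype {a | p a} F).trans (tsum_congr fun a => by simp [Set.indicator_apply])
  calc levelSum z w (N + 1)
      = ∑' m : Signature (N + 1), ENNReal.ofReal (pathWeight z w m.1) *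
          ∑' l : {l : Signature N // Interlaces l m}, ENNReal.ofReal (dimFun l.1.1) := by
        simp only [tsum_dimFun_below, levelSum]
    _ = ∑' m : Signature (N + 1), ∑' l : Signature N, if Interlaces l m then
          ENNReal.ofReal (pathWeight z w m.1) * ENNReal.ofReal (dimFun l.1) else 0 := by
        refine tsum_congr fun m => ?_
        rw [hsub (fun l => Interlaces l m) fun l => ENNReal.ofReal (dimFun l.1),
          ← ENNReal.tsum_mul_left]
        refine tsum_congr fun l => ?_
        split_ifs <;> simp
    _ = ∑' l : Signature N, ∑' m : Signature (N + 1), if Interlaces l m then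
          ENNReal.ofReal (pathWeight z w m.1) * ENNReal.ofReal (dimFun l.1) else 0 :=
        ENNReal.tsum_comm
    _ = ∑' l : Signature N, c * (ENNReal.ofReal (pathWeight z w l.1) *
          ENNReal.ofReal (dimFun l.1)) := by
        refine tsum_congr fun l => ?_
        rw [← mul_assoc, ← h l, hsub (fun m => Interlaces l m)
          fun m => ENNReal.ofReal (pathWeight z w m.1), ← ENNReal.tsum_mul_right]
        refine tsum_congr fun l => ?_
        split_ifs <;> simp
    _ = c * levelSum z w N := ENNReal.tsum_mul_left

instance : Unique (Signature 0) :=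
  ⟨inferInstance, fun _ => Subtype.ext (funext fun i => i.elim0)⟩

lemma dimFun_zero (v : Fin 0 → ℤ) : dimFun v = 1 := by simp [dimFun]

lemma gammaFun_zero (v : Fin 0 → ℤ) : gammaFun z w v = 1 := by simp [gammaFun]

lemma levelSum_zero : levelSum z w 0 = 1 := by
  rw [levelSum, tsum_eq_single default]
  · simp [pathWeight, dimFun_zero, gammaFun_zero]
  · intro l hl
    exact absurd (Subsingleton.elim l default) hl

/-- Finiteness propagates from level zero through the coherency constants, so no multidimensional
series has to be estimated. -/
lemma levelSum_ne (hz : ∀ n : ℤ, z ≠ n) (hw : ∀ n : ℤ, w ≠ n)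
    (hzw : -(1 / 2 : ℝ) < (z + w).re) (N : ℕ) :
    levelSum z w N ≠ 0 ∧ levelSum z w N ≠ ⊤ := by
  induction N with
  | zero => simp [levelSum_zero]
  | succ N ih =>
    obtain ⟨c, hc, h⟩ := exists_coherency_const hz hw hzw N
    rw [levelSum_succ N (c := ENNReal.ofReal c) fun l => by
      simp only [pathWeight]; rw [h l, ENNReal.ofReal_mul hc.le]]
    refine ⟨mul_ne_zero ?_ ih.1, ENNReal.mul_ne_top ENNReal.ofReal_ne_top ih.2⟩
    simpa using hc

lemma S_eq (hz : ∀ n : ℤ, z ≠ n) (hw : ∀ n : ℤ, w ≠ n) (N : ℕ) :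
    S z w N = (levelSum z w N).toReal := by
  rw [S, levelSum, ENNReal.tsum_toReal_eq]
  · refine tsum_congr fun l => ?_
    rw [ENNReal.toReal_mul, ENNReal.toReal_ofReal (pathWeight_pos hz hw l).le,
      ENNReal.toReal_ofReal (dimFun_pos l.2).le, gammaWeight_eq_gammaFun, Dim_eq_dimFun, pathWeight]
    ring
  · intro l
    exact ENNReal.mul_ne_top ENNReal.ofReal_ne_top ENNReal.ofReal_ne_top

lemma S_pos (hz : ∀ n : ℤ, z ≠ n) (hw : ∀ n : ℤ, w ≠ n)
    (hzw : -(1 / 2 : ℝ) < (z + w).re) (N : ℕ) : 0 < S z w N := by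
  rw [S_eq hz hw]
  exact ENNReal.toReal_pos (levelSum_ne hz hw hzw N).1 (levelSum_ne hz hw hzw N).2

lemma P_eq {N : ℕ} (l : Signature N) : P z w l = (S z w N)⁻¹ * pathWeight z w l.1 := by
  have := (dimFun_pos l.2).ne'
  rw [P, M, gammaWeight_eq_gammaFun, Dim_eq_dimFun, pathWeight]
  field_simp

lemma P_pos (hz : ∀ n : ℤ, z ≠ n) (hw : ∀ n : ℤ, w ≠ n)
    (hzw : -(1 / 2 : ℝ) < (z + w).re) {N : ℕ} (l : Signature N) : 0 < P z w l := by
  rw [P_eq]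
  exact mul_pos (inv_pos.2 (S_pos hz hw hzw N)) (pathWeight_pos hz hw l)

lemma P_zero (l : Signature 0) (hz : ∀ n : ℤ, z ≠ n) (hw : ∀ n : ℤ, w ≠ n) : P z w l = 1 := by
  rw [P_eq, S_eq hz hw, levelSum_zero, pathWeight, dimFun_zero, gammaFun_zero]
  simp

/-- The coherency relation. -/
lemma tsum_P_above (hz : ∀ n : ℤ, z ≠ n) (hw : ∀ n : ℤ, w ≠ n)
    (hzw : -(1 / 2 : ℝ) < (z + w).re) {N : ℕ} (l : Signature N) :
    ∑' m : {m : Signature (N + 1) // Interlaces l m}, ENNReal.ofReal (P z w m.1) =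
      ENNReal.ofReal (P z w l) := by
  obtain ⟨c, hc, h⟩ := exists_coherency_const hz hw hzw N
  have h' : S z w (N + 1) = c * S z w N := by
    rw [S_eq hz hw, S_eq hz hw, levelSum_succ N (c := ENNReal.ofReal c) fun l => by
      simp only [pathWeight]; rw [h l, ENNReal.ofReal_mul hc.le], ENNReal.toReal_mul,
      ENNReal.toReal_ofReal hc.le]
  have hS := S_pos hz hw hzw N
  simp only [P_eq]
  have e : ∀ m : {m : Signature (N + 1) // Interlaces l m},
      ENNReal.ofReal ((S z w (N + 1))⁻¹ * pathWeight z w m.1.1) =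
      ENNReal.ofReal (S z w (N + 1))⁻¹ * ENNReal.ofReal (pathWeight z w m.1.1) := fun m =>
    ENNReal.ofReal_mul (inv_pos.2 (S_pos hz hw hzw (N + 1))).le
  simp only [e]
  rw [ENNReal.tsum_mul_left]
  simp only [pathWeight]
  rw [h l, ← ENNReal.ofReal_mul (inv_pos.2 (S_pos hz hw hzw (N + 1))).le, h']
  congr 1
  field_simp

end Normalization

/-! ### Events depending on finitely many levels. -/

section PathSpace

/-- The initial segment of a path up to a given level. -/
def initialSegment (n : ℕ) (t : Path) (i : Fin (n + 1)) : Signature i := t.1 i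

lemma initialSegment_eq_iff {n : ℕ} {t t' : Path} :
    initialSegment n t = initialSegment n t' ↔ ∀ i ≤ n, t.1 i = t'.1 i := by
  constructor
  · intro h i hi
    exact congrFun h ⟨i, Nat.lt_succ_of_le hi⟩
  · intro h
    funext i
    exact h i (Nat.le_of_lt_succ i.2)

lemma isFinitePath (t : Path) (N : ℕ) : IsFinitePath t.1 N := fun n _ => t.2 n

lemma measurableSet_cylinder {s : ∀ n : ℕ, Signature n} {N : ℕ} (h : IsFinitePath s N) :
    MeasurableSet (cylinder s N) :=
  MeasurableSpace.measurableSet_generateFrom ⟨N, s, h, rfl⟩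

lemma preimage_initialSegment (n : ℕ) (t : Path) :
    initialSegment n ⁻¹' {initialSegment n t} = cylinder t.1 n := by
  ext t'
  exact initialSegment_eq_iff

/-- A set of paths depends only on the first levels of a path. -/
def IsDetermined (n : ℕ) (A : Set Path) : Prop :=
  ∀ t t' : Path, (∀ i ≤ n, t.1 i = t'.1 i) → t ∈ A → t' ∈ A

lemma measurableSet_fiber (n : ℕ) (p : ∀ i : Fin (n + 1), Signature i) :
    MeasurableSet (initialSegment n ⁻¹' {p}) := by
  by_cases h : ∃ t, initialSegment n t = p
  · obtain ⟨t, rfl⟩ := h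
    rw [preimage_initialSegment]
    exact measurableSet_cylinder (isFinitePath t n)
  · convert MeasurableSet.empty
    ext t
    simp only [Set.mem_preimage, Set.mem_singleton_iff, Set.mem_empty_iff_false, iff_false]
    exact fun ht => h ⟨t, ht⟩

lemma IsDetermined.eq_preimage {n : ℕ} {A : Set Path} (hA : IsDetermined n A) :
    A = initialSegment n ⁻¹' (initialSegment n '' A) := by
  refine (Set.subset_preimage_image _ _).antisymm ?_
  rintro t ⟨t', ht', h⟩
  exact hA t' t (initialSegment_eq_iff.1 h) ht'

/-- There are only countably many initial segments of a given length, so any union of fibres is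
measurable. -/
lemma IsDetermined.measurableSet {n : ℕ} {A : Set Path} (hA : IsDetermined n A) :
    MeasurableSet A := by
  rw [hA.eq_preimage, ← Set.biUnion_of_singleton (initialSegment n '' A), Set.preimage_iUnion₂]
  exact MeasurableSet.biUnion (Set.to_countable _) fun p _ => measurableSet_fiber n p

lemma IsDetermined.mono {n n' : ℕ} (h : n ≤ n') {A : Set Path} (hA : IsDetermined n A) :
    IsDetermined n' A := fun t t' ht => hA t t' fun i hi => ht i (hi.trans h)

lemma isDetermined_level (n : ℕ) (U : Signature n → Prop) :
    IsDetermined n {t | U (t.1 n)} := fun t t' h ht => by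
  show U (t'.1 n)
  rw [← h n le_rfl]; exact ht

lemma isDetermined_step (n : ℕ) (U : Signature n → Signature (n + 1) → Prop) :
    IsDetermined (n + 1) {t | U (t.1 n) (t.1 (n + 1))} := fun t t' h ht => by
  show U (t'.1 n) (t'.1 (n + 1))
  rw [← h n (Nat.le_succ n), ← h (n + 1) le_rfl]; exact ht

lemma IsDetermined.inter {n : ℕ} {A B : Set Path} (hA : IsDetermined n A)
    (hB : IsDetermined n B) : IsDetermined n (A ∩ B) := fun t t' h ht =>
  ⟨hA t t' h ht.1, hB t t' h ht.2⟩

lemma measure_eq_tsum_fibers (ρ : Measure Path) (n : ℕ) {B : Set Path} (hB : MeasurableSet B) :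
    ρ B = ∑' p, ρ (initialSegment n ⁻¹' {p} ∩ B) := by
  rw [← measure_iUnion]
  · congr 1
    ext t
    simp
  · intro p q hpq
    refine Set.disjoint_left.2 ?_
    rintro t ⟨h1, -⟩ ⟨h2, -⟩
    exact hpq (h1.symm.trans h2)
  · exact fun p => (measurableSet_fiber n p).inter hB

end PathSpace

/-! ### One-step events and comparison of their measures. -/

section Steps

variable {z w : ℂ} {ρ : Measure Path}

-- The event is a disjoint union of cylinders one level longer, whose masses are prescribed.
open Classical in
lemma measure_cylinder_inter_step (hρ : IsZWMeasure z w ρ) (t₀ : Path) (n : ℕ)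
    (U : Signature n → Signature (n + 1) → Prop) :
    ρ (cylinder t₀.1 n ∩ {t | U (t.1 n) (t.1 (n + 1))}) =
      ∑' m : {m : Signature (n + 1) // Interlaces (t₀.1 n) m},
        if U (t₀.1 n) m then ENNReal.ofReal (P z w m.1) else 0 := by
  set s : Signature (n + 1) → ∀ k : ℕ, Signature k := fun m => Function.update t₀.1 (n + 1) m
    with hs
  have hs1 : ∀ m, s m (n + 1) = m := fun m => Function.update_self _ _ _
  have hs2 : ∀ m, ∀ k ≤ n, s m k = t₀.1 k := fun m k hk =>
    Function.update_of_ne (by omega) _ _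
  have hfin : ∀ m, Interlaces (t₀.1 n) m → IsFinitePath (s m) (n + 1) := by
    intro m hm k hk
    rcases Nat.lt_succ_iff_lt_or_eq.1 hk with h | rfl
    · rw [hs2 m k h.le, hs2 m (k + 1) h]
      exact t₀.2 k
    · rw [hs2 m k le_rfl, hs1]
      exact hm
  have key : cylinder t₀.1 n ∩ {t | U (t.1 n) (t.1 (n + 1))} =
      ⋃ m : {m : Signature (n + 1) // Interlaces (t₀.1 n) m},
        if U (t₀.1 n) m then cylinder (s m.1) (n + 1) else ∅ := by
    ext t
    simp only [Set.mem_iUnion]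
    constructor
    · rintro ⟨h1, h2⟩
      have hn := h1 n le_rfl
      have hint : Interlaces (t₀.1 n) (t.1 (n + 1)) := hn ▸ t.2 n
      refine ⟨⟨t.1 (n + 1), hint⟩, ?_⟩
      have h2' : U (t₀.1 n) (t.1 (n + 1)) := hn ▸ h2
      rw [if_pos h2']
      intro k hk
      rcases Nat.le_succ_iff.1 hk with h | rfl
      · rw [hs2 _ k h]; exact h1 k h
      · rw [hs1]
    · rintro ⟨m, hm⟩
      split_ifs at hm with h
      · have h1 : t ∈ cylinder t₀.1 n := fun k hk => by
          rw [hm k (by omega), hs2 _ k hk]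
        refine ⟨h1, ?_⟩
        show U (t.1 n) (t.1 (n + 1))
        rw [h1 n le_rfl, hm (n + 1) le_rfl, hs1]
        exact h
      · exact absurd hm (Set.notMem_empty t)
  rw [key, measure_iUnion]
  · refine tsum_congr fun m => ?_
    split_ifs
    · rw [hρ _ _ (hfin m.1 m.2), hs1]
    · simp
  · intro m m' hmm
    refine Set.disjoint_left.2 fun t h1 h2 => hmm ?_
    dsimp only at h1 h2
    split_ifs at h1 h2
    · have e1 := h1 (n + 1) le_rfl
      have e2 := h2 (n + 1) le_rfl
      rw [hs1] at e1 e2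
      exact Subtype.ext (e1.symm.trans e2)
    all_goals simp_all
  · intro m
    split_ifs
    · exact measurableSet_cylinder (hfin m.1 m.2)
    · exact MeasurableSet.empty

open Classical in
/-- A comparison of one-step transition probabilities gives a comparison of measures. -/
lemma measure_inter_step_le (hρ : IsZWMeasure z w ρ) {n : ℕ} {A : Set Path}
    (hA : IsDetermined n A) (U V : Signature n → Signature (n + 1) → Prop) (K : ENNReal)
    (h : ∀ t ∈ A, ∑' m : {m : Signature (n + 1) // Interlaces (t.1 n) m},
        (if U (t.1 n) m then ENNReal.ofReal (P z w m.1) else 0) ≤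
      K * ∑' m : {m : Signature (n + 1) // Interlaces (t.1 n) m},
        if V (t.1 n) m then ENNReal.ofReal (P z w m.1) else 0) :
    ρ (A ∩ {t | U (t.1 n) (t.1 (n + 1))}) ≤ K * ρ (A ∩ {t | V (t.1 n) (t.1 (n + 1))}) := by
  have hmeas : ∀ W : Signature n → Signature (n + 1) → Prop,
      MeasurableSet (A ∩ {t | W (t.1 n) (t.1 (n + 1))}) := fun W =>
    ((hA.mono (Nat.le_succ n)).inter (isDetermined_step n W)).measurableSet
  rw [measure_eq_tsum_fibers ρ n (hmeas U), measure_eq_tsum_fibers ρ n (hmeas V),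
    ← ENNReal.tsum_mul_left]
  refine ENNReal.tsum_le_tsum fun p => ?_
  by_cases hp : ∃ t ∈ A, initialSegment n t = p
  · obtain ⟨t, htA, rfl⟩ := hp
    have hsub : cylinder t.1 n ⊆ A := fun t' ht' => hA t t' (fun i hi => (ht' i hi).symm) htA
    rw [preimage_initialSegment, ← Set.inter_assoc, ← Set.inter_assoc,
      Set.inter_eq_left.2 hsub, measure_cylinder_inter_step hρ, measure_cylinder_inter_step hρ]
    exact h t htA
  · have : initialSegment n ⁻¹' {p} ∩ (A ∩ {t | U (t.1 n) (t.1 (n + 1))}) = ∅ := by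
      ext t
      simp only [Set.mem_inter_iff, Set.mem_empty_iff_false, iff_false]
      rintro ⟨h1, h2, -⟩
      exact hp ⟨t, h2, h1⟩
    rw [this, measure_empty]
    exact zero_le

end Steps

/-! ### Existence and uniqueness of the measures. -/

section Existence

variable {z w : ℂ}

/-- The signatures which can follow a given one along a path. -/
def Above {N : ℕ} (l : Signature N) : Type := {m : Signature (N + 1) // Interlaces l m}

instance {N : ℕ} (l : Signature N) : MeasurableSpace (Above l) := ⊤

instance {N : ℕ} (l : Signature N) : DiscreteMeasurableSpace (Above l) :=
  ⟨fun _ => MeasurableSpace.measurableSet_top⟩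

/-- The one-step transition probabilities of the `(z,w)`-measure. -/
noncomputable def stepPMF (hz : ∀ n : ℤ, z ≠ n) (hw : ∀ n : ℤ, w ≠ n)
    (hzw : -(1 / 2 : ℝ) < (z + w).re) {N : ℕ} (l : Signature N) : PMF (Above l) :=
  ⟨fun m => ENNReal.ofReal (P z w m.1) / ENNReal.ofReal (P z w l), by
    have h := tsum_P_above hz hw hzw l
    have h1 : ∑' m : Above l, ENNReal.ofReal (P z w m.1) / ENNReal.ofReal (P z w l) = 1 := by
      simp only [div_eq_mul_inv]
      rw [ENNReal.tsum_mul_right]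
      refine (congrArg (· * _) h).trans (ENNReal.mul_inv_cancel ?_ ENNReal.ofReal_ne_top)
      simpa using P_pos hz hw hzw l
    rw [← h1]
    exact ENNReal.summable.hasSum⟩

/-- The path which follows a given choice of steps. -/
def pathOf (ω : ∀ p : Σ N, Signature N, Above p.2) : Path :=
  ⟨fun N => Nat.rec default (fun n l => (ω ⟨n, l⟩).1) N, fun N => (ω ⟨N, _⟩).2⟩

lemma pathOf_succ (ω : ∀ p : Σ N, Signature N, Above p.2) (n : ℕ) :
    (pathOf ω).1 (n + 1) = (ω ⟨n, (pathOf ω).1 n⟩).1 := rfl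

/-- A cylinder constrains the choices at the vertices it visits and at no others, so the product
measure of its preimage is a finite product. -/
lemma preimage_pathOf_cylinder [DecidableEq (Σ N, Signature N)]
    {s : ∀ n : ℕ, Signature n} {N : ℕ} :
    pathOf ⁻¹' cylinder s N =
      Set.pi ((Finset.range N).image fun n => (⟨n, s n⟩ : Σ N, Signature N))
        (fun p : Σ N, Signature N => {m : Above p.2 | m.1 = s (p.1 + 1)}) := by
  ext ω
  simp only [Set.mem_preimage, Set.mem_pi, Finset.mem_coe, Finset.mem_image, Finset.mem_range,
    forall_exists_index, and_imp]
  constructor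
  · rintro h _ n hn rfl
    have h1 := h n hn.le
    have h2 := h (n + 1) hn
    rw [pathOf_succ, h1] at h2
    exact h2
  · intro h n
    induction n with
    | zero => exact fun _ => Subsingleton.elim _ _
    | succ n ih =>
      intro hn
      rw [pathOf_succ, ih (by omega)]
      exact h _ n hn rfl

/-- Draw a successor independently at every vertex of the graph and follow the arrows. A path meets
each level once, so the choices it uses are independent, and the transition probabilities multiply
to a telescoping product. -/
lemma exists_isZWMeasure (hz : ∀ n : ℤ, z ≠ n) (hw : ∀ n : ℤ, w ≠ n)
    (hzw : -(1 / 2 : ℝ) < (z + w).re) : ∃ ρ : Measure Path, IsZWMeasure z w ρ := by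
  classical
  let μ : ∀ p : Σ N, Signature N, Measure (Above p.2) := fun p => (stepPMF hz hw hzw p.2).toMeasure
  have hmeas : Measurable pathOf := by
    refine measurable_generateFrom ?_
    rintro C ⟨N, s, -, rfl⟩
    rw [preimage_pathOf_cylinder]
    exact MeasurableSet.pi (Finset.countable_toSet _) fun p _ => MeasurableSet.of_discrete
  refine ⟨(Measure.infinitePi μ).map pathOf, fun N s hs => ?_⟩
  rw [Measure.map_apply hmeas (measurableSet_cylinder hs), preimage_pathOf_cylinder,
    Measure.infinitePi_pi _ (fun p _ => MeasurableSet.of_discrete), Finset.prod_image]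
  · have h1 : ∀ n ∈ Finset.range N, μ ⟨n, s n⟩ {m : Above (s n) | m.1 = s (n + 1)} =
        ENNReal.ofReal (P z w (s (n + 1))) / ENNReal.ofReal (P z w (s n)) := by
      intro n hn
      have hint : Interlaces (s n) (s (n + 1)) := hs n (Finset.mem_range.1 hn)
      let m₀ : Above (s n) := ⟨s (n + 1), hint⟩
      have e : {m : Above (s n) | m.1 = s (n + 1)} = {m₀} := by
        ext m
        exact ⟨fun h => Subtype.ext h, fun h => congrArg Subtype.val h⟩
      rw [e]
      exact PMF.toMeasure_apply_singleton (stepPMF hz hw hzw (s n)) m₀ MeasurableSet.of_discrete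
    rw [Finset.prod_congr rfl h1]
    clear h1
    induction N with
    | zero => simp [P_zero _ hz hw]
    | succ N ih =>
      rw [Finset.prod_range_succ, ih fun n hn => hs n (hn.trans (Nat.lt_succ_self N))]
      refine ENNReal.mul_div_cancel ?_ ENNReal.ofReal_ne_top
      simpa using P_pos hz hw hzw (s N)
  · intro n _ n' _ h
    exact congrArg Sigma.fst h

lemma isPiSystem_cylinders : IsPiSystem cylinders := by
  have key : ∀ (N N' : ℕ) (s s' : ∀ n : ℕ, Signature n), N ≤ N' → IsFinitePath s' N' →
      (cylinder s N ∩ cylinder s' N').Nonempty → cylinder s N ∩ cylinder s' N' ∈ cylinders := by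
    rintro N N' s s' hN hs' ⟨t, h1, h2⟩
    refine ⟨N', s', hs', Set.inter_eq_right.2 fun t' ht' n hn => ?_⟩
    rw [ht' n (hn.trans hN), ← h2 n (hn.trans hN), h1 n hn]
  rintro _ ⟨N, s, hs, rfl⟩ _ ⟨N', s', hs', rfl⟩ h
  rcases le_total N N' with hN | hN
  · exact key N N' s s' hN hs' h
  · rw [Set.inter_comm] at h ⊢
    exact key N' N s' s hN hs h

lemma IsZWMeasure.isProbabilityMeasure (hz : ∀ n : ℤ, z ≠ n) (hw : ∀ n : ℤ, w ≠ n)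
    {ρ : Measure Path} (hρ : IsZWMeasure z w ρ) : IsProbabilityMeasure ρ := by
  constructor
  have h := hρ 0 (fun _ => default) fun n hn => absurd hn (Nat.not_lt_zero n)
  rw [P_zero _ hz hw, ENNReal.ofReal_one] at h
  rw [← h]
  congr 1
  ext t
  simp only [Set.mem_univ, true_iff]
  intro n hn
  obtain rfl : n = 0 := by omega
  exact Subsingleton.elim _ _

lemma IsZWMeasure.unique (hz : ∀ n : ℤ, z ≠ n) (hw : ∀ n : ℤ, w ≠ n)
    {ρ ρ' : Measure Path} (hρ : IsZWMeasure z w ρ) (hρ' : IsZWMeasure z w ρ') : ρ = ρ' := by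
  have := hρ.isProbabilityMeasure hz hw
  have := hρ'.isProbabilityMeasure hz hw
  refine ext_of_generate_finite cylinders rfl isPiSystem_cylinders ?_ (by simp)
  rintro _ ⟨N, s, hs, rfl⟩
  rw [hρ N s hs, hρ' N s hs]

lemma existsUnique_isZWMeasure (hz : ∀ n : ℤ, z ≠ n) (hw : ∀ n : ℤ, w ≠ n)
    (hzw : -(1 / 2 : ℝ) < (z + w).re) : ∃! ρ : Measure Path, IsZWMeasure z w ρ := by
  obtain ⟨ρ, hρ⟩ := exists_isZWMeasure hz hw hzw
  exact ⟨ρ, hρ, fun ρ' hρ' => hρ'.unique hz hw hρ⟩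

end Existence

/-! ### Effect on the weight of moving one particle to the right. -/

section WeightAt

variable {z w : ℂ} {N : ℕ}

/-- The weight of a path as a function of the shifted coordinates of its endpoint. -/
noncomputable def weightAt (z w : ℂ) {N : ℕ} (y : Fin N → ℤ) : ℝ :=
  (∏ i, gammaFactor z w N (y i)) *
    ∏ i : Fin N, ∏ j ∈ Finset.Ioi i, ((y i : ℝ) - y j) / ((j : ℝ) - (i : ℝ))

lemma pathWeight_eq_weightAt (v : Fin N → ℤ) : pathWeight z w v = weightAt z w (shifted v) := by
  rw [pathWeight, weightAt, dimFun_eq_prod, gammaFun]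

lemma weightAt_pos (hz : ∀ n : ℤ, z ≠ n) (hw : ∀ n : ℤ, w ≠ n) {y : Fin N → ℤ}
    (hy : StrictAnti y) : 0 < weightAt z w y := by
  refine mul_pos (Finset.prod_pos fun _ _ => gammaFactor_pos hz hw _ _)
    (Finset.prod_pos fun i _ => Finset.prod_pos fun j hj => ?_)
  have h : i < j := Finset.mem_Ioi.1 hj
  have h1 : (i : ℝ) < j := by exact_mod_cast h
  have h2 : (y j : ℝ) < y i := by exact_mod_cast hy h
  apply div_pos <;> linarith

lemma prod_update_mul {ι : Type*} [Fintype ι] [DecidableEq ι] (F : ℤ → ℝ) (y : ι → ℤ) (k : ι)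
    (a b : ℤ) : (∏ i, F (Function.update y k a i)) * F b =
      (∏ i, F (Function.update y k b i)) * F a := by
  have h : ∀ c, ∏ i, F (Function.update y k c i) = F c * ∏ i ∈ Finset.univ \ {k}, F (y i) := by
    intro c
    rw [← Finset.prod_update_of_mem (Finset.mem_univ k) (fun i => F (y i)) (F c)]
    refine Finset.prod_congr rfl fun i _ => ?_
    rcases eq_or_ne i k with rfl | h
    · simp
    · simp [h]
  rw [h, h]; ring

/-- Moving one particle by one changes the gamma factors by a rational function. -/
lemma prod_gammaFactor_update (hz : ∀ n : ℤ, z ≠ n) (hw : ∀ n : ℤ, w ≠ n) (y : Fin N → ℤ)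
    (k : Fin N) (m : ℤ) :
    (∏ i, gammaFactor z w N (Function.update y k (m + 1) i)) * ‖w + N + 1 + m‖ ^ 2 =
      (∏ i, gammaFactor z w N (Function.update y k m i)) * ‖z - m - 1‖ ^ 2 := by
  have h1 := prod_update_mul (gammaFactor z w N) y k (m + 1) m
  have h2 := gammaFactor_step hz hw N m
  have h3 := (gammaFactor_pos hz hw N m).ne'
  apply mul_right_cancel₀ h3
  linear_combination ‖w + N + 1 + m‖ ^ 2 * h1 +
    (∏ i, gammaFactor z w N (Function.update y k m i)) * h2

/-- Spreading a product over row `k` as a double product lets the estimates on the dimension be made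
factor by factor. -/
lemma prod_Ioi_eq_single {k : Fin N} (t : Fin N → ℝ) :
    ∏ i : Fin N, ∏ j ∈ Finset.Ioi i, (if i = k then t j else 1) = ∏ j ∈ Finset.Ioi k, t j := by
  rw [Finset.prod_eq_single k]
  · exact Finset.prod_congr rfl fun j _ => if_pos rfl
  · intro i _ hi
    exact Finset.prod_eq_one fun j _ => if_neg hi
  · exact fun h => absurd (Finset.mem_univ k) h

lemma prod_Ioi_telescope (N : ℕ) (k : Fin N) (h : ℕ → ℝ) (h0 : ∀ j, h j ≠ 0) :
    ∏ j ∈ Finset.Ioi k, h ((j : ℕ) + 1) / h j = h N / h (k + 1) := by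
  have e1 : ∏ j ∈ Finset.Ioi k, h ((j : ℕ) + 1) / h j =
      ∏ j ∈ Finset.Ico ((k : ℕ) + 1) N, h (j + 1) / h j := by
    refine Finset.prod_bij (fun (j : Fin N) _ => (j : ℕ)) ?_ ?_ ?_ ?_
    · intro j hj
      have : k < j := Finset.mem_Ioi.1 hj
      rw [Finset.mem_Ico]
      exact ⟨this, j.2⟩
    · exact fun a _ b _ hab => Fin.ext hab
    · intro j hj
      rw [Finset.mem_Ico] at hj
      exact ⟨⟨j, hj.2⟩, Finset.mem_Ioi.2 (Fin.lt_def.2 hj.1), rfl⟩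
    · exact fun _ _ => rfl
  rw [e1]
  have e2 : ∀ n, (k : ℕ) + 1 ≤ n →
      ∏ j ∈ Finset.Ico ((k : ℕ) + 1) n, h (j + 1) / h j = h n / h (k + 1) := by
    intro n hn
    induction n, hn using Nat.le_induction with
    | base => simp [h0]
    | succ n hn ih =>
      rw [Finset.prod_Ico_succ_top hn, ih]
      field_simp [h0]
  exact e2 N k.2

lemma val_le_of_strictAnti {y : Fin N → ℤ} (hy : StrictAnti y) {k : Fin N} :
    ∀ j : Fin N, k ≤ j → y j ≤ y k - ((j : ℤ) - k) := by
  rintro ⟨j, hj⟩ hkj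
  have hkj' : (k : ℕ) ≤ j := hkj
  induction j, hkj' using Nat.le_induction with
  | base => simp
  | succ n hn ih =>
    have h1 := ih (by omega) (Fin.le_def.2 hn)
    have h2 : y ⟨n + 1, hj⟩ < y ⟨n, by omega⟩ := hy (Fin.lt_def.2 (Nat.lt_succ_self n))
    push_cast at h1 ⊢
    omega

/-- Upper bound for the effect of moving one particle to the right. -/
lemma weightAt_update_le (hz : ∀ n : ℤ, z ≠ n) (hw : ∀ n : ℤ, w ≠ n) {y : Fin N → ℤ} {k : Fin N}
    {c m : ℤ} (hm : c - 1 ≤ m) (h1 : StrictAnti (Function.update y k m))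
    (h2 : StrictAnti (Function.update y k (m + 1)))
    (hy : ∀ j, k < j → y j ≤ c - 1 - ((j : ℤ) - k)) :
    weightAt z w (Function.update y k (m + 1)) * ‖w + N + 1 + m‖ ^ 2 * (m - c + 2) ≤
      weightAt z w (Function.update y k m) * ‖z - m - 1‖ ^ 2 * (m - c + 1 + N) := by
  have hmc : (c : ℝ) - 1 ≤ m := by exact_mod_cast hm
  -- For `j > k` the gap `m - y j` is at least `h j`, so the move multiplies that factor by at most
  -- `h (j + 1) / h j`, and the bounds telescope. The factors with rows above `k` decrease.
  set h : ℕ → ℝ := fun j => if (k : ℕ) < j then (m : ℝ) - c + 1 + (j - (k : ℕ)) else 1 with hh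
  have hpos : ∀ j, 0 < h j := by
    intro j
    simp only [hh]
    split_ifs with hj
    · have : ((k : ℕ) : ℝ) + 1 ≤ j := by exact_mod_cast hj
      linarith
    · exact one_pos
  have hdim : ∏ i : Fin N, ∏ j ∈ Finset.Ioi i, ((Function.update y k (m + 1) i : ℝ) -
      Function.update y k (m + 1) j) / ((j : ℝ) - (i : ℝ)) ≤
      (∏ i : Fin N, ∏ j ∈ Finset.Ioi i, ((Function.update y k m i : ℝ) -
      Function.update y k m j) / ((j : ℝ) - (i : ℝ))) * (h N / h (k + 1)) := by
    rw [← prod_Ioi_telescope N k h fun j => (hpos j).ne', ← prod_Ioi_eq_single (k := k)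
      (fun j : Fin N => h ((j : ℕ) + 1) / h j), ← Finset.prod_mul_distrib]
    have hfac : ∀ i j : Fin N, i < j → 0 < ((Function.update y k (m + 1) i : ℝ) -
        Function.update y k (m + 1) j) / ((j : ℝ) - (i : ℝ)) := by
      intro i j hij
      have h3 : (i : ℝ) < j := by exact_mod_cast hij
      have h4 : ((Function.update y k (m + 1) j : ℤ) : ℝ) < Function.update y k (m + 1) i := by
        exact_mod_cast h2 hij
      apply div_pos <;> linarith
    refine Finset.prod_le_prod (fun i _ => Finset.prod_nonneg fun j hj =>
      (hfac i j (Finset.mem_Ioi.1 hj)).le) fun i _ => ?_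
    rw [← Finset.prod_mul_distrib]
    refine Finset.prod_le_prod (fun j hj => (hfac i j (Finset.mem_Ioi.1 hj)).le) fun j hj => ?_
    have hij : i < j := Finset.mem_Ioi.1 hj
    have h3 : (i : ℝ) < j := by exact_mod_cast hij
    rw [div_mul_eq_mul_div]
    refine div_le_div_of_nonneg_right ?_ (by linarith)
    by_cases hik : i = k
    · subst hik
      rw [if_pos rfl, Function.update_self, Function.update_self,
        Function.update_of_ne hij.ne', Function.update_of_ne hij.ne', ← mul_div_assoc,
        le_div_iff₀ (hpos _)]
      have hij' : (i : ℕ) < j := hij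
      have e1 : h ((j : ℕ) + 1) = h j + 1 := by
        simp only [hh]
        rw [if_pos hij', if_pos (by omega)]
        push_cast; ring
      have e2 : h j = (m : ℝ) - c + 1 + ((j : ℕ) - (i : ℕ)) := by
        simp only [hh]
        rw [if_pos hij']
      have e3 : (y j : ℝ) ≤ c - 1 - (((j : ℕ) : ℝ) - (i : ℕ)) := by exact_mod_cast hy j hij
      rw [e1]
      push_cast
      have e4 : h j ≤ m - y j := by rw [e2]; linarith
      nlinarith
    · rw [if_neg hik, mul_one, Function.update_of_ne hik, Function.update_of_ne hik]
      by_cases hjk : j = k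
      · subst hjk
        rw [Function.update_self, Function.update_self]
        push_cast
        linarith
      · rw [Function.update_of_ne hjk, Function.update_of_ne hjk]
  have e1 : h (k + 1) = m - c + 2 := by
    simp only [hh]; rw [if_pos (Nat.lt_succ_self _)]; push_cast; ring
  have e2 : h N ≤ m - c + 1 + N := by
    simp only [hh]
    rw [if_pos k.2]
    have : (0 : ℝ) ≤ (k : ℕ) := Nat.cast_nonneg _
    linarith
  have hD0 : 0 ≤ ∏ i : Fin N, ∏ j ∈ Finset.Ioi i, ((Function.update y k m i : ℝ) -
      Function.update y k m j) / ((j : ℝ) - (i : ℝ)) := by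
    refine Finset.prod_nonneg fun i _ => Finset.prod_nonneg fun j hj => ?_
    have hij : i < j := Finset.mem_Ioi.1 hj
    have h3 : (i : ℝ) < j := by exact_mod_cast hij
    have h4 : ((Function.update y k m j : ℤ) : ℝ) < Function.update y k m i := by
      exact_mod_cast h1 hij
    apply div_nonneg <;> linarith
  have hp : 0 < (m : ℝ) - c + 2 := by linarith
  rw [e1, ← mul_div_assoc, le_div_iff₀ hp] at hdim
  have hdim' := hdim.trans (mul_le_mul_of_nonneg_left e2 hD0)
  have hg := prod_gammaFactor_update hz hw y k m
  have hg0 : 0 ≤ (∏ i, gammaFactor z w N (Function.update y k m i)) * ‖z - m - 1‖ ^ 2 :=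
    mul_nonneg (Finset.prod_nonneg fun _ _ => (gammaFactor_pos hz hw _ _).le) (sq_nonneg _)
  have := mul_le_mul_of_nonneg_left hdim' hg0
  unfold weightAt
  refine (le_of_eq ?_).trans (this.trans (le_of_eq ?_))
  · rw [← hg]; ring
  · ring

/-- The constant which governs the decay of the weights to the right of the threshold. -/
noncomputable def decayConst (z : ℂ) (c : ℕ) : ℝ := (1 + (c + ‖z‖)) ^ 2

lemma one_le_decayConst (z : ℂ) (c : ℕ) : 1 ≤ decayConst z c := by
  have : 0 ≤ (c : ℝ) + ‖z‖ := by positivity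
  unfold decayConst
  nlinarith

/-- Passing from `c - 1` to `c` gains at most a factor `N` in the dimension, but the gamma factors
lose order `N²`. -/
lemma weightAt_threshold_le (hz : ∀ n : ℤ, z ≠ n) (hw : ∀ n : ℤ, w ≠ n) {y : Fin N → ℤ}
    {k : Fin N} {c : ℕ} (hN : decayConst z c + 1 + 2 * ‖w‖ ≤ N)
    (h1 : StrictAnti (Function.update y k (c - 1 : ℤ)))
    (h2 : StrictAnti (Function.update y k (c : ℤ)))
    (hy : ∀ j, k < j → y j ≤ c - 1 - ((j : ℤ) - k)) :
    weightAt z w (Function.update y k (c : ℤ)) ≤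
      weightAt z w (Function.update y k (c - 1 : ℤ)) := by
  have h := weightAt_update_le hz hw (c := c) (m := c - 1) le_rfl h1 (by simpa using h2) hy
  push_cast at h
  simp only [sub_add_cancel] at h
  have e1 : (c : ℝ) - 1 - c + 2 = 1 := by ring
  have e2 : (c : ℝ) - 1 - c + 1 + N = N := by ring
  rw [e1, e2, mul_one] at h
  have hW := (weightAt_pos hz hw h1).le
  have hW2 := (weightAt_pos hz hw h2).le
  have hb : 0 ≤ ‖w‖ := norm_nonneg w
  have hB : 0 ≤ (c : ℝ) + ‖z‖ := by positivity
  have ha := one_le_decayConst z c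
  have n1 : ‖z - (c - 1) - 1‖ ≤ c + ‖z‖ := by
    have : z - (c - 1) - 1 = z - (c : ℕ) := by ring
    rw [this]
    refine (norm_sub_le _ _).trans ?_
    rw [Complex.norm_natCast]; linarith
  have n2 : (N : ℝ) - ‖w‖ ≤ ‖w + N + 1 + (c - 1)‖ := by
    have : w + N + 1 + (c - 1) = ((N + c : ℕ) : ℂ) - -w := by push_cast; ring
    rw [this]
    refine le_trans ?_ (norm_sub_norm_le _ _)
    rw [Complex.norm_natCast, norm_neg]
    push_cast
    have : (0 : ℝ) ≤ c := Nat.cast_nonneg c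
    linarith
  have hNpos : 0 < (N : ℝ) := by linarith
  have hNb : 0 < (N : ℝ) - ‖w‖ := by linarith
  have s1 : ‖z - (c - 1) - 1‖ ^ 2 ≤ decayConst z c := by
    calc _ ≤ ((c : ℝ) + ‖z‖) ^ 2 := by gcongr
      _ ≤ _ := by unfold decayConst; nlinarith
  have s2 : ((N : ℝ) - ‖w‖) ^ 2 ≤ ‖w + N + 1 + (c - 1)‖ ^ 2 := by gcongr
  have s3 : decayConst z c * N ≤ ((N : ℝ) - ‖w‖) ^ 2 := by nlinarith
  have s4 : 0 < ‖w + N + 1 + (c - 1 : ℂ)‖ ^ 2 := by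
    refine lt_of_lt_of_le ?_ s2
    positivity
  refine le_of_mul_le_mul_right (h.trans ?_) s4
  rw [mul_assoc]
  refine mul_le_mul_of_nonneg_left ?_ hW
  refine le_trans (mul_le_mul_of_nonneg_right s1 hNpos.le) (s3.trans s2)

/-- With `a` the decay constant, the step from `c + e` to `c + e + 1` multiplies the weight by at
most `(e + a) / (e + a + 2)`. The product of these bounds telescopes and is summable in `e`,
independently of `N`. -/
lemma weightAt_decay (hz : ∀ n : ℤ, z ≠ n) (hw : ∀ n : ℤ, w ≠ n) {y : Fin N → ℤ}
    {k : Fin N} {c : ℕ} (hN : decayConst z c + 1 + 2 * ‖w‖ ≤ N) (e : ℕ)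
    (h1 : ∀ i : ℕ, i ≤ e → StrictAnti (Function.update y k ((c + i : ℕ) : ℤ)))
    (hy : ∀ j, k < j → y j ≤ c - 1 - ((j : ℤ) - k)) :
    weightAt z w (Function.update y k ((c + e : ℕ) : ℤ)) ≤
      decayConst z c * (decayConst z c + 1) / ((e + decayConst z c) * (e + decayConst z c + 1)) *
      weightAt z w (Function.update y k (c : ℤ)) := by
  set a := decayConst z c with ha
  have ha1 : 1 ≤ a := one_le_decayConst z c
  have hb : 0 ≤ ‖w‖ := norm_nonneg w
  have hB : 0 ≤ (c : ℝ) + ‖z‖ := by positivity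
  have hc0 : (0 : ℝ) ≤ c := Nat.cast_nonneg c
  induction e with
  | zero =>
    have : a * (a + 1) / ((((0 : ℕ) : ℝ) + a) * (((0 : ℕ) : ℝ) + a + 1)) = 1 := by
      rw [Nat.cast_zero, zero_add]
      exact div_self (by positivity)
    rw [this, one_mul, add_zero]
  | succ e ih =>
    have ih' := ih fun i hi => h1 i (by omega)
    have g1 := h1 e (by omega)
    have g2 := h1 (e + 1) le_rfl
    have hc : ((c + (e + 1) : ℕ) : ℤ) = ((c + e : ℕ) : ℤ) + 1 := by push_cast; ring
    rw [hc] at g2 ⊢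
    have h := weightAt_update_le hz hw (c := c) (m := ((c + e : ℕ) : ℤ)) (by omega) g1 g2 hy
    have hW := (weightAt_pos hz hw g1).le
    have he : (0 : ℝ) ≤ e := Nat.cast_nonneg e
    push_cast at h
    have e1 : (c : ℝ) + e - c + 2 = e + 2 := by ring
    have e2 : (c : ℝ) + e - c + 1 + N = e + 1 + N := by ring
    rw [e1, e2] at h
    set B := (c : ℝ) + ‖z‖ with hBdef
    have n1 : ‖z - (c + e) - 1‖ ≤ e + 1 + B := by
      have : z - (c + e) - 1 = z - (c + e + 1 : ℕ) := by push_cast; ring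
      rw [this]
      refine (norm_sub_le _ _).trans ?_
      rw [Complex.norm_natCast]; push_cast; linarith
    have n2 : (N : ℝ) + 1 + e - ‖w‖ ≤ ‖w + N + 1 + (c + e)‖ := by
      have : w + N + 1 + (c + e) = ((N + 1 + c + e : ℕ) : ℂ) - -w := by push_cast; ring
      rw [this]
      refine le_trans ?_ (norm_sub_norm_le _ _)
      rw [Complex.norm_natCast, norm_neg]
      push_cast
      linarith
    have hpos : 0 < (N : ℝ) + 1 + e - ‖w‖ := by linarith
    have s1 : ‖z - (c + e) - 1‖ ^ 2 ≤ (e + 2) * (e + a) := by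
      calc _ ≤ (e + 1 + B) ^ 2 := by gcongr
        _ ≤ _ := by
          have : a = (1 + B) ^ 2 := ha
          rw [this]
          nlinarith [mul_nonneg he hB, mul_nonneg he (sq_nonneg B)]
    have s2 : ((N : ℝ) + 1 + e - ‖w‖) ^ 2 ≤ ‖w + N + 1 + (c + e)‖ ^ 2 := by gcongr
    -- With `X = N + 1 + e`, the lower bound on `N` gives `e + a + 2 ≤ X - 2‖w‖`, and `X (X - 2‖w‖)
    -- ≤ (X - ‖w‖)²`.
    have s3 : ((e : ℝ) + 1 + N) * (e + a + 2) ≤ ((N : ℝ) + 1 + e - ‖w‖) ^ 2 := by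
      have : ((e : ℝ) + 1 + N) * (e + a + 2) ≤ (e + 1 + N) * (N + 1 + e - 2 * ‖w‖) :=
        mul_le_mul_of_nonneg_left (by linarith) (by positivity)
      nlinarith
    have s4 : 0 < ‖w + N + 1 + (c + e : ℂ)‖ ^ 2 := lt_of_lt_of_le (by positivity) s2
    have step : weightAt z w (Function.update y k (((c + e : ℕ) : ℤ) + 1)) * (e + a + 2) ≤
        weightAt z w (Function.update y k ((c + e : ℕ) : ℤ)) * (e + a) := by
      have hp2 : 0 < ‖w + N + 1 + (c + e : ℂ)‖ ^ 2 * ((e : ℝ) + 2) := by positivity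
      refine le_of_mul_le_mul_right ?_ hp2
      push_cast
      calc _ = weightAt z w (Function.update y k ((c : ℤ) + e + 1)) *
            ‖w + N + 1 + (c + e)‖ ^ 2 * (e + 2) * (e + a + 2) := by ring
        _ ≤ weightAt z w (Function.update y k ((c : ℤ) + e)) * ‖z - (c + e) - 1‖ ^ 2 *
            (e + 1 + N) * (e + a + 2) := mul_le_mul_of_nonneg_right h (by positivity)
        _ = weightAt z w (Function.update y k ((c : ℤ) + e)) * (‖z - (c + e) - 1‖ ^ 2 *
            ((e + 1 + N) * (e + a + 2))) := by ring
        _ ≤ weightAt z w (Function.update y k ((c : ℤ) + e)) * (((e + 2) * (e + a)) *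
            ‖w + N + 1 + (c + e)‖ ^ 2) := by
          push_cast at hW
          refine mul_le_mul_of_nonneg_left ?_ hW
          exact mul_le_mul s1 (s3.trans s2) (by positivity) (by positivity)
        _ = _ := by ring
    have hq : 0 < (e : ℝ) + a + 2 := by linarith
    calc _ ≤ weightAt z w (Function.update y k ((c + e : ℕ) : ℤ)) * (e + a) / (e + a + 2) := by
          rwa [le_div_iff₀ hq]
      _ ≤ (a * (a + 1) / ((e + a) * (e + a + 1)) * weightAt z w (Function.update y k (c : ℤ))) *
          (e + a) / (e + a + 2) := by gcongr
      _ = _ := by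
        push_cast
        have p1 : (e : ℝ) + a ≠ 0 := by positivity
        have p2 : (e : ℝ) + a + 1 ≠ 0 := by positivity
        have p3 : (e : ℝ) + 1 + a = e + a + 1 := by ring
        have p4 : (e : ℝ) + a + 1 + 1 = e + a + 2 := by ring
        rw [p3, p4]
        field_simp

lemma tsum_decay_ne_top {a : ℝ} (ha : 1 ≤ a) :
    ∑' e : ℕ, ENNReal.ofReal (a * (a + 1) / ((e + a) * (e + a + 1))) ≠ ⊤ := by
  have hs : Summable fun e : ℕ => a * (a + 1) / (((e : ℝ) + a) * (e + a + 1)) := by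
    refine summable_of_sum_range_le (c := a + 1) (fun e => by positivity) fun n => ?_
    have : ∀ n : ℕ, ∑ e ∈ Finset.range n, a * (a + 1) / (((e : ℝ) + a) * (e + a + 1)) =
        (a + 1) - a * (a + 1) / (n + a) := by
      intro n
      induction n with
      | zero => simp; field_simp; ring
      | succ n ih =>
        rw [Finset.sum_range_succ, ih]
        push_cast
        have p1 : (n : ℝ) + a ≠ 0 := by positivity
        have p2 : (n : ℝ) + a + 1 ≠ 0 := by positivity
        have p3 : (n : ℝ) + 1 + a = n + a + 1 := by ring
        rw [p3]
        field_simp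
        ring
    rw [this]
    have : 0 ≤ a * (a + 1) / (n + a) := by positivity
    linarith
  exact hs.tsum_ofReal_ne_top

end WeightAt

/-! ### Crossings of a fixed diagonal. -/

section Crossing

variable {z w z' w' : ℂ} {N : ℕ}

/-- Some row crosses the diagonal of content `c` between two consecutive levels. -/
def Crosses (c : ℤ) (l : Signature N) (m : Signature (N + 1)) : Prop :=
  ∃ k : Fin N, shifted l.1 k < c ∧ c ≤ shifted m.1 k.castSucc

/-- Pulling a row back, no further than its old position, keeps the signature among the possible
successors of `l`, so the comparison stays within one transition. -/
lemma exists_update_signature {l : Signature N} {m : Signature (N + 1)} (h : Interlaces l m)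
    (k : Fin N) {v : ℤ} (h1 : shifted l.1 k ≤ v) (h2 : v ≤ shifted m.1 k.castSucc) :
    ∃ m' : Signature (N + 1), Interlaces l m' ∧
      shifted m'.1 = Function.update (shifted m.1) k.castSucc v := by
  let m' : Fin (N + 1) → ℤ := fun i => Function.update (shifted m.1) k.castSucc v i +
    ((i : ℕ) + 1 : ℕ)
  have hm' : shifted m' = Function.update (shifted m.1) k.castSucc v := by
    funext i; simp [shifted, m']
  have h' := interlaces_iff_shifted.1 h
  have key : ∀ i : Fin N, shifted l.1 i ≤ shifted m' i.castSucc ∧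
      shifted m' i.succ < shifted l.1 i := by
    intro i
    rw [hm']
    refine ⟨?_, ?_⟩
    · rcases eq_or_ne i k with rfl | hik
      · rwa [Function.update_self]
      · rw [Function.update_of_ne ((Fin.castSucc_injective N).ne hik)]
        exact (h' i).1
    · rcases eq_or_ne i.succ k.castSucc with hik | hik
      · rw [hik, Function.update_self]
        exact h2.trans_lt (hik ▸ (h' i).2)
      · rw [Function.update_of_ne hik]
        exact (h' i).2
  have hint : ∀ i : Fin N, l.1 i ≤ m' i.castSucc ∧ m' i.succ ≤ l.1 i := by
    intro i
    have := key i
    simp only [shifted] at this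
    push_cast [Fin.val_castSucc, Fin.val_succ] at this
    constructor <;> omega
  exact ⟨⟨m', antitone_of_interlaces hint⟩, hint, hm'⟩

/-- A row can reach `c` only if the row above it was already beyond `c`. Applied in both directions,
this shows that the crossing row is determined by `l`. -/
lemma crosses_row_unique {c : ℤ} {l : Signature N} {m : Signature (N + 1)}
    (h : Interlaces l m) {k k' : Fin N} (h1 : shifted l.1 k < c)
    (h2 : c ≤ shifted m.1 k'.castSucc) : k' ≤ k := by
  by_contra hlt
  rw [not_le] at hlt
  have hlt' : (k : ℕ) < k' := hlt
  have h3 := (interlaces_iff_shifted.1 h ⟨(k' : ℕ) - 1, by omega⟩).2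
  have h4 : (⟨(k' : ℕ) - 1, by omega⟩ : Fin N).succ = k'.castSucc := by
    ext; simp; omega
  rw [h4] at h3
  have h5 : shifted l.1 ⟨(k' : ℕ) - 1, by omega⟩ ≤ shifted l.1 k :=
    (shifted_strictAnti l.2).antitone (Fin.le_def.2 (by simp; omega))
  omega

open Classical in
/-- The probability of a crossing is dominated by the probability of any event which contains one
of the two signatures at the threshold. -/
lemma tsum_crosses_le (hz : ∀ n : ℤ, z ≠ n) (hw : ∀ n : ℤ, w ≠ n)
    (hzw : -(1 / 2 : ℝ) < (z + w).re) {c : ℕ}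
    (hN : decayConst z c + 1 + 2 * ‖w‖ ≤ (N + 1 : ℕ)) (l : Signature N)
    (D : Signature (N + 1) → Prop)
    (hD : ∀ (y : Fin (N + 1) → ℤ) (k : Fin (N + 1)) (m m' : Signature (N + 1)),
      shifted m.1 = Function.update y k (c : ℤ) →
      shifted m'.1 = Function.update y k (c - 1 : ℤ) → D m ∨ D m') :
    ∑' m : {m : Signature (N + 1) // Interlaces l m},
        (if Crosses c l m then ENNReal.ofReal (P z w m.1) else 0) ≤
      (∑' e : ℕ, ENNReal.ofReal (decayConst z c * (decayConst z c + 1) /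
        ((e + decayConst z c) * (e + decayConst z c + 1)))) *
      ∑' m : {m : Signature (N + 1) // Interlaces l m},
        if D m then ENNReal.ofReal (P z w m.1) else 0 := by
  set h : ℕ → ℝ := fun e => decayConst z c * (decayConst z c + 1) /
        ((e + decayConst z c) * (e + decayConst z c + 1)) with hh
  have hpos : ∀ e, 0 ≤ h e := fun e => by
    have := one_le_decayConst z c
    simp only [hh]; positivity
  by_cases hex : ∃ m : {m : Signature (N + 1) // Interlaces l m}, Crosses c l m
  swap
  · have : ∀ m : {m : Signature (N + 1) // Interlaces l m},
        (if Crosses c l m then ENNReal.ofReal (P z w m.1) else 0) = 0 := fun m =>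
      if_neg fun hm => hex ⟨m, hm⟩
    simp only [this, tsum_zero]
    exact zero_le
  obtain ⟨m₀, k, hk1, hk2⟩ := hex
  have huniq : ∀ m : {m : Signature (N + 1) // Interlaces l m}, Crosses c l m →
      (c : ℤ) ≤ shifted m.1.1 k.castSucc := by
    rintro m ⟨k', h1, h2⟩
    have e1 : k' ≤ k := crosses_row_unique m.2 hk1 h2
    have e2 : k ≤ k' := crosses_row_unique m₀.2 h1 hk2
    rwa [le_antisymm e2 e1]
  -- Each crossing signature is collapsed to one satisfying `D` by moving its crossing row back to
  -- `c` or `c - 1`.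
  have hchoose : ∀ m : {m : {m : Signature (N + 1) // Interlaces l m} // Crosses c l m},
      ∃ d : {m : {m : Signature (N + 1) // Interlaces l m} // D m},
        P z w m.1.1 ≤ h (shifted m.1.1.1 k.castSucc - c).toNat * P z w d.1.1 ∧
        ∀ i, i ≠ k.castSucc → shifted d.1.1.1 i = shifted m.1.1.1 i := by
    rintro ⟨⟨m, hm⟩, hcr⟩
    have hcm : (c : ℤ) ≤ shifted m.1 k.castSucc := huniq ⟨m, hm⟩ hcr
    set y := shifted m.1 with hy
    set e := (y k.castSucc - c).toNat with he
    have hye : y k.castSucc = ((c + e : ℕ) : ℤ) := by push_cast; omega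
    have hupd : ∀ v : ℤ, c - 1 ≤ v → v ≤ y k.castSucc → ∃ m' : Signature (N + 1),
        Interlaces l m' ∧ shifted m'.1 = Function.update y k.castSucc v := fun v h1 h2 =>
      exists_update_signature hm k (by omega) h2
    have hanti : ∀ v : ℤ, c - 1 ≤ v → v ≤ y k.castSucc →
        StrictAnti (Function.update y k.castSucc v) := fun v h1 h2 => by
      obtain ⟨m', -, h3⟩ := hupd v h1 h2
      rw [← h3]
      exact shifted_strictAnti m'.2
    have hrest : ∀ j, k.castSucc < j → y j ≤ c - 1 - ((j : ℤ) - (k.castSucc : ℕ)) := by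
      intro j hj
      have h1 := val_le_of_strictAnti (hanti (c - 1) le_rfl (by omega)) j hj.le
      rwa [Function.update_self, Function.update_of_ne hj.ne'] at h1
    obtain ⟨mc, hmc1, hmc2⟩ := hupd c (by omega) hcm
    obtain ⟨md, hmd1, hmd2⟩ := hupd (c - 1) le_rfl (by omega)
    have hS := inv_pos.2 (S_pos hz hw hzw (N + 1))
    have hdecay : P z w m ≤ h e * P z w mc := by
      have := weightAt_decay hz hw hN e (y := y) (k := k.castSucc)
        (fun i hi => hanti _ (by push_cast; omega) (by rw [hye]; push_cast; omega)) hrest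
      rw [← hye, Function.update_eq_self] at this
      rw [P_eq, P_eq, pathWeight_eq_weightAt, pathWeight_eq_weightAt, hmc2, mul_left_comm]
      exact mul_le_mul_of_nonneg_left this hS.le
    have hthr : P z w mc ≤ P z w md := by
      have := weightAt_threshold_le hz hw hN (hanti _ le_rfl (by omega))
        (hanti _ (by omega) hcm) hrest
      rw [P_eq, P_eq, pathWeight_eq_weightAt, pathWeight_eq_weightAt, hmc2, hmd2]
      exact mul_le_mul_of_nonneg_left this hS.le
    rcases hD y k.castSucc mc md hmc2 hmd2 with hd | hd
    · refine ⟨⟨⟨mc, hmc1⟩, hd⟩, hdecay, fun i hi => ?_⟩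
      simp only [hmc2]
      rw [Function.update_of_ne hi]
    · refine ⟨⟨⟨md, hmd1⟩, hd⟩, hdecay.trans ?_, fun i hi => ?_⟩
      · exact mul_le_mul_of_nonneg_left hthr (hpos _)
      · simp only [hmd2]
        rw [Function.update_of_ne hi]
  choose d hd1 hd2 using hchoose
  have hsub : ∀ {α : Type} (p : α → Prop) (F : α → ENNReal),
      (∑' a, if p a then F a else 0) = ∑' a : {a // p a}, F a := fun p F =>
    (tsum_congr fun a => by simp [Set.indicator_apply]).trans (tsum_subtype {a | p a} F).symm
  rw [hsub (fun m : {m : Signature (N + 1) // Interlaces l m} => Crosses c l m)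
    (fun m => ENNReal.ofReal (P z w m.1)),
    hsub (fun m : {m : Signature (N + 1) // Interlaces l m} => D m)
    (fun m => ENNReal.ofReal (P z w m.1)), ← ENNReal.tsum_mul_right]
  simp only [← ENNReal.tsum_mul_left]
  rw [← ENNReal.tsum_prod (f := fun (e : ℕ)
    (m : {m : {m : Signature (N + 1) // Interlaces l m} // D m}) =>
    ENNReal.ofReal (h e) * ENNReal.ofReal (P z w m.1.1))]
  -- The overshoot beyond `c` and the collapsed signature together recover `m`, so the sum over
  -- crossings is bounded by a product of two sums.
  set ι : {m : {m : Signature (N + 1) // Interlaces l m} // Crosses c l m} →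
      ℕ × {m : {m : Signature (N + 1) // Interlaces l m} // D m} := fun m =>
    ((shifted m.1.1.1 k.castSucc - c).toNat, d m) with hι
  have hinj : Function.Injective ι := by
    intro m m' hmm
    rw [hι, Prod.ext_iff] at hmm
    obtain ⟨e1, e2⟩ := hmm
    dsimp only at e1 e2
    have c1 := huniq m.1 m.2
    have c2 := huniq m'.1 m'.2
    refine Subtype.ext (Subtype.ext (Subtype.ext (shifted_injective (funext fun i => ?_))))
    rcases eq_or_ne i k.castSucc with rfl | hi
    · omega
    · rw [← hd2 m i hi, ← hd2 m' i hi, e2]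
  refine le_trans (ENNReal.tsum_le_tsum fun m => ?_)
    (ENNReal.tsum_comp_le_tsum_of_injective hinj _)
  simp only [hι]
  rw [← ENNReal.ofReal_mul (hpos _)]
  exact ENNReal.ofReal_le_ofReal (hd1 m)

/-- On paths which exhaust the quadrant, every diagonal is crossed infinitely often. -/
lemma exists_crosses_of_mem_Gpos {t : Path} (ht : t ∈ Gpos) (c : ℕ) (M : ℕ) :
    ∃ n, M ≤ n ∧ Crosses c (t.1 n) (t.1 (n + 1)) := by
  set b : ℕ → ℤ := fun k => (t.1 (k + 1)).1 (Fin.last k) with hb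
  have hanti : ∀ k, b k ≤ b 0 := by
    intro k
    induction k with
    | zero => exact le_rfl
    | succ k ih =>
      have := (t.2 (k + 1) (Fin.last k)).2
      rw [Fin.succ_last] at this
      exact this.trans ih
  -- Row `k` enters at level `k + 1` with length at most `b 0 ≤ k`, hence with negative shifted
  -- coordinate. It must reach `c` later, and therefore crosses at a level beyond `M`.
  set k := max M (b 0).toNat with hk
  have hbox : (k, c + k + 1) ∈ ⋃ N : ℕ, posDiagram (t.1 N) := by
    have : (⋃ N : ℕ, posDiagram (t.1 N)) = Set.univ := ht
    rw [this]; trivial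
  rw [Set.mem_iUnion] at hbox
  have hex : ∃ n, ∃ h : k < n, (c : ℤ) ≤ shifted (t.1 n).1 ⟨k, h⟩ := by
    obtain ⟨n, h, hn⟩ := hbox
    refine ⟨n, h, ?_⟩
    simp only [shifted]
    push_cast at hn ⊢
    omega
  classical
  obtain ⟨h1, h2⟩ := Nat.find_spec hex
  obtain ⟨n, hn⟩ : ∃ n, Nat.find hex = n + 1 := ⟨Nat.find hex - 1, by omega⟩
  have hmin := Nat.find_min hex (m := n) (by omega)
  have hspec := Nat.find_spec hex
  rw [hn] at hspec
  obtain ⟨h1, h2⟩ := hspec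
  have hkn : k < n := by
    rcases Nat.lt_succ_iff_lt_or_eq.1 h1 with h | h
    · exact h
    · exfalso
      clear_value k
      subst h
      have h3 := hanti k
      have h4 : shifted (t.1 (k + 1)).1 ⟨k, h1⟩ = b k - (k + 1) := by
        simp only [shifted, hb]
        push_cast
        rfl
      rw [h4] at h2
      omega
  refine ⟨n, by omega, ⟨k, hkn⟩, ?_, h2⟩
  by_contra hcon
  exact hmin ⟨hkn, not_lt.1 hcon⟩

end Crossing

/-! ### The ratio along paths in `Gpos`. -/

section Ratio

variable {z w z' w' : ℂ} {N : ℕ}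

lemma ratio_pos (hz : ∀ n : ℤ, z ≠ n) (hw : ∀ n : ℤ, w ≠ n)
    (hz' : ∀ n : ℤ, z' ≠ n) (hw' : ∀ n : ℤ, w' ≠ n)
    (hzw : -(1 / 2 : ℝ) < (z + w).re) (hzw' : -(1 / 2 : ℝ) < (z' + w').re)
    (l : Signature N) : 0 < P z w l / P z' w' l :=
  div_pos (P_pos hz hw hzw l) (P_pos hz' hw' hzw' l)

/-- The change of the ratio when one particle moves over the threshold. -/
noncomputable def ratioStep (z w z' w' : ℂ) (N c : ℕ) : ℝ :=
  ‖z - c‖ ^ 2 / ‖z' - c‖ ^ 2 * (‖w' + N + c‖ ^ 2 / ‖w + N + c‖ ^ 2)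

/-- Dimensions cancel in the ratio and the other particles do not move, so the change depends only
on the level and on `c`. -/
lemma ratio_update (hz : ∀ n : ℤ, z ≠ n) (hw : ∀ n : ℤ, w ≠ n)
    (hz' : ∀ n : ℤ, z' ≠ n) (hw' : ∀ n : ℤ, w' ≠ n)
    {y : Fin N → ℤ} {k : Fin N} {c : ℕ} {m m' : Signature N}
    (hm : shifted m.1 = Function.update y k (c : ℤ))
    (hm' : shifted m'.1 = Function.update y k (c - 1 : ℤ)) :
    P z w m / P z' w' m = P z w m' / P z' w' m' * ratioStep z w z' w' N c := by
  have key : ∀ {z w : ℂ}, (∀ n : ℤ, z ≠ n) → (∀ n : ℤ, w ≠ n) → 0 < ‖z - c‖ ^ 2 ∧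
      0 < ‖w + N + c‖ ^ 2 ∧
      gammaFun z w m.1 = gammaFun z w m'.1 * (‖z - c‖ ^ 2 / ‖w + N + c‖ ^ 2) := by
    intro z w hz hw
    have h1 := prod_gammaFactor_update hz hw y k (c - 1 : ℤ)
    rw [sub_add_cancel, ← hm, ← hm'] at h1
    have e1 : z - ((c - 1 : ℤ) : ℂ) - 1 = z - c := by push_cast; ring
    have e2 : w + N + 1 + ((c - 1 : ℤ) : ℂ) = w + N + c := by push_cast; ring
    have p1 := norm_sub_int_pos hz (c - 1 : ℤ)
    have p2 := norm_add_int_pos hw N (c - 1 : ℤ)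
    rw [e1] at p1
    rw [e2] at p2
    rw [e1, e2] at h1
    have p2' : 0 < ‖w + N + c‖ ^ 2 := by positivity
    refine ⟨by positivity, p2', ?_⟩
    rw [← mul_div_assoc, eq_div_iff p2'.ne']
    exact h1
  obtain ⟨q1, q2, q3⟩ := key hz hw
  obtain ⟨q1', q2', q3'⟩ := key hz' hw'
  have d1 := (dimFun_pos m.2).ne'
  have d2 := (dimFun_pos m'.2).ne'
  have e : ∀ {n : Signature N}, dimFun n.1 ≠ 0 → P z w n / P z' w' n =
      (S z w N)⁻¹ / (S z' w' N)⁻¹ * (gammaFun z w n.1 / gammaFun z' w' n.1) := by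
    intro n hn
    rw [P_eq, P_eq, pathWeight, pathWeight, mul_div_mul_comm, mul_div_mul_right _ _ hn]
  rw [e d1, e d2, q3, q3', ratioStep, mul_div_mul_comm, mul_assoc]
  congr 2
  field_simp

lemma tendsto_norm_add_natCast (s : ℂ) :
    Tendsto (fun n : ℕ => ‖s + n‖) atTop atTop := by
  refine tendsto_atTop_mono (fun n : ℕ => ?_)
    (tendsto_atTop_add_const_right _ (-‖s‖) tendsto_natCast_atTop_atTop)
  have := norm_sub_norm_le (n : ℂ) (-s)
  rw [norm_neg, Complex.norm_natCast] at this
  have e : (n : ℂ) - -s = s + n := by ring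
  rw [e] at this
  linarith

lemma tendsto_norm_div_norm (s s' : ℂ) :
    Tendsto (fun n : ℕ => ‖s' + n‖ ^ 2 / ‖s + n‖ ^ 2) atTop (𝓝 1) := by
  have h1 : Tendsto (fun n : ℕ => (s' - s) / (s + n)) atTop (𝓝 0) := by
    rw [tendsto_zero_iff_norm_tendsto_zero]
    simp only [norm_div]
    exact tendsto_const_nhds.div_atTop (tendsto_norm_add_natCast s)
  have h2 : Tendsto (fun n : ℕ => ‖1 + (s' - s) / (s + n)‖ ^ 2) atTop (𝓝 1) := by
    simpa using ((h1.const_add 1).norm).pow 2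
  refine h2.congr' ?_
  filter_upwards [(tendsto_norm_add_natCast s).eventually_gt_atTop 0] with n hn
  have hn' := norm_pos_iff.1 hn
  rw [← div_pow, ← norm_div]
  congr 2
  field_simp
  ring

lemma tendsto_ratioStep (z w z' w' : ℂ) (c : ℕ) :
    Tendsto (fun n => ratioStep z w z' w' n c) atTop (𝓝 (‖z - c‖ ^ 2 / ‖z' - c‖ ^ 2)) := by
  have := (tendsto_norm_div_norm (w + c) (w' + c)).const_mul (‖z - c‖ ^ 2 / ‖z' - c‖ ^ 2)
  rw [mul_one] at this
  refine this.congr fun n => ?_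
  rw [ratioStep]
  congr 4 <;> ring_nf

/-- The values at `c = 0` and `c = 1` already determine `Re z` and `|Im z|`. -/
lemma exists_threshold (h : ({z, conj z} : Set ℂ) ≠ {z', conj z'}) :
    ∃ c : ℕ, ‖z - c‖ ^ 2 ≠ ‖z' - c‖ ^ 2 := by
  by_contra! hcon
  apply h
  have h0 := hcon 0
  have h1 := hcon 1
  rw [sq_norm_eq, sq_norm_eq] at h0 h1
  simp at h0 h1
  have hre : z.re = z'.re := by linarith
  rw [hre] at h0
  have him : z.im ^ 2 = z'.im ^ 2 := by linarith
  rcases sq_eq_sq_iff_eq_or_eq_neg.1 him with him | him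
  · rw [Complex.ext hre him]
  · have e : z = conj z' := Complex.ext (by simpa using hre) (by simpa using him)
    rw [e, Complex.conj_conj, Set.pair_comm]

/-- Along almost every path which exhausts the quadrant, the ratio does not converge to a nonzero
limit. -/
theorem measure_Q_inter_Gpos (hz : ∀ n : ℤ, z ≠ n) (hw : ∀ n : ℤ, w ≠ n)
    (hz' : ∀ n : ℤ, z' ≠ n) (hw' : ∀ n : ℤ, w' ≠ n)
    (hzw : -(1 / 2 : ℝ) < (z + w).re) (hzw' : -(1 / 2 : ℝ) < (z' + w').re)
    (hne : ({z, conj z} : Set ℂ) ≠ {z', conj z'}) {ρ : Measure Path} (hρ : IsZWMeasure z w ρ) :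
    ρ (Q z w z' w' ∩ Gpos) = 0 := by
  have := hρ.isProbabilityMeasure hz hw
  obtain ⟨c, hc⟩ := exists_threshold hne
  have hpc : ∀ {s : ℂ}, (∀ n : ℤ, s ≠ n) → 0 < ‖s - c‖ ^ 2 := fun {s} hs => by
    have := norm_pos_iff.2 (sub_ne_zero.2 (hs c))
    rw [Int.cast_natCast] at this
    positivity
  set θ : ℝ := ‖z - c‖ ^ 2 / ‖z' - c‖ ^ 2 with hθ
  have hθ0 : 0 < θ := div_pos (hpc hz) (hpc hz')
  have hθ1 : θ ≠ 1 := by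
    rw [hθ, Ne, div_eq_one_iff_eq (hpc hz').ne']
    exact hc
  have hlog : Real.log θ ≠ 0 := Real.log_ne_zero_of_pos_of_ne_one hθ0 hθ1
  -- The logarithm of `ratioStep` is eventually at least `2δ` in absolute value, so two signatures
  -- differing by it cannot both be within `δ` of the present value.
  set δ : ℝ := |Real.log θ| / 4 with hδ
  have hδ0 : 0 < δ := by positivity
  let R : ∀ {n : ℕ}, Signature n → ℝ := fun l => P z w l / P z' w' l
  have hRpos : ∀ {n : ℕ} (l : Signature n), 0 < R l := fun l =>
    ratio_pos hz hw hz' hw' hzw hzw' l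
  let near : ∀ {n : ℕ}, Signature n → Signature (n + 1) → Prop := fun l m =>
    |Real.log (R m) - Real.log (R l)| < δ
  obtain ⟨N₁, hN₁⟩ : ∃ N₁ : ℕ, ∀ n ≥ N₁, 0 < ratioStep z w z' w' n c ∧
      2 * δ ≤ |Real.log (ratioStep z w z' w' n c)| ∧ decayConst z c + 1 + 2 * ‖w‖ ≤ n := by
    have h1 := tendsto_ratioStep z w z' w' c
    have h2 := ((Real.continuousAt_log hθ0.ne').tendsto.comp h1).abs
    have h3 : 2 * δ < |Real.log θ| := by
      have := abs_pos.2 hlog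
      rw [hδ]; linarith
    obtain ⟨N₁, h⟩ := eventually_atTop.1 ((h1.eventually_const_lt hθ0).and
      ((h2.eventually_const_lt h3).and (tendsto_natCast_atTop_atTop.eventually_ge_atTop
        (decayConst z c + 1 + 2 * ‖w‖))))
    exact ⟨N₁, fun n hn => ⟨(h n hn).1, (h n hn).2.1.le, (h n hn).2.2⟩⟩
  set H : ENNReal := ∑' e : ℕ, ENNReal.ofReal (decayConst z c * (decayConst z c + 1) /
        ((e + decayConst z c) * (e + decayConst z c + 1))) with hH
  have hHtop : H ≠ ⊤ := tsum_decay_ne_top (one_le_decayConst z c)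
  have main : ∀ n₀ ≥ N₁, ρ ({t | ∀ n ≥ n₀, near (t.1 n) (t.1 (n + 1))} ∩ Gpos) = 0 := by
    intro n₀ hn₀
    set A : ℕ → Set Path := fun n => {t | ∀ j < n, near (t.1 (n₀ + j)) (t.1 (n₀ + j + 1))} with hA
    have hAdet : ∀ n, IsDetermined (n₀ + n) (A n) := by
      intro n t t' h ht j hj
      rw [← h (n₀ + j) (by omega), ← h (n₀ + j + 1) (by omega)]
      exact ht j hj
    set C : ℕ → Set Path := fun n => {t | Crosses c (t.1 (n₀ + n)) (t.1 (n₀ + n + 1))} with hC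
    set D : ℕ → Set Path := fun n => {t | ¬ near (t.1 (n₀ + n)) (t.1 (n₀ + n + 1))} with hD
    have hstep : ∀ n, ρ (A n ∩ C n) ≤ H * ρ (A n ∩ D n) := by
      intro n
      classical
      refine measure_inter_step_le hρ (hAdet n) (fun l m => Crosses c l m)
        (fun l m => ¬ near l m) H fun t _ => ?_
      obtain ⟨g1, g2, g3⟩ := hN₁ (n₀ + n + 1) (by omega)
      refine tsum_crosses_le hz hw hzw g3 (t.1 (n₀ + n)) (fun m => ¬ near (t.1 (n₀ + n)) m) ?_
      intro y k m m' hm hm'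
      by_contra! hcon
      obtain ⟨n1, n2⟩ := hcon
      have e1 : Real.log (R m) = Real.log (R m') +
          Real.log (ratioStep z w z' w' (n₀ + n + 1) c) := by
        rw [← Real.log_mul (hRpos m').ne' g1.ne']
        congr 1
        exact ratio_update hz hw hz' hw' hm hm'
      have n1' : |Real.log (R m) - Real.log (R (t.1 (n₀ + n)))| < δ := n1
      have n2' : |Real.log (R m') - Real.log (R (t.1 (n₀ + n)))| < δ := n2
      have e2 : Real.log (ratioStep z w z' w' (n₀ + n + 1) c) =
          (Real.log (R m) - Real.log (R (t.1 (n₀ + n)))) -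
          (Real.log (R m') - Real.log (R (t.1 (n₀ + n)))) := by rw [e1]; ring
      rw [e2] at g2
      have := abs_sub (Real.log (R m) - Real.log (R (t.1 (n₀ + n))))
        (Real.log (R m') - Real.log (R (t.1 (n₀ + n))))
      linarith
    -- `A n ∩ D n` says that the first jump after `n₀` occurs at step `n`; these events are
    -- disjoint.
    have hsum : ∑' n, ρ (A n ∩ D n) ≤ 1 := by
      rw [← measure_iUnion]
      · exact prob_le_one
      · have hlt : ∀ n n', n < n' → Disjoint (A n ∩ D n) (A n' ∩ D n') := by
          intro n n' h
          refine Set.disjoint_left.2 ?_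
          rintro t ⟨-, h1⟩ ⟨h2, -⟩
          exact h1 (h2 n h)
        intro n n' hnn
        rcases lt_or_gt_of_ne hnn with h | h
        · exact hlt n n' h
        · exact (hlt n' n h).symm
      · exact fun n => (((hAdet n).mono (Nat.le_succ _)).inter (isDetermined_step (n₀ + n)
          fun l m => ¬ near l m)).measurableSet
    have hfin : ∑' n, ρ (A n ∩ C n) ≠ ⊤ := by
      refine ne_top_of_le_ne_top (ENNReal.mul_ne_top hHtop ENNReal.one_ne_top) ?_
      calc ∑' n, ρ (A n ∩ C n) ≤ ∑' n, H * ρ (A n ∩ D n) := ENNReal.tsum_le_tsum hstep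
        _ = H * ∑' n, ρ (A n ∩ D n) := ENNReal.tsum_mul_left
        _ ≤ H * 1 := by gcongr
    refine measure_mono_null ?_ (measure_limsup_atTop_eq_zero hfin)
    rintro t ⟨h1, h2⟩
    rw [mem_limsup_iff_frequently_mem, frequently_atTop]
    intro M
    obtain ⟨n, hn, hcr⟩ := exists_crosses_of_mem_Gpos h2 c (n₀ + M)
    obtain ⟨j, rfl⟩ : ∃ j, n = n₀ + j := ⟨n - n₀, by omega⟩
    exact ⟨j, by omega, fun i _ => h1 _ (by omega), hcr⟩
  refine measure_mono_null (t := ⋃ n₀ : ℕ, {t : Path | ∀ n ≥ N₁ + n₀,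
    near (t.1 n) (t.1 (n + 1))} ∩ Gpos) ?_ (measure_iUnion_null fun n₀ => main _ (by omega))
  rintro t ⟨⟨a, ha0, ha⟩, ht⟩
  -- A positive limit makes the logarithms converge, so their increments are eventually below `δ`.
  have ha' : 0 < a := lt_of_le_of_ne (ge_of_tendsto' ha fun n => (hRpos (t.1 n)).le) ha0.symm
  have h1 := (Real.continuousAt_log ha'.ne').tendsto.comp ha
  have h2 := ((h1.comp (tendsto_add_atTop_nat 1)).sub h1).abs
  rw [sub_self, abs_zero] at h2
  obtain ⟨n₁, hn₁⟩ := eventually_atTop.1 (h2.eventually_lt_const hδ0)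
  rw [Set.mem_iUnion]
  exact ⟨n₁, fun n hn => hn₁ n (by omega), ht⟩

end Ratio

/-! ### Almost every path lies in `Gpos` or `Gneg`. -/

section Exit

variable {z w : ℂ} {N : ℕ}

/-- Lower bound for the effect of moving one particle to the right. -/
lemma le_weightAt_update (hz : ∀ n : ℤ, z ≠ n) (hw : ∀ n : ℤ, w ≠ n) {y : Fin N → ℤ} {k : Fin N}
    {s : ℤ} {p : ℕ} (hs : 0 ≤ s) (hpN : (k : ℕ) + p < N) (h1 : StrictAnti y)
    (hlt : ∀ i, i < k → y k + 2 ≤ y i)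
    (hgt : ∀ j : Fin N, k < j → (j : ℕ) + p < N → y k - y j ≤ s + ((j : ℤ) - k)) :
    weightAt z w y * (‖z - y k - 1‖ ^ 2 * ((1 / 2) ^ (k : ℕ) * (s + (N - p - (k : ℕ))))) ≤
      weightAt z w (Function.update y k (y k + 1)) * (‖w + N + 1 + y k‖ ^ 2 * (s + 1)) := by
  have hs' : (0 : ℝ) ≤ s := by exact_mod_cast hs
  have hkp : ((k : ℕ) : ℝ) + p + 1 ≤ N := by exact_mod_cast hpN
  -- Outside the last `p` rows the gap is at most `h j`, so the factor grows by at least `h (j + 1)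
  -- / h j`. The truncation makes this quotient `1` on the last `p` rows, where nothing is known. A
  -- row above `k` costs at most a factor `1/2`, since its gap is at least `2`.
  set h : ℕ → ℝ := fun j => if (k : ℕ) < j then s + ((min j (N - p) : ℕ) - (k : ℕ)) else 1 with hh
  have hpos : ∀ j, 0 < h j := by
    intro j
    simp only [hh]
    split_ifs with hj
    · have h3 : (k : ℕ) + 1 ≤ min j (N - p) := by omega
      have : ((k : ℕ) : ℝ) + 1 ≤ (min j (N - p) : ℕ) := by exact_mod_cast h3
      linarith
    · exact one_pos
  have hfac : ∀ i j : Fin N, i < j → 0 < ((y i : ℝ) - y j) / ((j : ℝ) - (i : ℝ)) := by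
    intro i j hij
    have h3 : (i : ℝ) < j := by exact_mod_cast hij
    have h4 : ((y j : ℤ) : ℝ) < y i := by exact_mod_cast h1 hij
    apply div_pos <;> linarith
  have hhalf : ∏ i : Fin N, ∏ j ∈ Finset.Ioi i, (if j = k then (1 / 2 : ℝ) else 1) =
      (1 / 2) ^ (k : ℕ) := by
    have : ∀ i : Fin N, ∏ j ∈ Finset.Ioi i, (if j = k then (1 / 2 : ℝ) else 1) =
        if i < k then (1 / 2 : ℝ) else 1 := fun i => by
      rw [Finset.prod_ite_eq']
      simp only [Finset.mem_Ioi]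
    simp only [this]
    rw [Finset.prod_ite, Finset.prod_const, Finset.prod_const_one, mul_one]
    congr 1
    rw [← Fin.card_Iio k]
    congr 1
    ext i; simp
  have hdim : (∏ i : Fin N, ∏ j ∈ Finset.Ioi i, ((y i : ℝ) - y j) / ((j : ℝ) - (i : ℝ))) *
      (h N / h (k + 1)) * (1 / 2) ^ (k : ℕ) ≤
      ∏ i : Fin N, ∏ j ∈ Finset.Ioi i, ((Function.update y k (y k + 1) i : ℝ) -
        Function.update y k (y k + 1) j) / ((j : ℝ) - (i : ℝ)) := by
    rw [← prod_Ioi_telescope N k h fun j => (hpos j).ne', ← prod_Ioi_eq_single (k := k)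
      (fun j : Fin N => h ((j : ℕ) + 1) / h j), ← hhalf, ← Finset.prod_mul_distrib,
      ← Finset.prod_mul_distrib]
    have hterm : ∀ i j : Fin N, i < j → 0 ≤ ((y i : ℝ) - y j) / ((j : ℝ) - (i : ℝ)) *
        (if i = k then h ((j : ℕ) + 1) / h j else 1) * (if j = k then (1 / 2 : ℝ) else 1) := by
      intro i j hij
      have := (hfac i j hij).le
      have h5 := (div_pos (hpos ((j : ℕ) + 1)) (hpos j)).le
      refine mul_nonneg (mul_nonneg this ?_) ?_ <;> split_ifs <;> first | exact h5 | norm_num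
    have hrw : ∀ i : Fin N, (∏ j ∈ Finset.Ioi i, ((y i : ℝ) - y j) / ((j : ℝ) - (i : ℝ))) *
        (∏ j ∈ Finset.Ioi i, (if i = k then h ((j : ℕ) + 1) / h j else 1)) *
        (∏ j ∈ Finset.Ioi i, (if j = k then (1 / 2 : ℝ) else 1)) =
        ∏ j ∈ Finset.Ioi i, ((y i : ℝ) - y j) / ((j : ℝ) - (i : ℝ)) *
        (if i = k then h ((j : ℕ) + 1) / h j else 1) * (if j = k then (1 / 2 : ℝ) else 1) := by
      intro i
      rw [← Finset.prod_mul_distrib, ← Finset.prod_mul_distrib]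
    refine Finset.prod_le_prod (fun i _ => ?_) fun i _ => ?_
    · rw [hrw]
      exact Finset.prod_nonneg fun j hj => hterm i j (Finset.mem_Ioi.1 hj)
    rw [hrw]
    refine Finset.prod_le_prod (fun j hj => hterm i j (Finset.mem_Ioi.1 hj)) fun j hj => ?_
    have hij : i < j := Finset.mem_Ioi.1 hj
    have h3 : (i : ℝ) < j := by exact_mod_cast hij
    have hD : 0 < (j : ℝ) - (i : ℝ) := by linarith
    rw [div_mul_eq_mul_div, div_mul_eq_mul_div]
    refine div_le_div_of_nonneg_right ?_ hD.le
    by_cases hik : i = k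
    · subst hik
      rw [if_pos rfl, if_neg hij.ne', mul_one, Function.update_self,
        Function.update_of_ne hij.ne', ← mul_div_assoc, div_le_iff₀ (hpos _)]
      have hij' : (i : ℕ) < j := hij
      have hyij : ((y j : ℤ) : ℝ) < y i := by exact_mod_cast h1 hij
      push_cast
      rcases lt_or_ge ((j : ℕ) + p) N with hjp | hjp
      · have e2 : h j = s + ((j : ℕ) - (i : ℕ)) := by
          simp only [hh]
          rw [if_pos hij', min_eq_left (by omega)]
        have e1 : h ((j : ℕ) + 1) = h j + 1 := by
          rw [e2]
          simp only [hh]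
          rw [if_pos (by omega), min_eq_left (by omega)]
          push_cast; ring
        have e3 : (y i : ℝ) - y j ≤ s + (((j : ℕ) : ℝ) - (i : ℕ)) := by
          exact_mod_cast hgt j hij hjp
        rw [e1, e2]
        nlinarith
      · have e1 : h ((j : ℕ) + 1) = h j := by
          simp only [hh]
          rw [if_pos (by omega), if_pos hij', min_eq_right (by omega), min_eq_right (by omega)]
        rw [e1]
        nlinarith [hpos j]
    · rw [if_neg hik, mul_one, Function.update_of_ne hik]
      by_cases hjk : j = k
      · subst hjk
        rw [if_pos rfl, Function.update_self]
        have : ((y j : ℤ) : ℝ) + 2 ≤ y i := by exact_mod_cast hlt i hij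
        push_cast
        linarith
      · rw [if_neg hjk, mul_one, Function.update_of_ne hjk]
  have e1 : h (k + 1) = s + 1 := by
    simp only [hh]
    rw [if_pos (Nat.lt_succ_self _), min_eq_left (by omega)]
    push_cast; ring
  have e2 : h N = s + (N - p - (k : ℕ)) := by
    simp only [hh]
    rw [if_pos k.2, min_eq_right (by omega), Nat.cast_sub (by omega)]
  have hp : 0 < (s : ℝ) + 1 := by linarith
  rw [e1, e2, mul_div_assoc', div_mul_eq_mul_div, div_le_iff₀ hp] at hdim
  have hg := prod_gammaFactor_update hz hw y k (y k)
  rw [Function.update_eq_self] at hg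
  have hg0 : 0 ≤ (∏ i, gammaFactor z w N (y i)) * ‖z - y k - 1‖ ^ 2 :=
    mul_nonneg (Finset.prod_nonneg fun _ _ => (gammaFactor_pos hz hw _ _).le) (sq_nonneg _)
  have := mul_le_mul_of_nonneg_left hdim hg0
  unfold weightAt
  refine (le_of_eq ?_).trans (this.trans (le_of_eq ?_))
  · ring
  · rw [← hg]; ring

/-- The rows `0, …, k - 1` are separated from the row `k`, of length `a`, and all rows but the
last `p` ones are at least `-b`. -/
def Stays (k p : ℕ) (a b : ℤ) {n : ℕ} (l : Signature n) : Prop :=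
  ∃ hk : k < n, l.1 ⟨k, hk⟩ = a ∧ (∀ i : Fin n, (i : ℕ) < k → a + 2 ≤ l.1 i) ∧
    ∀ i : Fin n, (i : ℕ) + p < n → -b ≤ l.1 i

/-- The negation of `Stays`. -/
def Exits (k p : ℕ) (a b : ℤ) {n : ℕ} (l : Signature n) : Prop := ¬ Stays k p a b l

/-- The constant in the lower bound for the exit probability. -/
noncomputable def exitConst (z : ℂ) (k : ℕ) (a b : ℤ) : ℝ :=
  ‖z - (a - (k + 1) : ℤ) - 1‖ ^ 2 * (1 / 2) ^ k / (8 * ((a + b : ℤ) + 1))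

lemma exitConst_pos (hz : ∀ n : ℤ, z ≠ n) (k : ℕ) {a b : ℤ} (hab : 0 ≤ a + b) :
    0 < exitConst z k a b := by
  have h1 := norm_sub_int_pos hz (a - (k + 1))
  have h2 : (0 : ℝ) ≤ (a + b : ℤ) := by exact_mod_cast hab
  unfold exitConst
  positivity

/-- The competitor lengthens row `k` by one box; the separation of the rows above leaves room for
it. The dimension gains order `N` and the gamma factors lose order `N²`, so the relative weight is
at least of order `1/N`. The `8` in `exitConst` combines `N - p - k ≥ N/2` with `‖w + N + …‖ ≤ 2N`,
at level `N + 1`. -/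
lemma exists_exit (hz : ∀ n : ℤ, z ≠ n) (hw : ∀ n : ℤ, w ≠ n)
    (hzw : -(1 / 2 : ℝ) < (z + w).re) {k p : ℕ} {a b : ℤ} (hab : 0 ≤ a + b)
    (hN1 : 2 * (p + k) ≤ N) (hN2 : ‖w + 1 + (a - (k + 1) : ℤ)‖ ≤ N)
    {l : Signature N} {m : Signature (N + 1)} (h : Interlaces l m) (hl : Stays k p a b l)
    (hm : Stays k p a b m) :
    ∃ m' : Signature (N + 1), Interlaces l m' ∧ Exits k p a b m' ∧
      (∀ i : Fin (N + 1), (i : ℕ) ≠ k → m'.1 i = m.1 i) ∧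
      exitConst z k a b / (N + 1 : ℕ) * P z w m ≤ P z w m' := by
  obtain ⟨hk, hl1, hl2, hl3⟩ := hl
  obtain ⟨hk', hm1, hm2, hm3⟩ := hm
  set κ : Fin (N + 1) := ⟨k, hk'⟩ with hκ
  let v : Fin (N + 1) → ℤ := Function.update m.1 κ (a + 1)
  have hint : ∀ i : Fin N, l.1 i ≤ v i.castSucc ∧ v i.succ ≤ l.1 i := by
    intro i
    refine ⟨?_, ?_⟩
    · rcases eq_or_ne i.castSucc κ with hik | hik
      · have hval : (i.castSucc : ℕ) = κ := congrArg Fin.val hik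
        have : i = ⟨k, hk⟩ := Fin.ext hval
        rw [this, hl1]
        simp only [v]
        rw [← this, hik, Function.update_self]
        omega
      · simp only [v]
        rw [Function.update_of_ne hik]
        exact (h i).1
    · rcases eq_or_ne i.succ κ with hik | hik
      · simp only [v]
        rw [hik, Function.update_self]
        have : (i : ℕ) + 1 = k := congrArg Fin.val hik
        have := hl2 i (by omega)
        omega
      · simp only [v]
        rw [Function.update_of_ne hik]
        exact (h i).2
  have hmv : ∃ m' : Signature (N + 1), m'.1 = v := ⟨⟨v, antitone_of_interlaces hint⟩, rfl⟩
  obtain ⟨m', hm'⟩ := hmv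
  refine ⟨m', by rw [← hm'] at hint; exact hint, ?_, ?_, ?_⟩
  · rintro ⟨_, h1, -⟩
    rw [hm'] at h1
    simp only [v] at h1
    rw [show (⟨k, hk'⟩ : Fin (N + 1)) = κ from rfl, Function.update_self] at h1
    omega
  · intro i hi
    rw [hm']
    exact Function.update_of_ne (fun hh => hi (congrArg Fin.val hh)) _ _
  · set y := shifted m.1 with hy
    have hyk : y κ = a - (k + 1) := by
      show m.1 κ - ((k + 1 : ℕ) : ℤ) = _
      rw [show m.1 κ = a from hm1]
      push_cast; ring
    have hκv : ((κ : Fin (N + 1)) : ℕ) = k := rfl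
    have hv : shifted v = Function.update y κ (y κ + 1) := by
      funext i
      rcases eq_or_ne i κ with rfl | hi
      · rw [Function.update_self, hyk]
        simp only [shifted, v, Function.update_self]
        rw [hκv]
        push_cast; ring
      · rw [Function.update_of_ne hi]
        simp only [shifted, v, Function.update_of_ne hi, hy]
    have hle := le_weightAt_update hz hw (y := y) (k := κ) (s := a + b) (p := p) hab
      (by simp only [hκ]; omega) (shifted_strictAnti m.2) (fun i hi => by
        have h1 := hm2 i hi
        have h2 : (i : ℕ) < k := hi
        rw [hyk]
        simp only [hy, shifted]
        push_cast
        omega) (fun j hj hjp => by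
        have h1 := hm3 j hjp
        rw [hyk, hκv]
        simp only [hy, shifted]
        push_cast
        omega)
    rw [← hv, hyk] at hle
    rw [P_eq m, P_eq m', pathWeight_eq_weightAt, pathWeight_eq_weightAt, hm', mul_left_comm]
    refine mul_le_mul_of_nonneg_left ?_ (inv_pos.2 (S_pos hz hw hzw _)).le
    have hW := (weightAt_pos hz hw (shifted_strictAnti m.2)).le
    have hW' := (weightAt_pos (N := N + 1) hz hw
      (shifted_strictAnti (antitone_of_interlaces hint))).le
    have hs' : (0 : ℝ) ≤ ((a + b : ℤ) : ℝ) := by exact_mod_cast hab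
    have hz0 : 0 ≤ ‖z - (a - (k + 1) : ℤ) - 1‖ ^ 2 := sq_nonneg _
    have n1 : ‖w + (N + 1 : ℕ) + 1 + (a - (k + 1) : ℤ)‖ ≤ 2 * (N + 1 : ℕ) := by
      have e : w + (N + 1 : ℕ) + 1 + (a - (k + 1) : ℤ) =
          (w + 1 + (a - (k + 1) : ℤ)) + (N + 1 : ℕ) := by ring
      rw [e]
      refine (norm_add_le _ _).trans ?_
      rw [Complex.norm_natCast]
      push_cast at hN2 ⊢
      linarith
    have n2 : ((N + 1 : ℕ) : ℝ) / 2 ≤ (a + b : ℤ) + ((N + 1 : ℕ) - p - (k : ℕ)) := by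
      have : 2 * ((p : ℝ) + k) ≤ N := by exact_mod_cast hN1
      push_cast at hs' ⊢
      linarith
    have hM : (0 : ℝ) < (N + 1 : ℕ) := by positivity
    have hchain : weightAt z w y * (‖z - (a - (k + 1) : ℤ) - 1‖ ^ 2 *
        ((1 / 2) ^ k * (((N + 1 : ℕ) : ℝ) / 2))) ≤
        weightAt z w (shifted v) * ((2 * (N + 1 : ℕ)) ^ 2 * ((a + b : ℤ) + 1)) := by
      refine le_trans ?_ (hle.trans ?_)
      · refine mul_le_mul_of_nonneg_left ?_ hW
        refine mul_le_mul_of_nonneg_left ?_ hz0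
        exact mul_le_mul_of_nonneg_left n2 (by positivity)
      · refine mul_le_mul_of_nonneg_left ?_ hW'
        refine mul_le_mul_of_nonneg_right ?_ (by linarith)
        exact pow_le_pow_left₀ (norm_nonneg _) n1 2
    have hden : (0 : ℝ) < (2 * (N + 1 : ℕ)) ^ 2 * ((a + b : ℤ) + 1) := by positivity
    refine le_of_mul_le_mul_right (le_trans (le_of_eq ?_) hchain) hden
    unfold exitConst
    field_simp
    ring

-- The competitor determines the original signature, because row `k` of the latter is known to be
-- `a`; hence the comparison can be summed.
open Classical in
lemma tsum_stays_le (hz : ∀ n : ℤ, z ≠ n) (hw : ∀ n : ℤ, w ≠ n)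
    (hzw : -(1 / 2 : ℝ) < (z + w).re) {k p : ℕ} {a b : ℤ} (hab : 0 ≤ a + b)
    (hN1 : 2 * (p + k) ≤ N) (hN2 : ‖w + 1 + (a - (k + 1) : ℤ)‖ ≤ N)
    {l : Signature N} (hl : Stays k p a b l) :
    ∑' m : {m : Signature (N + 1) // Interlaces l m},
        (if Stays k p a b m.1 then ENNReal.ofReal (P z w m.1) else 0) ≤
      ENNReal.ofReal (exitConst z k a b / (N + 1 : ℕ))⁻¹ *
      ∑' m : {m : Signature (N + 1) // Interlaces l m},
        if Exits k p a b m.1 then ENNReal.ofReal (P z w m.1) else 0 := by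
  have hq : 0 < exitConst z k a b / (N + 1 : ℕ) :=
    div_pos (exitConst_pos hz k hab) (by positivity)
  set q := exitConst z k a b / (N + 1 : ℕ) with hq'
  have hchoose : ∀ m : {m : {m : Signature (N + 1) // Interlaces l m} // Stays k p a b m.1},
      ∃ d : {m : {m : Signature (N + 1) // Interlaces l m} // Exits k p a b m.1},
        P z w m.1.1 ≤ q⁻¹ * P z w d.1.1 ∧
        ∀ i : Fin (N + 1), (i : ℕ) ≠ k → d.1.1.1 i = m.1.1.1 i := by
    rintro ⟨⟨m, hm⟩, hst⟩
    obtain ⟨m', g1, g2, g3, g4⟩ := exists_exit hz hw hzw hab hN1 hN2 hm hl hst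
    refine ⟨⟨⟨m', g1⟩, g2⟩, ?_, g3⟩
    rw [inv_mul_eq_div, le_div_iff₀ hq, mul_comm]
    exact g4
  choose d hd1 hd2 using hchoose
  have hsub : ∀ {α : Type} (p : α → Prop) (F : α → ENNReal),
      (∑' a, if p a then F a else 0) = ∑' a : {a // p a}, F a := fun p F =>
    (tsum_congr fun a => by simp [Set.indicator_apply]).trans (tsum_subtype {a | p a} F).symm
  rw [hsub (fun m : {m : Signature (N + 1) // Interlaces l m} => Stays k p a b m.1)
    (fun m => ENNReal.ofReal (P z w m.1)),
    hsub (fun m : {m : Signature (N + 1) // Interlaces l m} => Exits k p a b m.1)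
    (fun m => ENNReal.ofReal (P z w m.1)), ← ENNReal.tsum_mul_left]
  have hinj : Function.Injective d := by
    intro m m' hmm
    refine Subtype.ext (Subtype.ext (Subtype.ext (funext fun i => ?_)))
    by_cases hi : (i : ℕ) = k
    · obtain ⟨h1, h2, -⟩ := m.2
      obtain ⟨h1', h2', -⟩ := m'.2
      have : i = ⟨k, h1⟩ := Fin.ext hi
      rw [this, h2, h2']
    · rw [← hd2 m i hi, ← hd2 m' i hi, hmm]
  refine le_trans (ENNReal.tsum_le_tsum fun m => ?_)
    (ENNReal.tsum_comp_le_tsum_of_injective hinj _)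
  rw [← ENNReal.ofReal_mul (inv_pos.2 hq).le]
  exact ENNReal.ofReal_le_ofReal (hd1 m)

/-- At each level the first-exit event has mass at least a constant over the level times the mass of
never exiting. First exits are disjoint, so divergence of the harmonic series makes the latter mass
zero. -/
lemma measure_stays_eq_zero (hz : ∀ n : ℤ, z ≠ n) (hw : ∀ n : ℤ, w ≠ n)
    (hzw : -(1 / 2 : ℝ) < (z + w).re) {ρ : Measure Path} (hρ : IsZWMeasure z w ρ)
    {k p : ℕ} {a b : ℤ} (hab : 0 ≤ a + b) {n₀ : ℕ}
    (hN1 : 2 * (p + k) ≤ n₀) (hN2 : ‖w + 1 + (a - (k + 1) : ℤ)‖ ≤ n₀) :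
    ρ {t | ∀ n ≥ n₀, Stays k p a b (t.1 n)} = 0 := by
  have := hρ.isProbabilityMeasure hz hw
  set B : Set Path := {t | ∀ n ≥ n₀, Stays k p a b (t.1 n)} with hB
  set A : ℕ → Set Path := fun n => {t | ∀ j ≤ n, Stays k p a b (t.1 (n₀ + j))} with hA
  have hAdet : ∀ n, IsDetermined (n₀ + n) (A n) := by
    intro n t t' h ht j hj
    rw [← h (n₀ + j) (by omega)]
    exact ht j hj
  set D : ℕ → Set Path := fun n => {t | Exits k p a b (t.1 (n₀ + n + 1))} with hD
  have hC := exitConst_pos hz k hab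
  set q : ℕ → ℝ := fun n => exitConst z k a b / (n₀ + n + 1 : ℕ) with hq
  have hq0 : ∀ n, 0 < q n := fun n => div_pos hC (by positivity)
  have hstep : ∀ n, ENNReal.ofReal (q n) * ρ B ≤ ρ (A n ∩ D n) := by
    intro n
    classical
    have h := measure_inter_step_le hρ (hAdet n) (fun _ m => Stays k p a b m)
      (fun _ m => Exits k p a b m) (ENNReal.ofReal (q n)⁻¹) fun t ht =>
        tsum_stays_le hz hw hzw hab (by omega) (hN2.trans (by push_cast; linarith
          [(Nat.cast_nonneg n : (0 : ℝ) ≤ n)])) (ht n le_rfl)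
    have hsub : B ⊆ A n ∩ {t | Stays k p a b (t.1 (n₀ + n + 1))} := fun t ht =>
      ⟨fun j _ => ht _ (by omega), ht _ (by omega)⟩
    have h2 : ρ B ≤ ENNReal.ofReal (q n)⁻¹ * ρ (A n ∩ D n) := (measure_mono hsub).trans h
    calc ENNReal.ofReal (q n) * ρ B
        ≤ ENNReal.ofReal (q n) * (ENNReal.ofReal (q n)⁻¹ * ρ (A n ∩ D n)) := by gcongr
      _ = ρ (A n ∩ D n) := by
        rw [← mul_assoc, ← ENNReal.ofReal_mul (hq0 n).le, mul_inv_cancel₀ (hq0 n).ne',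
          ENNReal.ofReal_one, one_mul]
  have hsum : ∑' n, ρ (A n ∩ D n) ≤ 1 := by
    rw [← measure_iUnion]
    · exact prob_le_one
    · have hlt : ∀ n n', n < n' → Disjoint (A n ∩ D n) (A n' ∩ D n') := by
        intro n n' h
        refine Set.disjoint_left.2 ?_
        rintro t ⟨-, h1⟩ ⟨h2, -⟩
        exact h1 (h2 (n + 1) h)
      intro n n' hnn
      rcases lt_or_gt_of_ne hnn with h | h
      · exact hlt n n' h
      · exact (hlt n' n h).symm
    · exact fun n => (((hAdet n).mono (Nat.le_succ _)).inter (isDetermined_level (n₀ + n + 1)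
        fun m => Exits k p a b m)).measurableSet
  by_contra hne
  have h1 : (∑' n, ENNReal.ofReal (q n)) * ρ B ≤ 1 := by
    rw [← ENNReal.tsum_mul_right]
    exact (ENNReal.tsum_le_tsum hstep).trans hsum
  have h2 : ∑' n, ENNReal.ofReal (q n) ≠ ⊤ := by
    intro htop
    rw [htop, ENNReal.top_mul hne] at h1
    simp at h1
  have h3 := ENNReal.summable_toReal h2
  have h4 : Summable fun n : ℕ => 1 / (((n + (n₀ + 1) : ℕ)) : ℝ) := by
    refine (h3.mul_left (exitConst z k a b)⁻¹).congr fun n => ?_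
    rw [ENNReal.toReal_ofReal (hq0 n).le]
    simp only [hq]
    have e : n + (n₀ + 1) = n₀ + n + 1 := by omega
    rw [e]
    field_simp
  exact Real.not_summable_one_div_natCast
    ((summable_nat_add_iff (f := fun n : ℕ => 1 / (n : ℝ)) (n₀ + 1)).1 h4)

lemma row_mono (t : Path) {k n n' : ℕ} (hk : k < n) (h : n ≤ n') :
    (t.1 n).1 ⟨k, hk⟩ ≤ (t.1 n').1 ⟨k, hk.trans_le h⟩ := by
  induction n', h using Nat.le_induction with
  | base => exact le_rfl
  | succ m hm ih => exact ih.trans (t.2 m ⟨k, hk.trans_le hm⟩).1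

/-- Let `k` be the first bounded row: being monotone and integer-valued it stabilizes at its maximum
`a`, while the rows above are unbounded and eventually exceed `a + 2`. A box missing from the
negative diagrams bounds from below all but the last `p` rows. -/
lemma exists_stays {t : Path} (hp : t ∉ Gpos) (hn : t ∉ Gneg) :
    ∃ (k p : ℕ) (a b : ℤ), 0 ≤ a + b ∧ ∀ᶠ n in atTop, Stays k p a b (t.1 n) := by
  classical
  have hp' : ∃ i : ℕ, ∃ j : ℤ, ∀ n, ∀ h : i < n, (t.1 n).1 ⟨i, h⟩ ≤ j := by
    have hp1 : ¬ (⋃ N : ℕ, posDiagram (t.1 N)) = Set.univ := hp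
    rw [Set.eq_univ_iff_forall] at hp1
    push Not at hp1
    obtain ⟨⟨i, j⟩, hij⟩ := hp1
    refine ⟨i, j, fun n h => ?_⟩
    by_contra hcon
    exact hij (Set.mem_iUnion.2 ⟨n, h, by simp only at hcon ⊢; omega⟩)
  obtain ⟨p, q, hq⟩ : ∃ p : ℕ, ∃ q : ℤ, ∀ n, ∀ h : p < n, -q ≤ (t.1 n).1 (Fin.rev ⟨p, h⟩) := by
    have hn1 : ¬ (⋃ N : ℕ, negDiagram (t.1 N)) = Set.univ := hn
    rw [Set.eq_univ_iff_forall] at hn1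
    push Not at hn1
    obtain ⟨⟨i, j⟩, hij⟩ := hn1
    refine ⟨i, j, fun n h => ?_⟩
    by_contra hcon
    exact hij (Set.mem_iUnion.2 ⟨n, h, by simp only at hcon ⊢; omega⟩)
  set k := Nat.find hp' with hk
  obtain ⟨j, hj⟩ := Nat.find_spec hp'
  obtain ⟨a, ⟨n₁, hn₁, ha⟩, hmax⟩ := Int.exists_greatest_of_bdd
    (P := fun v => ∃ n, ∃ h : k < n, (t.1 n).1 ⟨k, h⟩ = v)
    ⟨j, fun v ⟨n, h, hv⟩ => hv ▸ hj n h⟩ ⟨_, k + 1, Nat.lt_succ_self k, rfl⟩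
  refine ⟨k, p, a, max q (-a), by omega, ?_⟩
  have hev : ∀ᶠ n in atTop, ∀ i : Fin k, ∀ h : (i : ℕ) < n, a + 2 ≤ (t.1 n).1 ⟨i, h⟩ := by
    refine eventually_all.2 fun i => ?_
    have := Nat.find_min hp' i.2
    push Not at this
    obtain ⟨n, h, hlt⟩ := this (a + 2)
    filter_upwards [eventually_ge_atTop n] with n' hn' h'
    exact hlt.le.trans (row_mono t h hn')
  filter_upwards [hev, eventually_ge_atTop n₁, eventually_gt_atTop p] with n h1 h2 h3
  refine ⟨hn₁.trans_le h2, ?_, fun i hi => h1 ⟨i, hi⟩ i.2, fun i hi => ?_⟩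
  · refine le_antisymm (hmax _ ⟨n, _, rfl⟩) ?_
    rw [← ha]
    exact row_mono t hn₁ h2
  · have h4 := hq n h3
    have h5 : (t.1 n).1 (Fin.rev ⟨p, h3⟩) ≤ (t.1 n).1 i := by
      refine (t.1 n).2 (Fin.le_def.2 ?_)
      rw [Fin.val_rev]
      simp only
      omega
    omega

/-- Almost every path exhausts the quadrant by its positive or by its negative diagrams. -/
theorem measure_compl_Gpos_union_Gneg (hz : ∀ n : ℤ, z ≠ n) (hw : ∀ n : ℤ, w ≠ n)
    (hzw : -(1 / 2 : ℝ) < (z + w).re) {ρ : Measure Path} (hρ : IsZWMeasure z w ρ) :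
    ρ (Gpos ∪ Gneg)ᶜ = 0 := by
  have hnull : ∀ (k p : ℕ) (a b : ℤ), 0 ≤ a + b →
      ρ {t | ∀ᶠ n in atTop, Stays k p a b (t.1 n)} = 0 := by
    intro k p a b hab
    obtain ⟨n₁, hn₁⟩ := exists_nat_ge ‖w + 1 + (a - (k + 1) : ℤ)‖
    refine measure_mono_null (t := ⋃ n : ℕ, {t : Path | ∀ n' ≥ n + n₁ + 2 * (p + k),
      Stays k p a b (t.1 n')}) ?_ (measure_iUnion_null fun n => measure_stays_eq_zero hz hw hzw hρ
        hab (by omega) (hn₁.trans (by exact_mod_cast (by omega))))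
    intro t ht
    obtain ⟨n, hn⟩ := eventually_atTop.1 ht
    exact Set.mem_iUnion.2 ⟨n, fun n' hn' => hn n' (by omega)⟩
  have hsub : (Gpos ∪ Gneg)ᶜ ⊆ ⋃ x : {x : ℕ × ℕ × ℤ × ℤ // 0 ≤ x.2.2.1 + x.2.2.2},
      {t : Path | ∀ᶠ n in atTop, Stays x.1.1 x.1.2.1 x.1.2.2.1 x.1.2.2.2 (t.1 n)} := by
    intro t ht
    rw [Set.mem_compl_iff, Set.mem_union, not_or] at ht
    obtain ⟨k, p, a, b, hab, h⟩ := exists_stays ht.1 ht.2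
    exact Set.mem_iUnion.2 ⟨⟨(k, p, a, b), hab⟩, h⟩
  exact measure_mono_null hsub (measure_iUnion_null fun x => hnull _ _ _ _ x.2)

end Exit

/-! ### Martingale convergence and mutual singularity. -/

section Singular

variable {z w z' w' : ℂ}

/-- The filtration generated by the initial segments of a path. -/
def levelFiltration : Filtration ℕ (inferInstance : MeasurableSpace Path) where
  seq n := MeasurableSpace.comap (initialSegment n) ⊤
  mono' := by
    rintro n n' h A ⟨U, -, rfl⟩
    have hdet : IsDetermined n (initialSegment n ⁻¹' U) := fun t t' ht hU => by
      rw [Set.mem_preimage, ← initialSegment_eq_iff.2 ht]; exact hU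
    exact ⟨_, trivial, (hdet.mono h).eq_preimage.symm⟩
  le' := by
    rintro n A ⟨U, -, rfl⟩
    have hdet : IsDetermined n (initialSegment n ⁻¹' U) := fun t t' ht hU => by
      rw [Set.mem_preimage, ← initialSegment_eq_iff.2 ht]; exact hU
    exact hdet.measurableSet

lemma isDetermined_of_measurableSet {n : ℕ} {A : Set Path}
    (hA : MeasurableSet[levelFiltration n] A) : IsDetermined n A := by
  obtain ⟨U, -, rfl⟩ := hA
  intro t t' ht hU
  rw [Set.mem_preimage, ← initialSegment_eq_iff.2 ht]; exact hU

lemma measurable_level (n : ℕ) (F : Signature n → ℝ) :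
    Measurable[levelFiltration n] fun t : Path => F (t.1 n) := by
  intro U _
  exact ⟨{p | F (p (Fin.last n)) ∈ U}, trivial, rfl⟩

/-- The ratio of the cylinder masses is the density on the paths of finite length. -/
lemma setLIntegral_ratio (hz : ∀ n : ℤ, z ≠ n) (hw : ∀ n : ℤ, w ≠ n)
    (hz' : ∀ n : ℤ, z' ≠ n) (hw' : ∀ n : ℤ, w' ≠ n)
    (hzw : -(1 / 2 : ℝ) < (z + w).re) (hzw' : -(1 / 2 : ℝ) < (z' + w').re)
    {ρ ρ' : Measure Path} (hρ : IsZWMeasure z w ρ) (hρ' : IsZWMeasure z' w' ρ')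
    {n : ℕ} {A : Set Path} (hA : IsDetermined n A) :
    ∫⁻ t in A, ENNReal.ofReal (P z w (t.1 n) / P z' w' (t.1 n)) ∂ρ' = ρ A := by
  have hU : A = ⋃ p, initialSegment n ⁻¹' {p} ∩ A := by ext t; simp
  rw [measure_eq_tsum_fibers ρ n hA.measurableSet]
  conv_lhs => rw [hU]
  rw [lintegral_iUnion]
  · refine tsum_congr fun p => ?_
    by_cases hp : ∃ t ∈ A, initialSegment n t = p
    · obtain ⟨t, htA, rfl⟩ := hp
      have hsub : cylinder t.1 n ⊆ A := fun t' ht' => hA t t' (fun i hi => (ht' i hi).symm) htA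
      rw [preimage_initialSegment, Set.inter_eq_left.2 hsub,
        setLIntegral_congr_fun (measurableSet_cylinder (isFinitePath t n))
          (g := fun _ => ENNReal.ofReal (P z w (t.1 n) / P z' w' (t.1 n)))
          (fun t' ht' => by simp only [ht' n le_rfl]),
        setLIntegral_const, hρ n t.1 (isFinitePath t n), hρ' n t.1 (isFinitePath t n),
        ← ENNReal.ofReal_mul (ratio_pos hz hw hz' hw' hzw hzw' _).le,
        div_mul_cancel₀ _ (P_pos hz' hw' hzw' _).ne']
    · have : initialSegment n ⁻¹' {p} ∩ A = ∅ := by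
        ext t
        simp only [Set.mem_inter_iff, Set.mem_empty_iff_false, iff_false]
        rintro ⟨h1, h2⟩
        exact hp ⟨t, h2, h1⟩
      rw [this]; simp
  · exact fun p => (measurableSet_fiber n p).inter hA.measurableSet
  · intro p q hpq
    refine Set.disjoint_left.2 ?_
    rintro t ⟨h1, -⟩ ⟨h2, -⟩
    exact hpq (h1.symm.trans h2)

/-- The ratio is a density on each level of the filtration, hence a nonnegative `ρ'`-martingale of
mean one, and Doob's theorem applies. -/
lemma ae_exists_tendsto_ratio (hz : ∀ n : ℤ, z ≠ n) (hw : ∀ n : ℤ, w ≠ n)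
    (hz' : ∀ n : ℤ, z' ≠ n) (hw' : ∀ n : ℤ, w' ≠ n)
    (hzw : -(1 / 2 : ℝ) < (z + w).re) (hzw' : -(1 / 2 : ℝ) < (z' + w').re)
    {ρ ρ' : Measure Path} (hρ : IsZWMeasure z w ρ) (hρ' : IsZWMeasure z' w' ρ') :
    ∀ᵐ t ∂ρ', ∃ c : ℝ, Tendsto (fun n => P z w (t.1 n) / P z' w' (t.1 n)) atTop (𝓝 c) := by
  have := hρ.isProbabilityMeasure hz hw
  have := hρ'.isProbabilityMeasure hz' hw'
  set f : ℕ → Path → ℝ := fun n t => P z w (t.1 n) / P z' w' (t.1 n) with hf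
  have hf0 : ∀ n t, 0 ≤ f n t := fun n t => (ratio_pos hz hw hz' hw' hzw hzw' _).le
  have hmeas : ∀ n, Measurable[levelFiltration n] (f n) := fun n =>
    measurable_level n fun l => P z w l / P z' w' l
  have hmeas' : ∀ n, Measurable (f n) := fun n => (hmeas n).mono (levelFiltration.le n) le_rfl
  have hlint : ∀ {n : ℕ} {A : Set Path}, IsDetermined n A →
      ∫⁻ t in A, ENNReal.ofReal (f n t) ∂ρ' = ρ A := fun hA =>
    setLIntegral_ratio hz hw hz' hw' hzw hzw' hρ hρ' hA
  have hlint1 : ∀ n, ∫⁻ t, ENNReal.ofReal (f n t) ∂ρ' = 1 := fun n => by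
    rw [← setLIntegral_univ, hlint (n := n) (A := Set.univ) fun _ _ _ _ => trivial, measure_univ]
  have hint : ∀ n, Integrable (f n) ρ' := fun n => by
    refine ⟨(hmeas' n).aestronglyMeasurable, ?_⟩
    rw [hasFiniteIntegral_iff_ofReal (Eventually.of_forall (hf0 n)), hlint1]
    exact ENNReal.one_lt_top
  have hset : ∀ {n : ℕ} {A : Set Path}, IsDetermined n A →
      ∫ t in A, f n t ∂ρ' = (ρ A).toReal := fun {n A} hA => by
    rw [integral_eq_lintegral_of_nonneg_ae (Eventually.of_forall (hf0 n))
      (hmeas' n).aestronglyMeasurable, hlint hA]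
  have hmart : Martingale f levelFiltration ρ' := by
    refine martingale_of_setIntegral_eq_succ (fun n => (hmeas n).stronglyMeasurable) hint ?_
    intro n A hA
    have hA' := isDetermined_of_measurableSet hA
    rw [hset hA', hset (hA'.mono (Nat.le_succ n))]
  have hlim := hmart.submartingale.ae_tendsto_limitProcess (R := 1) fun n => by
    rw [eLpNorm_one_eq_lintegral_enorm, ENNReal.coe_one, ← hlint1 n]
    refine lintegral_mono fun t => ?_
    rw [Real.enorm_of_nonneg (hf0 n t)]
  filter_upwards [hlim] with t ht
  exact ⟨_, ht⟩

/-- The set `Z` where the density tends to zero carries `ρ'`, as nonzero limits occur only on `Q`.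
It is `ρ`-null because the set where the `n`-th density is below `ε` has `ρ`-mass at most `ε`. -/
lemma mutuallySingular_of_measure_Q (hz : ∀ n : ℤ, z ≠ n) (hw : ∀ n : ℤ, w ≠ n)
    (hz' : ∀ n : ℤ, z' ≠ n) (hw' : ∀ n : ℤ, w' ≠ n)
    (hzw : -(1 / 2 : ℝ) < (z + w).re) (hzw' : -(1 / 2 : ℝ) < (z' + w').re)
    {ρ ρ' : Measure Path} (hρ : IsZWMeasure z w ρ) (hρ' : IsZWMeasure z' w' ρ')
    (hQ : ρ' (Q z w z' w') = 0) : ρ.MutuallySingular ρ' := by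
  have := hρ'.isProbabilityMeasure hz' hw'
  set Z : Set Path := {t | Tendsto (fun n => P z w (t.1 n) / P z' w' (t.1 n)) atTop (𝓝 0)} with hZ
  have h1 : ρ' Zᶜ = 0 := by
    rw [← mem_ae_iff]
    have hQ' : ∀ᵐ t ∂ρ', t ∉ Q z w z' w' := measure_eq_zero_iff_ae_notMem.1 hQ
    filter_upwards [ae_exists_tendsto_ratio hz hw hz' hw' hzw hzw' hρ hρ', hQ'] with t ht hq
    obtain ⟨c, hc⟩ := ht
    rcases eq_or_ne c 0 with rfl | h0
    · exact hc
    · exact absurd ⟨c, h0, hc⟩ hq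
  have h2 : ρ Z = 0 := by
    refine le_antisymm (ENNReal.le_of_forall_pos_le_add fun ε hε _ => ?_) zero_le
    rw [zero_add]
    set E : ℕ → Set Path := fun n => {t | P z w (t.1 n) / P z' w' (t.1 n) < ε} with hE
    have hEle : ∀ n, ρ (E n) ≤ ε := fun n => by
      have hdet : IsDetermined n (E n) :=
        isDetermined_level n fun l => P z w l / P z' w' l < ε
      rw [← setLIntegral_ratio hz hw hz' hw' hzw hzw' hρ hρ' hdet]
      calc _ ≤ ∫⁻ _ in E n, (ε : ENNReal) ∂ρ' := by
            refine setLIntegral_mono measurable_const fun t ht => ?_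
            rw [← ENNReal.ofReal_coe_nnreal]
            exact ENNReal.ofReal_le_ofReal (le_of_lt ht)
        _ = ε * ρ' (E n) := by rw [setLIntegral_const]
        _ ≤ ε * 1 := by gcongr; exact prob_le_one
        _ = ε := mul_one _
    have hsub : Z ⊆ ⋃ n : ℕ, ⋂ j ≥ n, E j := by
      intro t ht
      obtain ⟨n, hn⟩ := eventually_atTop.1 (Tendsto.eventually_lt_const
        (show (0 : ℝ) < ε by exact_mod_cast hε) ht)
      exact Set.mem_iUnion.2 ⟨n, Set.mem_iInter₂.2 fun j hj => hn j hj⟩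
    refine (measure_mono hsub).trans ?_
    rw [Monotone.measure_iUnion]
    · refine iSup_le fun n => (measure_mono ?_).trans (hEle n)
      exact Set.iInter₂_subset n le_rfl
    · intro n n' h
      exact Set.biInter_subset_biInter_left fun j hj => le_trans h hj
  exact Measure.MutuallySingular.mk h2 h1 (by rw [Set.union_compl_self])

end Singular

/-! ### Duality of signatures and the passage from `Gpos` to `Gneg`. -/

section Reflection

variable {z w z' w' : ℂ}

/-- The dual signature `-l_N ≥ … ≥ -l_1`. -/
def dual {N : ℕ} (l : Signature N) : Signature N :=
  ⟨fun i => -l.1 (Fin.rev i), fun _ _ h => neg_le_neg (l.2 (Fin.rev_le_rev.2 h))⟩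

lemma dual_dual {N : ℕ} (l : Signature N) : dual (dual l) = l :=
  Subtype.ext (funext fun i => by simp [dual])

lemma interlaces_dual {N : ℕ} {l : Signature N} {m : Signature (N + 1)} (h : Interlaces l m) :
    Interlaces (dual l) (dual m) := by
  intro i
  have := h (Fin.rev i)
  simp only [dual, Fin.rev_castSucc, Fin.rev_succ]
  omega

/-- A product over all pairs lets both indices be reversed and exchanged freely. -/
lemma dimFun_eq_prod_ite {N : ℕ} (v : Fin N → ℤ) :
    dimFun v = ∏ i : Fin N, ∏ j : Fin N, if i < j then
      ((v i : ℝ) - (v j : ℝ) + (j : ℝ) - (i : ℝ)) / ((j : ℝ) - (i : ℝ)) else 1 := by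
  unfold dimFun
  refine Finset.prod_congr rfl fun i _ => ?_
  rw [← Finset.prod_filter]
  refine Finset.prod_congr ?_ fun _ _ => rfl
  ext j; simp

lemma dimFun_dual {N : ℕ} (l : Signature N) : dimFun (dual l).1 = dimFun l.1 := by
  rw [dimFun_eq_prod_ite, dimFun_eq_prod_ite, Finset.prod_comm, ← Equiv.prod_comp Fin.revPerm]
  refine Finset.prod_congr rfl fun i _ => ?_
  rw [← Equiv.prod_comp Fin.revPerm]
  refine Finset.prod_congr rfl fun j _ => ?_
  simp only [Fin.revPerm_apply, Fin.rev_lt_rev, dual, Fin.rev_rev]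
  split_ifs with h
  · have h1 : ((Fin.rev i : Fin N) : ℝ) = N - 1 - (i : ℕ) := by
      rw [Fin.val_rev, Nat.cast_sub (by omega)]; push_cast; ring
    have h2 : ((Fin.rev j : Fin N) : ℝ) = N - 1 - (j : ℕ) := by
      rw [Fin.val_rev, Nat.cast_sub (by omega)]; push_cast; ring
    rw [h1, h2]
    push_cast
    congr 1 <;> ring
  · rfl

lemma gammaFun_dual {N : ℕ} (l : Signature N) : gammaFun z w (dual l).1 = gammaFun w z l.1 := by
  unfold gammaFun
  rw [← Equiv.prod_comp Fin.revPerm]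
  refine Finset.prod_congr rfl fun i _ => ?_
  rw [gammaFactor_swap]
  congr 1
  simp only [shifted, dual, Fin.revPerm_apply, Fin.rev_rev, Fin.val_rev]
  have := i.2
  push_cast
  omega

lemma S_swap (N : ℕ) : S z w N = S w z N := by
  let e : Signature N ≃ Signature N := ⟨dual, dual, dual_dual, dual_dual⟩
  rw [S, S, ← Equiv.tsum_eq e]
  refine tsum_congr fun l => ?_
  show gammaWeight z w (dual l) * Dim (dual l) ^ 2 = _
  rw [gammaWeight_eq_gammaFun, gammaWeight_eq_gammaFun, Dim_eq_dimFun, Dim_eq_dimFun, dimFun_dual,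
    gammaFun_dual]

lemma P_dual {N : ℕ} (l : Signature N) : P z w (dual l) = P w z l := by
  rw [P_eq, P_eq, pathWeight, pathWeight, dimFun_dual, gammaFun_dual, S_swap]

/-- The reflection of the path space. -/
def dualPath (t : Path) : Path := ⟨fun N => dual (t.1 N), fun N => interlaces_dual (t.2 N)⟩

lemma preimage_dualPath_cylinder (s : ∀ n : ℕ, Signature n) (N : ℕ) :
    dualPath ⁻¹' cylinder s N = cylinder (fun n => dual (s n)) N := by
  ext t
  refine forall₂_congr fun n _ => ?_
  show dual (t.1 n) = s n ↔ t.1 n = dual (s n)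
  constructor
  · intro h; rw [← h, dual_dual]
  · intro h; rw [h, dual_dual]

lemma measurable_dualPath : Measurable dualPath := by
  refine measurable_generateFrom ?_
  rintro C ⟨N, s, hs, rfl⟩
  rw [preimage_dualPath_cylinder]
  exact measurableSet_cylinder fun n hn => interlaces_dual (hs n hn)

lemma IsZWMeasure.map_dualPath {ρ : Measure Path} (hρ : IsZWMeasure z w ρ) :
    IsZWMeasure w z (ρ.map dualPath) := by
  intro N s hs
  rw [Measure.map_apply measurable_dualPath (measurableSet_cylinder hs),
    preimage_dualPath_cylinder, hρ N _ fun n hn => interlaces_dual (hs n hn), P_dual]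

theorem measure_Q_inter_Gneg (hz : ∀ n : ℤ, z ≠ n) (hw : ∀ n : ℤ, w ≠ n)
    (hz' : ∀ n : ℤ, z' ≠ n) (hw' : ∀ n : ℤ, w' ≠ n)
    (hzw : -(1 / 2 : ℝ) < (z + w).re) (hzw' : -(1 / 2 : ℝ) < (z' + w').re)
    (hne : ({w, conj w} : Set ℂ) ≠ {w', conj w'}) {ρ : Measure Path} (hρ : IsZWMeasure z w ρ) :
    ρ (Q z w z' w' ∩ Gneg) = 0 := by
  have h := measure_Q_inter_Gpos hw hz hw' hz' (by rwa [add_comm]) (by rwa [add_comm]) hne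
    hρ.map_dualPath
  have h1 := Measure.preimage_null_of_map_null measurable_dualPath.aemeasurable h
  refine measure_mono_null ?_ h1
  rintro t ⟨⟨c, hc, hlim⟩, ht⟩
  -- The negative diagram of a signature is by definition the positive diagram of its dual, so `ht`
  -- serves unchanged.
  refine ⟨⟨c, hc, hlim.congr fun n => ?_⟩, ht⟩
  show _ = P w z (dual (t.1 n)) / P w' z' (dual (t.1 n))
  rw [P_dual, P_dual]

end Reflection

/-! ### Symmetry in the two parameter pairs, and the main theorem. -/

lemma Q_symm (z w z' w' : ℂ) : Q z w z' w' ⊆ Q z' w' z w := by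
  rintro t ⟨c, hc, h⟩
  refine ⟨c⁻¹, inv_ne_zero hc, (h.inv₀ hc).congr fun n => ?_⟩
  rw [inv_div]

end GelfandTsetlin

theorem theorem3 (z w z' w' : ℂ)
    (hz : ∀ n : ℤ, z ≠ (n : ℂ)) (hw : ∀ n : ℤ, w ≠ (n : ℂ))
    (hz' : ∀ n : ℤ, z' ≠ (n : ℂ)) (hw' : ∀ n : ℤ, w' ≠ (n : ℂ))
    (hzw : -(1 / 2 : ℝ) < (z + w).re) (hzw' : -(1 / 2 : ℝ) < (z' + w').re) :
    (∃! ρ : Measure GelfandTsetlin.Path, GelfandTsetlin.IsZWMeasure z w ρ) ∧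
    (∃! ρ' : Measure GelfandTsetlin.Path, GelfandTsetlin.IsZWMeasure z' w' ρ') ∧
    ∀ ρ ρ' : Measure GelfandTsetlin.Path,
      GelfandTsetlin.IsZWMeasure z w ρ → GelfandTsetlin.IsZWMeasure z' w' ρ' →
        (({z, conj z} : Set ℂ) ≠ {z', conj z'} →
          ρ (GelfandTsetlin.Q z w z' w' ∩ GelfandTsetlin.Gpos) = 0 ∧
          ρ' (GelfandTsetlin.Q z w z' w' ∩ GelfandTsetlin.Gpos) = 0) ∧
        (({w, conj w} : Set ℂ) ≠ {w', conj w'} →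
          ρ (GelfandTsetlin.Q z w z' w' ∩ GelfandTsetlin.Gneg) = 0 ∧
          ρ' (GelfandTsetlin.Q z w z' w' ∩ GelfandTsetlin.Gneg) = 0) ∧
        (({z, conj z} : Set ℂ) ≠ {z', conj z'} → ({w, conj w} : Set ℂ) ≠ {w', conj w'} →
          ρ.MutuallySingular ρ') := by

  refine ⟨GelfandTsetlin.existsUnique_isZWMeasure hz hw hzw,
    GelfandTsetlin.existsUnique_isZWMeasure hz' hw' hzw', fun ρ ρ' hρ hρ' => ?_⟩
  have pos : ({z, conj z} : Set ℂ) ≠ {z', conj z'} →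
      ρ (GelfandTsetlin.Q z w z' w' ∩ GelfandTsetlin.Gpos) = 0 ∧
      ρ' (GelfandTsetlin.Q z w z' w' ∩ GelfandTsetlin.Gpos) = 0 := fun h =>
    ⟨GelfandTsetlin.measure_Q_inter_Gpos hz hw hz' hw' hzw hzw' h hρ,
      measure_mono_null (Set.inter_subset_inter_left _ (GelfandTsetlin.Q_symm _ _ _ _))
        (GelfandTsetlin.measure_Q_inter_Gpos hz' hw' hz hw hzw' hzw h.symm hρ')⟩
  have neg : ({w, conj w} : Set ℂ) ≠ {w', conj w'} →
      ρ (GelfandTsetlin.Q z w z' w' ∩ GelfandTsetlin.Gneg) = 0 ∧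
      ρ' (GelfandTsetlin.Q z w z' w' ∩ GelfandTsetlin.Gneg) = 0 := fun h =>
    ⟨GelfandTsetlin.measure_Q_inter_Gneg hz hw hz' hw' hzw hzw' h hρ,
      measure_mono_null (Set.inter_subset_inter_left _ (GelfandTsetlin.Q_symm _ _ _ _))
        (GelfandTsetlin.measure_Q_inter_Gneg hz' hw' hz hw hzw' hzw h.symm hρ')⟩
  refine ⟨pos, neg, fun h1 h2 => ?_⟩
  -- It suffices that `Q` is `ρ'`-null, and it is covered by its parts in `Gpos` and `Gneg` and the
  -- null complement of their union.
  refine GelfandTsetlin.mutuallySingular_of_measure_Q hz hw hz' hw' hzw hzw' hρ hρ' ?_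
  refine measure_mono_null (fun t ht => ?_) (measure_union_null (measure_union_null (pos h1).2
    (neg h2).2) (GelfandTsetlin.measure_compl_Gpos_union_Gneg hz' hw' hzw' hρ'))
  by_cases hp : t ∈ GelfandTsetlin.Gpos
  · exact Or.inl (Or.inl ⟨ht, hp⟩)
  · by_cases hn : t ∈ GelfandTsetlin.Gneg
    · exact Or.inl (Or.inr ⟨ht, hn⟩)
    · exact Or.inr fun h => h.elim hp hn
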